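/- Let $X$ be a compact connected Riemann surface, let $r\ge 3$, and let $B$ be a nondegenerate symmetric bilinear form on $\mathbb{C}^r$. Let $\operatorname{GO}(r,\mathbb{C})=\{A\in \operatorname{GL}(r,\mathbb{C}) : A^tBA=cB \text{ for some } c\in\mathbb{C}^*\}$. Let $(E,\varphi:E\otimes E\to L)$ be an orthogonal bundle of rank $r$ and degree $d$ on $X$, i.e. $E$ is a holomorphic vector bundle, $L$ a holomorphic line bundle and $\varphi$ a symmetric nondegenerate holomorphic homomorphism. Let $P$ be the corresponding principal $\operatorname{GO}(r,\mathbb{C})$-bundle, whose fibre over $x$ is the set of linear isomorphisms $u:\mathbb{C}^r\to E_x$ with $\varphi(u(v),u(w))=B(v,w)\,t$ for some nonzero $t\in L_x$ and all $v,w$. Let $H\subset E$ be a holomorphic subbundle with $\varphi|_{H\otimes H}=0$, of rank $s\ge 1$ and degree $e$. Fix a $B$-isotropic subspace $W\subset\mathbb{C}^r$ of dimension $s$, let $Q\subset\operatorname{GO}(r,\mathbb{C})$ be the (maximal parabolic) subgroup preserving $W$, let $\mathfrak q$ be its Lie algebra, and let $P^Q\subset P$ be the set of those $u$ with $u(W)=H_x$.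 Then $P^Q$ is a holomorphic reduction of structure group of $P$ to $Q$ (it has holomorphic sections near every point of $X$), the adjoint bundle $P^Q(\mathfrak q)=P^Q\times^Q\mathfrak q$ is a holomorphic vector bundle of rank $\dim\mathfrak q$, and $$\deg P^Q(\mathfrak q)=\Big(\frac es-\frac dr\Big)\,s\,(r-s-1),\qquad \dim\mathfrak q=\frac{r^2-r}{2}-\frac{2rs-3s^2-s}{2}+1 .$$ Here the degree of a holomorphic vector bundle is the integral over $X$ of the Chern form $\frac{i}{2\pi}\Theta$ of any Hermitian metric on its determinant line bundle. -/

import Mathlib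

open scoped Manifold ContDiff Matrix Topology InnerProductSpace
open Bundle Set

noncomputable section

namespace OrthBundle

/-! ### Integration of real 2-forms on a compact Riemann surface

A real 2-form is recorded by its coefficient functions with respect to `dx ∧ dy` in all holomorphic
coordinates `c`. -/

section Integration

theorem exists_chartPartition (X : Type*) [TopologicalSpace X] [T2Space X] [CompactSpace X]
    [ChartedSpace ℂ X] :
    ∃ ρ : PartitionOfUnity X X (univ : Set X),
      ρ.IsSubordinate (fun x => (chartAt ℂ x).source) :=
  PartitionOfUnity.exists_isSubordinate isClosed_univ _ (fun x => (chartAt ℂ x).open_source)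
    (fun x _ => mem_iUnion.2 ⟨x, mem_chart_source ℂ x⟩)

/-- A partition of unity subordinate to the cover by coordinate neighbourhoods. -/
def chartPartition (X : Type*) [TopologicalSpace X] [T2Space X] [CompactSpace X]
    [ChartedSpace ℂ X] : PartitionOfUnity X X (univ : Set X) :=
  (exists_chartPartition X).choose

/-- The integral of the 2-form whose coefficient in the coordinate `c` is `κ c`. -/
def surfaceIntegral (X : Type*) [TopologicalSpace X] [T2Space X] [CompactSpace X]
    [ChartedSpace ℂ X] (κ : OpenPartialHomeomorph X ℂ → ℂ → ℝ) : ℝ :=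
  ∑ᶠ x : X, ∫ z in (chartAt ℂ x).target,
    chartPartition X x ((chartAt ℂ x).symm z) * κ (chartAt ℂ x) z

end Integration

/-! ### Holomorphic bundles and their degree

A holomorphic bundle is given here by its fibres `V x` and by the predicate `hol σ U` saying that
the section `σ` is holomorphic on `U`. -/

section Degree

variable {X : Type*} [TopologicalSpace X]

/-- `b` is a holomorphic frame of rank `n` on the open set `U`. -/
def IsHolFrame {V : X → Type*} [∀ x, AddCommGroup (V x)] [∀ x, Module ℂ (V x)]
    (hol : (∀ x, V x) → Set X → Prop) {n : ℕ} (b : ∀ x, Module.Basis (Fin n) ℂ (V x))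
    (U : Set X) : Prop :=
  IsOpen U ∧ ∀ i, hol (fun x => b x i) U

/-- Holomorphic frames of rank `n` exist near every point. -/
def HasLocalFrames {V : X → Type*} [∀ x, AddCommGroup (V x)] [∀ x, Module ℂ (V x)]
    (hol : (∀ x, V x) → Set X → Prop) (n : ℕ) : Prop :=
  ∀ x₀ : X, ∃ (b : ∀ x, Module.Basis (Fin n) ℂ (V x)) (U : Set X), x₀ ∈ U ∧ IsHolFrame hol b U

/-- A smooth Hermitian metric on the determinant line bundle of a rank `n` holomorphic bundle:
`normSq x b` is the squared length of `b₁ ∧ ⋯ ∧ bₙ` for a basis `b` of the fibre over `x`. -/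
structure DetMetric [ChartedSpace ℂ X] (V : X → Type*) [∀ x, AddCommGroup (V x)]
    [∀ x, Module ℂ (V x)] (hol : (∀ x, V x) → Set X → Prop) (n : ℕ) where
  normSq : ∀ x, Module.Basis (Fin n) ℂ (V x) → ℝ
  pos : ∀ x b, 0 < normSq x b
  change : ∀ x (b b' : Module.Basis (Fin n) ℂ (V x)),
    normSq x b' = ‖b.det (fun i => b' i)‖ ^ 2 * normSq x b
  smooth : ∀ (b : ∀ x, Module.Basis (Fin n) ℂ (V x)) (U : Set X), IsHolFrame hol b U →
    ContMDiffOn 𝓘(ℝ, ℂ) 𝓘(ℝ, ℝ) ∞ (fun x => normSq x (b x)) U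

open Classical in
/-- The coefficient of `dx ∧ dy` in the coordinate `c` of the Chern form
`(i / 2π) ∂̄∂ log ‖b₁ ∧ ⋯ ∧ bₙ‖² = -(1 / 4π) Δ log ‖b₁ ∧ ⋯ ∧ bₙ‖² dx ∧ dy`, where `b` is any
holomorphic frame near the point with coordinate `z`. -/
def DetMetric.chernForm [ChartedSpace ℂ X] {V : X → Type*} [∀ x, AddCommGroup (V x)]
    [∀ x, Module ℂ (V x)] {hol : (∀ x, V x) → Set X → Prop} {n : ℕ}
    (N : DetMetric V hol n) (c : OpenPartialHomeomorph X ℂ) (z : ℂ) : ℝ :=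
  if h : ∃ (b : ∀ x, Module.Basis (Fin n) ℂ (V x)) (U : Set X), c.symm z ∈ U ∧ IsHolFrame hol b U
  then -(1 / (4 * Real.pi)) *
    Laplacian.laplacian
      (fun w : ℂ => Real.log (N.normSq (c.symm w) (h.choose (c.symm w)))) z
  else 0

open Classical in
/-- The degree of a rank `n` holomorphic bundle: the integral of the Chern form of a Hermitian
metric on its determinant line bundle (any one, the integral does not depend on it). -/
def degreeOf [T2Space X] [CompactSpace X] [ChartedSpace ℂ X] (V : X → Type*)
    [∀ x, AddCommGroup (V x)] [∀ x, Module ℂ (V x)]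
    (hol : (∀ x, V x) → Set X → Prop) (n : ℕ) : ℝ :=
  if h : Nonempty (DetMetric V hol n) then surfaceIntegral X h.some.chernForm else 0

/-- Holomorphic sections, over subsets of the base, of a holomorphic vector bundle. -/
def IsHolSection [ChartedSpace ℂ X] (F : Type*) [NormedAddCommGroup F] [NormedSpace ℂ F]
    (E : X → Type*) [TopologicalSpace (TotalSpace F E)] [∀ x, TopologicalSpace (E x)]
    [FiberBundle F E] (σ : ∀ x, E x) (U : Set X) : Prop :=
  ContMDiffOn 𝓘(ℂ) (𝓘(ℂ).prod 𝓘(ℂ, F)) ω (fun x => TotalSpace.mk' F x (σ x)) U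

/-- The degree of a holomorphic vector bundle on a compact Riemann surface. -/
def degree [T2Space X] [CompactSpace X] [ChartedSpace ℂ X] (F : Type*) [NormedAddCommGroup F]
    [NormedSpace ℂ F] (E : X → Type*) [TopologicalSpace (TotalSpace F E)]
    [∀ x, AddCommGroup (E x)] [∀ x, Module ℂ (E x)] [∀ x, TopologicalSpace (E x)]
    [FiberBundle F E] : ℝ :=
  degreeOf E (IsHolSection F E) (Module.finrank ℂ F)

end Degree

/-! ### The general orthogonal group, its parabolic subgroups and their Lie algebras -/

section Group

variable {r : ℕ}

/-- The group of conformally orthogonal matrices: `Aᵗ B A = c B` with `c ≠ 0`. -/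
def GO (B : Matrix (Fin r) (Fin r) ℂ) : Subgroup (GL (Fin r) ℂ) where
  carrier := {A | ∃ c : ℂ, c ≠ 0 ∧ 
    (A : Matrix (Fin r) (Fin r) ℂ)ᵀ * B * (A : Matrix (Fin r) (Fin r) ℂ) = c • B}
  one_mem' := ⟨1, one_ne_zero, by simp⟩
  mul_mem' := by
    rintro A A' ⟨c, hc, h⟩ ⟨c', hc', h'⟩
    refine ⟨c * c', mul_ne_zero hc hc', ?_⟩
    have : ((A * A' : GL (Fin r) ℂ) : Matrix (Fin r) (Fin r) ℂ)ᵀ * B *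
        ((A * A' : GL (Fin r) ℂ) : Matrix (Fin r) (Fin r) ℂ) =
        (A' : Matrix (Fin r) (Fin r) ℂ)ᵀ * ((A : Matrix (Fin r) (Fin r) ℂ)ᵀ * B * (A : Matrix (Fin r) (Fin r) ℂ)) * A' := by
      simp [Matrix.transpose_mul, mul_assoc]
    rw [this, h, Matrix.mul_smul, Matrix.smul_mul, h', smul_smul]
  inv_mem' := by
    rintro A ⟨c, hc, h⟩
    refine ⟨c⁻¹, inv_ne_zero hc, ?_⟩
    have h1 : (A : Matrix (Fin r) (Fin r) ℂ) * ((A⁻¹ : GL (Fin r) ℂ) : Matrix (Fin r) (Fin r) ℂ) = 1 := by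
      rw [← Units.val_mul, mul_inv_cancel, Units.val_one]
    have h2 : ((A⁻¹ : GL (Fin r) ℂ) : Matrix (Fin r) (Fin r) ℂ)ᵀ * (A : Matrix (Fin r) (Fin r) ℂ)ᵀ = 1 := by
      rw [← Matrix.transpose_mul, h1, Matrix.transpose_one]
    have h3 : B = c⁻¹ • ((A : Matrix (Fin r) (Fin r) ℂ)ᵀ * B * (A : Matrix (Fin r) (Fin r) ℂ)) := by
      rw [h, smul_smul, inv_mul_cancel₀ hc, one_smul]
    have h4 : ((A⁻¹ : GL (Fin r) ℂ) : Matrix (Fin r) (Fin r) ℂ)ᵀ *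
        ((A : Matrix (Fin r) (Fin r) ℂ)ᵀ * B * (A : Matrix (Fin r) (Fin r) ℂ)) * ((A⁻¹ : GL (Fin r) ℂ) : Matrix (Fin r) (Fin r) ℂ) = B := by
      calc _ = (((A⁻¹ : GL (Fin r) ℂ) : Matrix (Fin r) (Fin r) ℂ)ᵀ * (A : Matrix (Fin r) (Fin r) ℂ)ᵀ) * B *
            ((A : Matrix (Fin r) (Fin r) ℂ) * ((A⁻¹ : GL (Fin r) ℂ) : Matrix (Fin r) (Fin r) ℂ)) := by
              simp only [mul_assoc]
        _ = B := by rw [h1, h2, one_mul, mul_one]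
    change ((A⁻¹ : GL (Fin r) ℂ) : Matrix (Fin r) (Fin r) ℂ)ᵀ * B * ((A⁻¹ : GL (Fin r) ℂ) : Matrix (Fin r) (Fin r) ℂ) = _
    conv_lhs => rw [h3]
    rw [Matrix.mul_smul, Matrix.smul_mul, h4]

/-- `W` is isotropic for the bilinear form with matrix `B`. -/
def IsIsotropic (B : Matrix (Fin r) (Fin r) ℂ) (W : Submodule ℂ (Fin r → ℂ)) : Prop :=
  ∀ v ∈ W, ∀ w ∈ W, v ⬝ᵥ B *ᵥ w = 0

/-- The subgroup of `GO B` preserving the subspace `W`; for `W ≠ 0` isotropic this is the maximal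
parabolic subgroup attached to `W`. -/
def parabolic (B : Matrix (Fin r) (Fin r) ℂ) (W : Submodule ℂ (Fin r → ℂ)) :
    Subgroup (GL (Fin r) ℂ) where
  carrier := {A | A ∈ GO B ∧ ∀ v, (A : Matrix (Fin r) (Fin r) ℂ) *ᵥ v ∈ W ↔ v ∈ W}
  one_mem' := ⟨one_mem _, by simp⟩
  mul_mem' := by
    rintro A A' ⟨h, hW⟩ ⟨h', hW'⟩
    refine ⟨mul_mem h h', fun v => ?_⟩
    rw [Units.val_mul, ← Matrix.mulVec_mulVec, hW, hW']
  inv_mem' := by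
    rintro A ⟨h, hW⟩
    refine ⟨inv_mem h, fun v => ?_⟩
    rw [← hW, Matrix.mulVec_mulVec, ← Units.val_mul, mul_inv_cancel, Units.val_one,
      Matrix.one_mulVec]

/-- `A` belongs to the Lie algebra of the closed linear group `G`: the one-parameter group
`t ↦ exp (t A)` lies in `G`. -/
def InLieAlgebra (G : Subgroup (GL (Fin r) ℂ)) (A : Matrix (Fin r) (Fin r) ℂ) : Prop :=
  ∀ t : ℝ, ∃ g ∈ G, (g : Matrix (Fin r) (Fin r) ℂ) = NormedSpace.exp (t • A)

theorem mem_of_hasDerivAt {M : Type*} [NormedAddCommGroup M] [NormedSpace ℝ M]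
    {S : Set M} (hS : IsClosed S) (hadd : ∀ a ∈ S, ∀ b ∈ S, a - b ∈ S)
    (hsmul : ∀ (t : ℝ), ∀ a ∈ S, t • a ∈ S) {f : ℝ → M} {f' : M} (hf : ∀ t, f t ∈ S)
    (h : HasDerivAt f f' 0) : f' ∈ S := by
  refine hS.mem_of_tendsto (hasDerivAt_iff_tendsto_slope.1 h) (Filter.Eventually.of_forall ?_)
  intro t
  rw [slope_def_module]
  exact hsmul _ _ (hadd _ (hf _) _ (hf _))

attribute [local instance] Matrix.linftyOpNormedRing Matrix.linftyOpNormedAlgebra in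
theorem exp_conditions (B : Matrix (Fin r) (Fin r) ℂ) (W : Submodule ℂ (Fin r → ℂ))
    (A : Matrix (Fin r) (Fin r) ℂ) :
    (∀ t : ℝ, (∃ c : ℂ, (NormedSpace.exp (t • A))ᵀ * B * NormedSpace.exp (t • A) = c • B) ∧
      ∀ v ∈ W, NormedSpace.exp (t • A) *ᵥ v ∈ W) →
    (∃ c : ℂ, Aᵀ * B + B * A = c • B) ∧ ∀ v ∈ W, A *ᵥ v ∈ W := by
  intro h
  have hd : HasDerivAt (fun t : ℝ => NormedSpace.exp (t • A)) A 0 := by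
    have h0 := hasDerivAt_exp_smul_const (𝕂 := ℝ) A (0 : ℝ)
    rw [zero_smul, NormedSpace.exp_zero, one_mul] at h0
    exact h0
  have hdT : HasDerivAt (fun t : ℝ => (NormedSpace.exp (t • A))ᵀ) Aᵀ 0 := by
    have h0 := hasDerivAt_exp_smul_const (𝕂 := ℝ) Aᵀ (0 : ℝ)
    rw [zero_smul, NormedSpace.exp_zero, one_mul] at h0
    simp only [← Matrix.exp_transpose, Matrix.transpose_smul]
    exact h0
  constructor
  · have h1 : HasDerivAt (fun t : ℝ => (NormedSpace.exp (t • A))ᵀ * B * NormedSpace.exp (t • A))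
        (Aᵀ * B + B * A) 0 := by
      have h0 := (hdT.mul_const B).mul hd
      simp only [zero_smul, NormedSpace.exp_zero, mul_one, Matrix.transpose_one, one_mul] at h0
      exact h0
    have h2 := mem_of_hasDerivAt (S := (Submodule.span ℂ {B} : Set (Matrix (Fin r) (Fin r) ℂ)))
      (Submodule.closed_of_finiteDimensional _) (fun a ha b hb => sub_mem ha hb)
      (fun t a ha => by
        have : t • a = (t : ℂ) • a := by ext; simp
        rw [this]; exact Submodule.smul_mem _ _ ha)
      (fun t => by
        obtain ⟨c, hc⟩ := (h t).1
        exact Submodule.mem_span_singleton.2 ⟨c, hc.symm⟩) h1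
    obtain ⟨c, hc⟩ := Submodule.mem_span_singleton.1 h2
    exact ⟨c, hc.symm⟩
  · intro v hv
    have hL : HasDerivAt (fun t : ℝ => NormedSpace.exp (t • A) *ᵥ v) (A *ᵥ v) 0 := by
      let l : Matrix (Fin r) (Fin r) ℂ →ₗ[ℝ] (Fin r → ℂ) :=
        { toFun := fun M => M *ᵥ v
          map_add' := fun M N => Matrix.add_mulVec _ _ _
          map_smul' := fun t M => Matrix.smul_mulVec _ _ _ }
      exact (LinearMap.toContinuousLinearMap l).hasFDerivAt.comp_hasDerivAt (0 : ℝ) hd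
    exact mem_of_hasDerivAt (S := (W : Set (Fin r → ℂ)))
      (Submodule.closed_of_finiteDimensional _) (fun a ha b hb => sub_mem ha hb)
      (fun t a ha => by
        have : t • a = (t : ℂ) • a := by ext; simp
        rw [this]; exact Submodule.smul_mem _ _ ha)
      (fun t => (h t).2 v hv) hL

attribute [local instance] Matrix.linftyOpNormedRing Matrix.linftyOpNormedAlgebra in
theorem exp_preserves (W : Submodule ℂ (Fin r → ℂ))
    (A : Matrix (Fin r) (Fin r) ℂ) (h : ∀ v ∈ W, A *ᵥ v ∈ W) (v : Fin r → ℂ) (hv : v ∈ W) :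
    NormedSpace.exp A *ᵥ v ∈ W := by
  have hp : ∀ n : ℕ, (A ^ n) *ᵥ v ∈ W := by
    intro n
    induction n with
    | zero => simpa using hv
    | succ n ih => rw [pow_succ', ← Matrix.mulVec_mulVec]; exact h _ ih
  let l : Matrix (Fin r) (Fin r) ℂ →ₗ[ℂ] (Fin r → ℂ) :=
    { toFun := fun M => M *ᵥ v
      map_add' := fun M N => Matrix.add_mulVec _ _ _
      map_smul' := fun t M => Matrix.smul_mulVec _ _ _ }
  have hs := NormedSpace.exp_series_hasSum_exp' (𝕂 := ℂ) A
  have hs2 := hs.mapL (LinearMap.toContinuousLinearMap l)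
  refine (Submodule.closed_of_finiteDimensional W).mem_of_tendsto hs2
    (Filter.Eventually.of_forall fun s => ?_)
  refine Submodule.sum_mem _ fun n _ => ?_
  change (((n.factorial : ℂ)⁻¹) • A ^ n) *ᵥ v ∈ W
  rw [Matrix.smul_mulVec]
  exact Submodule.smul_mem _ _ (hp n)

attribute [local instance] Matrix.linftyOpNormedRing Matrix.linftyOpNormedAlgebra in
theorem exp_conformal (B : Matrix (Fin r) (Fin r) ℂ) (A : Matrix (Fin r) (Fin r) ℂ) (c : ℂ)
    (h : Aᵀ * B + B * A = c • B) :
    (NormedSpace.exp A)ᵀ * B * NormedSpace.exp A = Complex.exp c • B := by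
  have h1 : SemiconjBy B (c • 1 - A) Aᵀ := by
    change B * (c • 1 - A) = Aᵀ * B
    rw [mul_sub, Matrix.mul_smul, mul_one, ← h]; abel
  have h2 : SemiconjBy B (NormedSpace.exp (c • 1 - A)) (NormedSpace.exp Aᵀ) := by
    have hl := (NormedSpace.exp_series_hasSum_exp' (𝕂 := ℂ) (c • 1 - A)).mul_left B
    have hr := (NormedSpace.exp_series_hasSum_exp' (𝕂 := ℂ) Aᵀ).mul_right B
    have he : (fun n : ℕ => B * ((n.factorial : ℂ)⁻¹ • (c • 1 - A) ^ n)) =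
        fun n : ℕ => ((n.factorial : ℂ)⁻¹ • Aᵀ ^ n) * B := by
      funext n
      rw [Matrix.mul_smul, Matrix.smul_mul, (h1.pow_right n).eq]
    rw [he] at hl
    exact hl.unique hr
  have h3 : NormedSpace.exp (c • (1 : Matrix (Fin r) (Fin r) ℂ) - A) * NormedSpace.exp A
      = NormedSpace.exp (c • (1 : Matrix (Fin r) (Fin r) ℂ)) := by
    rw [← Matrix.exp_add_of_commute, sub_add_cancel]
    exact Commute.sub_left ((Commute.one_left A).smul_left c) (Commute.refl A)
  have h4 : NormedSpace.exp (c • (1 : Matrix (Fin r) (Fin r) ℂ)) = Complex.exp c • 1 := by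
    have : c • (1 : Matrix (Fin r) (Fin r) ℂ) = Matrix.diagonal (fun _ => c) := by
      rw [Matrix.smul_one_eq_diagonal]
    rw [this, Matrix.exp_diagonal, Matrix.smul_one_eq_diagonal]
    congr 1
    funext i
    rw [Pi.coe_exp, Complex.exp_eq_exp_ℂ]
  rw [← Matrix.exp_transpose, ← h2.eq, mul_assoc, h3, h4, Matrix.mul_smul, mul_one]


theorem inLieAlgebra_parabolic_iff (B : Matrix (Fin r) (Fin r) ℂ)
    (W : Submodule ℂ (Fin r → ℂ)) (A : Matrix (Fin r) (Fin r) ℂ) :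
    InLieAlgebra (parabolic B W) A ↔
      (∃ c : ℂ, Aᵀ * B + B * A = c • B) ∧ ∀ v ∈ W, A *ᵥ v ∈ W := by
  constructor
  · intro h
    refine exp_conditions B W A fun t => ?_
    obtain ⟨g, ⟨⟨c, -, hg⟩, hW⟩, he⟩ := h t
    rw [he] at hg
    refine ⟨⟨c, hg⟩, fun v hv => ?_⟩
    rw [← he]
    exact (hW v).2 hv
  · rintro ⟨⟨c, hc⟩, hW⟩ t
    have hcan : NormedSpace.exp (t • A) * NormedSpace.exp (-(t • A)) = 1 := by
      rw [← Matrix.exp_add_of_commute _ _ (Commute.neg_right (Commute.refl (t • A))), add_neg_cancel,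
        NormedSpace.exp_zero]
    have hcan' : NormedSpace.exp (-(t • A)) * NormedSpace.exp (t • A) = 1 := by
      rw [← Matrix.exp_add_of_commute _ _ (Commute.neg_left (Commute.refl (t • A))), neg_add_cancel,
        NormedSpace.exp_zero]
    have hWt : ∀ s : ℝ, ∀ v ∈ W, (s • A) *ᵥ v ∈ W := by
      intro s v hv
      have : (s • A) *ᵥ v = (s : ℂ) • (A *ᵥ v) := by
        rw [Matrix.smul_mulVec]; ext; simp
      rw [this]
      exact W.smul_mem _ (hW v hv)
    refine ⟨⟨NormedSpace.exp (t • A), NormedSpace.exp (-(t • A)), hcan, hcan'⟩, ⟨?_, ?_⟩, rfl⟩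
    · refine ⟨Complex.exp (t * c), Complex.exp_ne_zero _, exp_conformal B (t • A) (t * c) ?_⟩
      rw [Matrix.transpose_smul, Matrix.smul_mul, Matrix.mul_smul, ← smul_add, hc, mul_smul]
      ext; simp
    · intro v
      refine ⟨fun hv => ?_, fun hv => exp_preserves W _ (hWt t) v hv⟩
      have h1 := exp_preserves W (-(t • A)) (fun w hw => by
        rw [← neg_smul]; exact hWt (-t) w hw) _ hv
      change NormedSpace.exp (-(t • A)) *ᵥ (NormedSpace.exp (t • A) *ᵥ v) ∈ W at h1
      rwa [Matrix.mulVec_mulVec, hcan', Matrix.one_mulVec] at h1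

/-- The Lie algebra of the group `parabolic B W`. -/
def parabolicLie (B : Matrix (Fin r) (Fin r) ℂ) (W : Submodule ℂ (Fin r → ℂ)) :
    Submodule ℂ (Matrix (Fin r) (Fin r) ℂ) where
  carrier := {A | InLieAlgebra (parabolic B W) A}
  zero_mem' := by
    change InLieAlgebra _ _
    rw [inLieAlgebra_parabolic_iff]
    exact ⟨⟨0, by simp⟩, by simp⟩
  add_mem' := by
    intro A A' h h'
    change InLieAlgebra _ _
    change InLieAlgebra _ _ at h h'
    rw [inLieAlgebra_parabolic_iff] at *
    obtain ⟨⟨c, hc⟩, hW⟩ := h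
    obtain ⟨⟨c', hc'⟩, hW'⟩ := h'
    refine ⟨⟨c + c', ?_⟩, fun v hv => ?_⟩
    · rw [Matrix.transpose_add, add_mul, mul_add, add_smul, ← hc, ← hc']; abel
    · rw [Matrix.add_mulVec]; exact W.add_mem (hW v hv) (hW' v hv)
  smul_mem' := by
    intro a A h
    change InLieAlgebra _ _
    change InLieAlgebra _ _ at h
    rw [inLieAlgebra_parabolic_iff] at *
    obtain ⟨⟨c, hc⟩, hW⟩ := h
    refine ⟨⟨a * c, ?_⟩, fun v hv => ?_⟩
    · rw [Matrix.transpose_smul, Matrix.smul_mul, Matrix.mul_smul, ← smul_add, hc, smul_smul]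
    · rw [Matrix.smul_mulVec]; exact W.smul_mem _ (hW v hv)

end Group

/-! ### Orthogonal bundles, isotropic subbundles and the associated principal bundles -/

section Bundles

variable {X : Type*} [TopologicalSpace X] [ChartedSpace ℂ X]
  {F : Type*} [NormedAddCommGroup F] [NormedSpace ℂ F]
  {FL : Type*} [NormedAddCommGroup FL] [NormedSpace ℂ FL]
  {FH : Type*} [NormedAddCommGroup FH] [NormedSpace ℂ FH]
  {E : X → Type*} [TopologicalSpace (TotalSpace F E)]
  [∀ x, AddCommGroup (E x)] [∀ x, Module ℂ (E x)] [∀ x, TopologicalSpace (E x)]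
  [FiberBundle F E]
  {L : X → Type*} [TopologicalSpace (TotalSpace FL L)]
  [∀ x, AddCommGroup (L x)] [∀ x, Module ℂ (L x)] [∀ x, TopologicalSpace (L x)]
  [FiberBundle FL L]
  {H : X → Type*} [TopologicalSpace (TotalSpace FH H)]
  [∀ x, AddCommGroup (H x)] [∀ x, Module ℂ (H x)] [∀ x, TopologicalSpace (H x)]
  [FiberBundle FH H]

variable (F FL E L) in
/-- A symmetric nondegenerate holomorphic homomorphism `E ⊗ E ⟶ L`. -/
structure OrthogonalForm where
  form : ∀ x, E x →ₗ[ℂ] E x →ₗ[ℂ] L x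
  symm : ∀ x v w, form x v w = form x w v
  nondegenerate : ∀ x v, (∀ w, form x v w = 0) → v = 0
  holomorphic : ∀ (U : Set X) (σ τ : ∀ x, E x), IsOpen U → IsHolSection F E σ U →
    IsHolSection F E τ U → IsHolSection FL L (fun x => form x (σ x) (τ x)) U

variable (FH H) in
/-- A holomorphic subbundle `H ⊂ E` on which the orthogonal form vanishes identically: a fibrewise
injective holomorphic homomorphism `H ⟶ E` with isotropic image. -/
structure IsotropicSubbundle (φ : OrthogonalForm F FL E L) where
  incl : ∀ x, H x →ₗ[ℂ] E x
  injective : ∀ x, Function.Injective (incl x)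
  holomorphic : ∀ (U : Set X) (σ : ∀ x, H x), IsOpen U → IsHolSection FH H σ U →
    IsHolSection F E (fun x => incl x (σ x)) U
  isotropic : ∀ x v w, φ.form x (incl x v) (incl x w) = 0

variable {r : ℕ}

/-- The fibre over `x` of the principal `GO B`-bundle `P` of an orthogonal bundle: the linear
isomorphisms `u : ℂʳ ⟶ E x` carrying the bilinear form `B` to the orthogonal form, up to the choice
of a vector of the line `L x`. -/
def ConformalFrame (φ : OrthogonalForm F FL E L) (B : Matrix (Fin r) (Fin r) ℂ) (x : X) :=
  {u : (Fin r → ℂ) ≃ₗ[ℂ] E x //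
    ∃ t : L x, t ≠ 0 ∧ ∀ v w, φ.form x (u v) (u w) = (v ⬝ᵥ B *ᵥ w) • t}

/-- The right action `u ↦ u ∘ g` of `GO B` on the fibres of `P`. -/
def ConformalFrame.act {φ : OrthogonalForm F FL E L} {B : Matrix (Fin r) (Fin r) ℂ} {x : X}
    (u : ConformalFrame φ B x) (g : GO B) : ConformalFrame φ B x :=
  ⟨(LinearMap.GeneralLinearGroup.generalLinearEquiv ℂ (Fin r → ℂ)
      (Matrix.GeneralLinearGroup.toLin (g : GL (Fin r) ℂ))).trans u.1, by
    obtain ⟨t, ht, hu⟩ := u.2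
    obtain ⟨c, hc, hg⟩ := g.2
    refine ⟨c • t, smul_ne_zero hc ht, fun v w => ?_⟩
    change φ.form x (u.1 (((g : GL (Fin r) ℂ) : Matrix (Fin r) (Fin r) ℂ) *ᵥ v))
      (u.1 (((g : GL (Fin r) ℂ) : Matrix (Fin r) (Fin r) ℂ) *ᵥ w)) = _
    rw [hu, smul_smul]
    congr 1
    have h := congrArg (fun M => v ⬝ᵥ M *ᵥ w) hg
    simp only [Matrix.smul_mulVec, dotProduct_smul, smul_eq_mul] at h
    rw [mul_comm, ← h, ← Matrix.mulVec_mulVec, ← Matrix.mulVec_mulVec,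
      Matrix.dotProduct_transpose_mulVec]
    exact dotProduct_comm _ _⟩

theorem ConformalFrame.act_apply {φ : OrthogonalForm F FL E L} {B : Matrix (Fin r) (Fin r) ℂ}
    {x : X} (u : ConformalFrame φ B x) (g : GO B) (v : Fin r → ℂ) :
    (u.act g).1 v = u.1 (((g : GL (Fin r) ℂ) : Matrix (Fin r) (Fin r) ℂ) *ᵥ v) := rfl

variable {φ : OrthogonalForm F FL E L}

/-- The fibre over `x` of the reduction `P^Q ⊂ P` given by the isotropic subbundle `H`, where
`Q = parabolic B W`: the conformal frames carrying `W` onto `H x`. -/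
def AdaptedFrame (j : IsotropicSubbundle FH H φ) (B : Matrix (Fin r) (Fin r) ℂ)
    (W : Submodule ℂ (Fin r → ℂ)) (x : X) :=
  {u : ConformalFrame φ B x // ∀ v, u.1 v ∈ LinearMap.range (j.incl x) ↔ v ∈ W}

variable {j : IsotropicSubbundle FH H φ} {B : Matrix (Fin r) (Fin r) ℂ}
  {W : Submodule ℂ (Fin r → ℂ)}

/-- The right action of `Q = parabolic B W` on the fibres of `P^Q`. -/
def AdaptedFrame.act {x : X} (u : AdaptedFrame j B W x) (g : parabolic B W) :
    AdaptedFrame j B W x :=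
  ⟨u.1.act ⟨g.1, g.2.1⟩, fun v => by
    rw [ConformalFrame.act_apply, u.2]
    exact g.2.2 v⟩

/-- The action of `Q` on each fibre of `P^Q` is free and transitive. -/
theorem AdaptedFrame.existsUnique_act {x : X} (u u' : AdaptedFrame j B W x) :
    ∃! g : parabolic B W, u.act g = u' := by
  let a : (Fin r → ℂ) ≃ₗ[ℂ] (Fin r → ℂ) := u'.1.1.trans u.1.1.symm
  have hmul : LinearMap.toMatrix' (a : (Fin r → ℂ) →ₗ[ℂ] (Fin r → ℂ)) *
      LinearMap.toMatrix' (a.symm : (Fin r → ℂ) →ₗ[ℂ] (Fin r → ℂ)) = 1 := by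
    rw [← LinearMap.toMatrix'_comp]; simp
  have hmul' : LinearMap.toMatrix' (a.symm : (Fin r → ℂ) →ₗ[ℂ] (Fin r → ℂ)) *
      LinearMap.toMatrix' (a : (Fin r → ℂ) →ₗ[ℂ] (Fin r → ℂ)) = 1 := by
    rw [← LinearMap.toMatrix'_comp]; simp
  let m : GL (Fin r) ℂ := ⟨_, _, hmul, hmul'⟩
  have hm : ∀ v, (m : Matrix (Fin r) (Fin r) ℂ) *ᵥ v = a v := fun v =>
    LinearMap.toMatrix'_mulVec (a : (Fin r → ℂ) →ₗ[ℂ] (Fin r → ℂ)) v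
  have hua : ∀ v, u.1.1 (a v) = u'.1.1 v := fun v => by simp [a]
  obtain ⟨t, ht, hu⟩ := u.1.2
  obtain ⟨t', ht', hu'⟩ := u'.1.2
  have key : ∀ v w, (a v ⬝ᵥ B *ᵥ a w) • t = (v ⬝ᵥ B *ᵥ w) • t' := fun v w => by
    rw [← hu, ← hu', hua, hua]
  have hc : ∃ c : ℂ, c ≠ 0 ∧ ∀ v w, a v ⬝ᵥ B *ᵥ a w = c * (v ⬝ᵥ B *ᵥ w) := by
    by_cases h0 : ∃ v w, v ⬝ᵥ B *ᵥ w ≠ 0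
    · obtain ⟨v, w, h⟩ := h0
      have h1 : t' = ((v ⬝ᵥ B *ᵥ w)⁻¹ * (a v ⬝ᵥ B *ᵥ a w)) • t := by
        rw [mul_smul, key, smul_smul, inv_mul_cancel₀ h, one_smul]
      refine ⟨(v ⬝ᵥ B *ᵥ w)⁻¹ * (a v ⬝ᵥ B *ᵥ a w),
        fun hz => ht' (by rw [h1, hz, zero_smul]), fun v' w' => ?_⟩
      have h2 := key v' w'
      rw [h1, smul_smul] at h2
      rw [smul_left_injective ℂ ht h2, mul_comm]
    · push Not at h0
      exact ⟨1, one_ne_zero, fun v w => by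
        rw [h0 (a v) (a w), h0 v w, mul_zero]⟩
  have hmem : m ∈ parabolic B W := by
    refine ⟨?_, fun v => ?_⟩
    · obtain ⟨c, hc0, hc⟩ := hc
      refine ⟨c, hc0, ?_⟩
      ext k l
      have h : (Pi.single k 1 : Fin r → ℂ) ⬝ᵥ ((m : Matrix (Fin r) (Fin r) ℂ)ᵀ * B *
          (m : Matrix (Fin r) (Fin r) ℂ)) *ᵥ (Pi.single l 1 : Fin r → ℂ) =
          c * ((Pi.single k 1 : Fin r → ℂ) ⬝ᵥ B *ᵥ (Pi.single l 1 : Fin r → ℂ)) := by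
        rw [← Matrix.mulVec_mulVec, ← Matrix.mulVec_mulVec, Matrix.dotProduct_transpose_mulVec,
          dotProduct_comm, hm, hm, hc]
      simpa using h
    · rw [hm, ← u.2, hua, u'.2]
  refine ⟨⟨m, hmem⟩, ?_, ?_⟩
  · refine Subtype.ext (Subtype.ext (LinearEquiv.ext fun v => ?_))
    change u.1.1 ((m : Matrix (Fin r) (Fin r) ℂ) *ᵥ v) = _
    rw [hm, hua]
  · rintro g rfl
    refine Subtype.ext (Units.ext (Matrix.ext_of_mulVec_single fun k => ?_))
    apply u.1.1.injective
    change u.1.1 _ = u.1.1 ((m : Matrix (Fin r) (Fin r) ℂ) *ᵥ _)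
    rw [hm, hua]
    rfl

/-- `u` is a holomorphic section of `P^Q` over the open set `U`. -/
def IsHolAdaptedFrame (u : ∀ x, AdaptedFrame j B W x) (U : Set X) : Prop :=
  IsOpen U ∧ ∀ v : Fin r → ℂ, IsHolSection F E (fun x => (u x).1.1 v) U

variable (j B W) in
/-- The fibre over `x` of the adjoint bundle `P^Q(𝔮) = P^Q ×^Q 𝔮`, as the space of functions
`f : P^Q_x ⟶ 𝔮` with `f (u g) = Ad (g⁻¹) (f u)`. -/
def adjointFibre (x : X) : Submodule ℂ (AdaptedFrame j B W x → parabolicLie B W) where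
  carrier := {f | ∀ (u : AdaptedFrame j B W x) (g : parabolic B W),
    (f (u.act g) : Matrix (Fin r) (Fin r) ℂ) =
      ((g⁻¹ : parabolic B W) : GL (Fin r) ℂ) * (f u : Matrix (Fin r) (Fin r) ℂ) *
        ((g : GL (Fin r) ℂ) : Matrix (Fin r) (Fin r) ℂ)}
  zero_mem' := by intro u g; simp
  add_mem' := by
    intro f f' h h' u g
    simp only [Pi.add_apply, Submodule.coe_add, h u g, h' u g, mul_add, add_mul]
  smul_mem' := by
    intro a f h u g
    simp only [Pi.smul_apply, Submodule.coe_smul, h u g, Matrix.mul_smul, Matrix.smul_mul]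

/-- A section of `P^Q(𝔮)` is holomorphic on `U` if it is given by a holomorphic `𝔮`-valued function
with respect to each local holomorphic section of `P^Q`. -/
def IsHolAdjointSection (σ : ∀ x, adjointFibre j B W x) (U : Set X) : Prop :=
  ∀ (u : ∀ x, AdaptedFrame j B W x) (U' : Set X), U' ⊆ U → IsHolAdaptedFrame u U' →
    ∀ k l : Fin r, ContMDiffOn 𝓘(ℂ) 𝓘(ℂ) ω
      (fun x => ((σ x : AdaptedFrame j B W x → parabolicLie B W) (u x) :
        Matrix (Fin r) (Fin r) ℂ) k l) U'

end Bundles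

end OrthBundle

end

set_option linter.unusedSectionVars false

noncomputable section

namespace OrthBundle

/-! ### Symmetric forms vanishing on a subspace -/

section Orbits

variable {r : ℕ}

theorem dotProduct_mulVec_comm {B : Matrix (Fin r) (Fin r) ℂ} (hB : B.IsSymm) (v w : Fin r → ℂ) :
    v ⬝ᵥ B *ᵥ w = w ⬝ᵥ B *ᵥ v := by
  conv_lhs => rw [← hB]
  rw [Matrix.dotProduct_transpose_mulVec]

theorem dotProduct_transpose_mul_mul_mulVec (S B T : Matrix (Fin r) (Fin r) ℂ)
    (v w : Fin r → ℂ) : v ⬝ᵥ (Sᵀ * B * T) *ᵥ w = (S *ᵥ v) ⬝ᵥ B *ᵥ (T *ᵥ w) := by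
  rw [← Matrix.mulVec_mulVec, ← Matrix.mulVec_mulVec, Matrix.dotProduct_transpose_mulVec,
    dotProduct_comm]

/-- The orthogonal complement of `W` with respect to `B`. -/
def orthCompl (B : Matrix (Fin r) (Fin r) ℂ) (W : Submodule ℂ (Fin r → ℂ)) :
    Submodule ℂ (Fin r → ℂ) :=
  (Matrix.toBilin' B).orthogonal W

theorem mem_orthCompl {B : Matrix (Fin r) (Fin r) ℂ} {W : Submodule ℂ (Fin r → ℂ)}
    {v : Fin r → ℂ} : v ∈ orthCompl B W ↔ ∀ w ∈ W, w ⬝ᵥ B *ᵥ v = 0 := by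
  simp only [orthCompl, LinearMap.BilinForm.mem_orthogonal_iff,
    Matrix.toBilin'_apply']

theorem toBilin'_isRefl {B : Matrix (Fin r) (Fin r) ℂ} (hB : B.IsSymm) :
    (Matrix.toBilin' B).IsRefl := by
  intro v w h
  rw [Matrix.toBilin'_apply'] at *
  rwa [dotProduct_mulVec_comm hB]

theorem toBilin'_nondegenerate {B : Matrix (Fin r) (Fin r) ℂ} (hB : B.det ≠ 0) :
    (Matrix.toBilin' B).Nondegenerate :=
  LinearMap.BilinForm.nondegenerate_toBilin'_of_det_ne_zero' B hB

theorem mem_of_orthogonal_orthCompl {B : Matrix (Fin r) (Fin r) ℂ} (hB : B.IsSymm)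
    (hdet : B.det ≠ 0) {W : Submodule ℂ (Fin r → ℂ)} {w : Fin r → ℂ}
    (h : ∀ v ∈ orthCompl B W, v ⬝ᵥ B *ᵥ w = 0) : w ∈ W := by
  have h1 : w ∈ orthCompl B (orthCompl B W) := mem_orthCompl.2 h
  rwa [orthCompl, orthCompl, LinearMap.BilinForm.orthogonal_orthogonal
    (toBilin'_nondegenerate hdet) (toBilin'_isRefl hB)] at h1

theorem finrank_orthCompl {B : Matrix (Fin r) (Fin r) ℂ}
    (hdet : B.det ≠ 0) (W : Submodule ℂ (Fin r → ℂ)) :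
    Module.finrank ℂ (orthCompl B W) = r - Module.finrank ℂ W := by
  rw [orthCompl, LinearMap.BilinForm.finrank_orthogonal (toBilin'_nondegenerate hdet)]
  simp

theorem IsIsotropic.le_orthCompl {B : Matrix (Fin r) (Fin r) ℂ} {W : Submodule ℂ (Fin r → ℂ)}
    (h : IsIsotropic B W) : W ≤ orthCompl B W :=
  fun v hv => mem_orthCompl.2 fun w hw => h w hw v hv

/-- The symmetric matrices for which `W` is isotropic. -/
def isotropicForms (W : Submodule ℂ (Fin r → ℂ)) : Submodule ℂ (Matrix (Fin r) (Fin r) ℂ) where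
  carrier := {T | T.IsSymm ∧ IsIsotropic T W}
  zero_mem' := ⟨Matrix.isSymm_zero, fun v _ w _ => by simp⟩
  add_mem' := by
    rintro S T ⟨hS, hS'⟩ ⟨hT, hT'⟩
    refine ⟨hS.add hT, fun v hv w hw => ?_⟩
    rw [Matrix.add_mulVec, dotProduct_add, hS' v hv w hw, hT' v hv w hw, add_zero]
  smul_mem' := by
    rintro c T ⟨hT, hT'⟩
    refine ⟨hT.smul c, fun v hv w hw => ?_⟩
    rw [Matrix.smul_mulVec, dotProduct_smul, hT' v hv w hw, smul_zero]

theorem exists_projection (W : Submodule ℂ (Fin r → ℂ)) :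
    ∃ p : Matrix (Fin r) (Fin r) ℂ, (∀ v, p *ᵥ v ∈ W) ∧ ∀ v ∈ W, p *ᵥ v = v := by
  obtain ⟨f, hf⟩ := W.subtype.exists_leftInverse_of_injective (Submodule.ker_subtype W)
  refine ⟨LinearMap.toMatrix' (W.subtype ∘ₗ f), fun v => ?_, fun v hv => ?_⟩
  · rw [LinearMap.toMatrix'_mulVec]; exact (f v).2
  · rw [LinearMap.toMatrix'_mulVec]
    exact congrArg Subtype.val (LinearMap.congr_fun hf ⟨v, hv⟩)

/-- A linear right inverse of `A ↦ Aᵀ B + B A` with values in the matrices preserving `W`, and a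
linear projection onto `isotropicForms W`. -/
theorem exists_infinitesimal_section (B : Matrix (Fin r) (Fin r) ℂ) (hB : B.IsSymm)
    (hdet : B.det ≠ 0) (W : Submodule ℂ (Fin r → ℂ)) (hW : IsIsotropic B W) :
    ∃ R ϖ : Matrix (Fin r) (Fin r) ℂ →ₗ[ℂ] Matrix (Fin r) (Fin r) ℂ,
      (∀ T ∈ isotropicForms W, (R T)ᵀ * B + B * R T = T) ∧
      (∀ T ∈ isotropicForms W, ∀ w ∈ W, R T *ᵥ w ∈ W) ∧
      (∀ T, ϖ T ∈ isotropicForms W) ∧ ∀ T ∈ isotropicForms W, ϖ T = T := by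
  obtain ⟨p, hp, hp'⟩ := exists_projection W
  obtain ⟨q, hq, hq'⟩ := exists_projection (orthCompl B W)
  have hBu : IsUnit B.det := isUnit_iff_ne_zero.2 hdet
  let R : Matrix (Fin r) (Fin r) ℂ →ₗ[ℂ] Matrix (Fin r) (Fin r) ℂ :=
    { toFun := fun T => B⁻¹ * ((1 / 2 : ℂ) • (T + (pᵀ * T * q - qᵀ * T * p)))
      map_add' := fun S T => by
        rw [← mul_add, ← smul_add]; congr 2; noncomm_ring
      map_smul' := fun c T => by
        simp only [RingHom.id_apply, Matrix.mul_smul, Matrix.smul_mul, ← smul_sub, ← smul_add,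
          smul_comm c] }
  let ϖ : Matrix (Fin r) (Fin r) ℂ →ₗ[ℂ] Matrix (Fin r) (Fin r) ℂ :=
    { toFun := fun T => (1 / 2 : ℂ) • ((T + Tᵀ) - pᵀ * (T + Tᵀ) * p)
      map_add' := fun S T => by
        rw [← smul_add, Matrix.transpose_add]; congr 1; noncomm_ring
      map_smul' := fun c T => by
        simp only [RingHom.id_apply, Matrix.transpose_smul, Matrix.mul_smul, Matrix.smul_mul,
          ← smul_sub, ← smul_add, smul_comm c] }
  have hBR : ∀ T, B * R T = (1 / 2 : ℂ) • (T + (pᵀ * T * q - qᵀ * T * p)) := fun T => by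
    change B * (B⁻¹ * _) = _
    rw [← mul_assoc, Matrix.mul_nonsing_inv _ hBu, one_mul]
  refine ⟨R, ϖ, ?_, ?_, ?_, ?_⟩
  · rintro T ⟨hT, -⟩
    have h1 : (R T)ᵀ * B = (B * R T)ᵀ := by rw [Matrix.transpose_mul, hB.eq]
    rw [h1, hBR]
    simp only [Matrix.transpose_smul, Matrix.transpose_add, Matrix.transpose_sub,
      Matrix.transpose_mul, Matrix.transpose_transpose, hT.eq, ← smul_add, mul_assoc]
    rw [show T + (qᵀ * (T * p) - pᵀ * (T * q)) + (T + (pᵀ * (T * q) - qᵀ * (T * p))) =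
      (2 : ℂ) • T by rw [two_smul]; abel, smul_smul]
    norm_num
  · rintro T ⟨-, hT⟩ w hw
    refine mem_of_orthogonal_orthCompl hB hdet fun v hv => ?_
    rw [Matrix.mulVec_mulVec, hBR, Matrix.smul_mulVec, dotProduct_smul, Matrix.add_mulVec,
      Matrix.sub_mulVec, dotProduct_add, dotProduct_sub, dotProduct_transpose_mul_mul_mulVec,
      dotProduct_transpose_mul_mul_mulVec, hp' w hw, hq' v hv, hq' w (hW.le_orthCompl hw),
      hT _ (hp v) w hw]
    simp
  · intro T
    refine ⟨?_, fun v hv w hw => ?_⟩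
    · change ((1 / 2 : ℂ) • ((T + Tᵀ) - pᵀ * (T + Tᵀ) * p))ᵀ = _
      simp only [Matrix.transpose_smul, Matrix.transpose_add, Matrix.transpose_sub,
        Matrix.transpose_mul, Matrix.transpose_transpose, mul_assoc, add_comm Tᵀ T]
      change _ = (1 / 2 : ℂ) • ((T + Tᵀ) - pᵀ * (T + Tᵀ) * p)
      rw [mul_assoc]
    · change v ⬝ᵥ ((1 / 2 : ℂ) • ((T + Tᵀ) - pᵀ * (T + Tᵀ) * p)) *ᵥ w = 0
      rw [Matrix.smul_mulVec, dotProduct_smul, Matrix.sub_mulVec, dotProduct_sub,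
        dotProduct_transpose_mul_mul_mulVec, hp' v hv, hp' w hw, sub_self, smul_zero]
  · rintro T ⟨hT, hT'⟩
    change (1 / 2 : ℂ) • ((T + Tᵀ) - pᵀ * (T + Tᵀ) * p) = T
    have h0 : pᵀ * (T + Tᵀ) * p = 0 := by
      refine Matrix.ext_of_mulVec_single fun k => ?_
      refine dotProduct_eq _ _ fun v => ?_
      rw [dotProduct_comm, dotProduct_transpose_mul_mul_mulVec, hT.eq, Matrix.add_mulVec,
        dotProduct_add, hT' _ (hp _) _ (hp _), add_zero, Matrix.zero_mulVec, zero_dotProduct]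
    rw [h0, hT.eq, sub_zero, ← two_smul ℂ T, smul_smul]
    norm_num

attribute [local instance] Matrix.linftyOpNormedRing Matrix.linftyOpNormedAlgebra in
/-- Isotropic forms near a nondegenerate one `B` are pulled back from `B` by matrices which preserve
`W` and depend analytically on the form. -/
theorem exists_analytic_normalization (B : Matrix (Fin r) (Fin r) ℂ) (hB : B.IsSymm)
    (hdet : B.det ≠ 0) (W : Submodule ℂ (Fin r → ℂ)) (hW : IsIsotropic B W) :
    ∃ Θ : Matrix (Fin r) (Fin r) ℂ → Matrix (Fin r) (Fin r) ℂ, ContDiffAt ℂ ω Θ B ∧ Θ B = 1 ∧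
      ∀ᶠ G in 𝓝 B, G.IsSymm → IsIsotropic G W →
        (∀ w ∈ W, Θ G *ᵥ w ∈ W) ∧ (Θ G)ᵀ * B * Θ G = G := by
  obtain ⟨R, ϖ, hR, hRW, hϖ, hϖ'⟩ := exists_infinitesimal_section B hB hdet W hW
  let l := LinearMap.toContinuousLinearMap (R ∘ₗ ϖ)
  let lT := LinearMap.toContinuousLinearMap
    ((Matrix.transposeLinearEquiv (Fin r) (Fin r) ℂ ℂ).toLinearMap ∘ₗ R ∘ₗ ϖ)
  have hl : ∀ T, l T = R (ϖ T) := fun T => rfl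
  have hlT : ∀ T, lT T = (R (ϖ T))ᵀ := fun T => rfl
  let f : Matrix (Fin r) (Fin r) ℂ → Matrix (Fin r) (Fin r) ℂ := fun T => T + lT T * B * l T
  have hf0 : f 0 = 0 := by simp [f]
  have hfc : ContDiffAt ℂ ω f 0 :=
    (contDiff_id.add ((lT.contDiff.mul contDiff_const).mul l.contDiff)).contDiffAt
  have hfd : HasFDerivAt f ((ContinuousLinearEquiv.refl ℂ (Matrix (Fin r) (Fin r) ℂ) :
      Matrix (Fin r) (Fin r) ℂ →L[ℂ] Matrix (Fin r) (Fin r) ℂ)) 0 := by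
    have h1 := (hasFDerivAt_id (𝕜 := ℂ) (0 : Matrix (Fin r) (Fin r) ℂ)).add
      ((lT.hasFDerivAt (x := 0).mul_const' B).mul' (l.hasFDerivAt (x := 0)))
    refine h1.congr_fderiv ?_
    ext1 T
    change T + ((lT 0 * B) * l T + (lT T * B) * l 0) = T
    rw [map_zero, map_zero, zero_mul, zero_mul, mul_zero, add_zero, add_zero]
  have hω : (ω : WithTop ℕ∞) ≠ 0 := by simp
  let g := hfc.localInverse hfd hω
  have hg : ContDiffAt ℂ ω g 0 := by
    have := hfc.to_localInverse hfd hω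
    rwa [hf0] at this
  have hg0 : g 0 = 0 := by
    have := hfc.localInverse_apply_image hfd hω
    rwa [hf0] at this
  have hfg : ∀ᶠ y in 𝓝 (0 : Matrix (Fin r) (Fin r) ℂ), f (g y) = y := by
    have := (hfc.hasStrictFDerivAt' hfd hω).eventually_right_inverse
    rwa [hf0] at this
  refine ⟨fun G => 1 + l (g (G - B)), ?_, ?_, ?_⟩
  · refine contDiffAt_const.add (l.contDiff.contDiffAt.comp B ?_)
    refine ContDiffAt.comp B ?_ (contDiffAt_id.sub contDiffAt_const)
    rw [sub_self]
    exact hg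
  · simp [hg0]
  · have ht : Filter.Tendsto (fun G : Matrix (Fin r) (Fin r) ℂ => G - B) (𝓝 B) (𝓝 0) := by
      have : Continuous (fun G : Matrix (Fin r) (Fin r) ℂ => G - B) := by fun_prop
      simpa using this.tendsto B
    filter_upwards [ht.eventually hfg] with G hG hGs hGW
    set T := g (G - B) with hTdef
    have hmem : G - B ∈ isotropicForms W :=
      sub_mem (S := Submodule ℂ (Matrix (Fin r) (Fin r) ℂ)) ⟨hGs, hGW⟩ ⟨hB, hW⟩
    have hquad : lT T * B * l T ∈ isotropicForms W := by
      refine ⟨?_, fun v hv w hw => ?_⟩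
      · rw [hl, hlT]
        change _ᵀ = _
        simp only [Matrix.transpose_mul, Matrix.transpose_transpose, hB.eq, mul_assoc]
      · rw [hl, hlT, dotProduct_transpose_mul_mul_mulVec]
        exact hW _ (hRW _ (hϖ _) _ hv) _ (hRW _ (hϖ _) _ hw)
    have hT : T ∈ isotropicForms W := by
      have : T = (G - B) - lT T * B * l T := by rw [← hG]; simp [f]
      rw [this]
      exact sub_mem hmem hquad
    refine ⟨fun w hw => ?_, ?_⟩
    · rw [Matrix.add_mulVec, Matrix.one_mulVec]
      exact W.add_mem hw (hRW _ (hϖ _) _ hw)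
    · have h1 := hR _ (hϖ T)
      rw [hϖ' T hT] at h1
      have h2 : T + lT T * B * l T = G - B := hG
      rw [hl, hlT, hϖ' T hT] at h2
      rw [hl, hϖ' T hT, Matrix.transpose_add, Matrix.transpose_one]
      calc (1 + (R T)ᵀ) * B * (1 + R T) = B + ((R T)ᵀ * B + B * R T) + (R T)ᵀ * B * R T := by
            noncomm_ring
        _ = G := by rw [h1, add_assoc, h2]; abel

theorem inv_mulVec_mem {S : Matrix (Fin r) (Fin r) ℂ} (hS : S.det ≠ 0)
    {W : Submodule ℂ (Fin r → ℂ)} (h : ∀ w ∈ W, S *ᵥ w ∈ W) {w : Fin r → ℂ} (hw : w ∈ W) :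
    S⁻¹ *ᵥ w ∈ W := by
  have hSu : IsUnit S.det := isUnit_iff_ne_zero.2 hS
  have hinj : Function.Injective (Matrix.toLin' S) := by
    intro v v' hv
    have := congrArg (fun x => S⁻¹ *ᵥ x) hv
    simpa [Matrix.mulVec_mulVec, Matrix.nonsing_inv_mul _ hSu] using this
  have hmap : W.map (Matrix.toLin' S) = W := by
    apply Submodule.eq_of_le_of_finrank_eq
    · rintro _ ⟨w, hw, rfl⟩
      exact h w hw
    · exact (Submodule.equivMapOfInjective _ hinj W).finrank_eq.symm
  have hw' := hw
  rw [← hmap] at hw'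
  obtain ⟨w', hw'', rfl⟩ := hw'
  rw [Matrix.toLin'_apply, Matrix.mulVec_mulVec, Matrix.nonsing_inv_mul _ hSu, Matrix.one_mulVec]
  exact hw''

/-- Any two nondegenerate symmetric forms for which `W` is isotropic are equivalent by a matrix
preserving `W`. -/
theorem exists_isotropic_equivalence (B G : Matrix (Fin r) (Fin r) ℂ) (hB : B.IsSymm)
    (hdet : B.det ≠ 0) (hG : G.IsSymm) (hGdet : G.det ≠ 0) (W : Submodule ℂ (Fin r → ℂ))
    (hW : IsIsotropic B W) (hGW : IsIsotropic G W) :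
    ∃ S : Matrix (Fin r) (Fin r) ℂ, (∀ w ∈ W, S *ᵥ w ∈ W) ∧ Sᵀ * B * S = G := by
  let M : ℂ → Matrix (Fin r) (Fin r) ℂ := fun z => B + z • (G - B)
  have hM : ∀ z, M z ∈ isotropicForms W := fun z =>
    add_mem (S := Submodule ℂ (Matrix (Fin r) (Fin r) ℂ)) ⟨hB, hW⟩
      (Submodule.smul_mem _ z (sub_mem (S := Submodule ℂ (Matrix (Fin r) (Fin r) ℂ))
        ⟨hG, hGW⟩ ⟨hB, hW⟩))
  have hMc : Continuous M := by fun_prop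
  let P : Polynomial ℂ := (B.map Polynomial.C + (Polynomial.X : Polynomial ℂ) •
    (G - B).map Polynomial.C).det
  have hP : ∀ z, P.eval z = (M z).det := fun z => by
    simp only [P]
    rw [← Polynomial.coe_evalRingHom, RingHom.map_det]
    congr 1
    ext i j
    simp [M]
  have hP0 : P ≠ 0 := by
    rintro h0
    have := hP 0
    rw [h0] at this
    simp [M] at this
    exact hdet this.symm
  have hpre : IsPreconnected {z : ℂ | (M z).det ≠ 0} := by
    have hcount : ({z : ℂ | P.IsRoot z}).Countable := (P.finite_setOfPred_isRoot hP0).countable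
    have := (hcount.isConnected_compl_of_one_lt_rank (by simp)).isPreconnected
    convert this using 1
    ext z
    simp [Polynomial.IsRoot, hP]
  let Rel : ℂ → ℂ → Prop := fun z z' => ∃ S : Matrix (Fin r) (Fin r) ℂ,
    (∀ w ∈ W, S *ᵥ w ∈ W) ∧ Sᵀ * M z * S = M z'
  have hsymm : ∀ z z', (M z').det ≠ 0 → Rel z z' → Rel z' z := by
    rintro z z' hz' ⟨S, hS, hSM⟩
    have hSdet : S.det ≠ 0 := by
      intro h0
      rw [← hSM, Matrix.det_mul, h0, mul_zero] at hz'
      exact hz' rfl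
    have hSu : IsUnit S.det := isUnit_iff_ne_zero.2 hSdet
    refine ⟨S⁻¹, fun w hw => ?_, ?_⟩
    · exact inv_mulVec_mem hSdet hS hw
    · rw [← hSM]
      have h1 : S * S⁻¹ = 1 := Matrix.mul_nonsing_inv _ hSu
      have h2 : (S⁻¹)ᵀ * Sᵀ = 1 := by rw [← Matrix.transpose_mul, h1, Matrix.transpose_one]
      calc (S⁻¹)ᵀ * (Sᵀ * M z * S) * S⁻¹ = ((S⁻¹)ᵀ * Sᵀ) * M z * (S * S⁻¹) := by noncomm_ring
        _ = M z := by rw [h1, h2, one_mul, mul_one]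
  have key : Rel 0 1 := by
    refine hpre.induction₂ Rel ?_ ?_ ?_ (by simpa [M] using hdet) (by simpa [M] using hGdet)
    · intro z hz
      obtain ⟨Θ, -, -, hΘ⟩ := exists_analytic_normalization (M z) (hM z).1 hz W (hM z).2
      have := (hMc.tendsto z).eventually hΘ
      refine (this.mono fun z' hz' => ?_).filter_mono nhdsWithin_le_nhds
      obtain ⟨h1, h2⟩ := hz' (hM z').1 (hM z').2
      exact ⟨Θ (M z'), h1, h2⟩
    · rintro x y z hx hy hz ⟨S, hS, hSM⟩ ⟨T, hT, hTM⟩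
      refine ⟨S * T, fun w hw => ?_, ?_⟩
      · rw [← Matrix.mulVec_mulVec]; exact hS _ (hT _ hw)
      · rw [← hTM, ← hSM, Matrix.transpose_mul]; noncomm_ring
    · intro x y hx hy h
      exact hsymm _ _ hy h
  obtain ⟨S, hS, hSM⟩ := key
  exact ⟨S, hS, by simpa [M] using hSM⟩

end Orbits

end OrthBundle

namespace OrthBundle

/-! ### Triangular bases adapted to a chain of invariant subspaces -/

section Flags

variable {V : Type*} [AddCommGroup V] [Module ℂ V] [FiniteDimensional ℂ V]

theorem exists_eigenvector_mod (f : V →ₗ[ℂ] V) {U U' : Submodule ℂ V}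
    (hU : ∀ v ∈ U, f v ∈ U) (hU' : ∀ v ∈ U', f v ∈ U') (hlt : ¬ U' ≤ U) :
    ∃ v ∈ U', v ∉ U ∧ ∃ c : ℂ, f v - c • v ∈ U := by
  let fq : (V ⧸ U) →ₗ[ℂ] (V ⧸ U) := U.mapQ U f hU
  let Y := U'.map U.mkQ
  have hY : ∀ y ∈ Y, fq y ∈ Y := by
    rintro _ ⟨v, hv, rfl⟩
    exact ⟨f v, hU' v hv, rfl⟩
  obtain ⟨v₀, hv₀, hv₀'⟩ := SetLike.not_le_iff_exists.1 hlt
  have : Nontrivial Y := by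
    refine ⟨⟨⟨U.mkQ v₀, v₀, hv₀, rfl⟩, 0, fun h => hv₀' ?_⟩⟩
    have := congrArg Subtype.val h
    simpa using this
  obtain ⟨c, hc⟩ := Module.End.exists_eigenvalue (fq.restrict hY)
  obtain ⟨⟨y, v, hv, rfl⟩, hy⟩ := hc.exists_hasEigenvector
  refine ⟨v, hv, fun h => hy.2 ?_, c, ?_⟩
  · ext1
    simpa using h
  · have := congrArg Subtype.val hy.apply_eq_smul
    have h2 : U.mkQ (f v) = U.mkQ (c • v) := by rw [map_smul]; exact this
    exact (Submodule.Quotient.eq U).1 h2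

theorem exists_triangular_sequence (f : V →ₗ[ℂ] V) (C : ℕ → Submodule ℂ V)
    (hf : ∀ k, ∀ v ∈ C k, f v ∈ C k) (n : ℕ) (hn : ∀ k < n, k < Module.finrank ℂ (C k)) :
    ∃ v : ℕ → V, ∀ i < n, v i ∈ C i ∧ v i ∉ Submodule.span ℂ (v '' Iio i) ∧
      ∃ c : ℂ, f (v i) - c • v i ∈ Submodule.span ℂ (v '' Iio i) := by
  induction n with
  | zero => exact ⟨0, by simp⟩
  | succ k ih =>
    obtain ⟨v, hv⟩ := ih fun i hi => hn i (by omega)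
    let U := Submodule.span ℂ (v '' Iio k)
    have hsub : ∀ i < k, Submodule.span ℂ (v '' Iio i) ≤ U := fun i hi =>
      Submodule.span_mono (image_mono (Iio_subset_Iio hi.le))
    have hUf : ∀ x ∈ U, f x ∈ U := by
      intro x hx
      refine Submodule.span_induction (p := fun x _ => f x ∈ U) ?_ (by simp)
        (fun x y _ _ hx hy => by rw [map_add]; exact U.add_mem hx hy)
        (fun a x _ hx => by rw [map_smul]; exact U.smul_mem a hx) hx
      rintro _ ⟨i, hi, rfl⟩
      obtain ⟨c, hc⟩ := (hv i hi).2.2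
      have h1 : v i ∈ U := Submodule.subset_span ⟨i, hi, rfl⟩
      have := U.add_mem (hsub i hi hc) (U.smul_mem c h1)
      simpa using this
    have hlt : ¬ C k ≤ U := by
      intro hle
      have h1 := Submodule.finrank_mono hle
      have h2 : Module.finrank ℂ U ≤ k := by
        classical
        refine (finrank_span_le_card (v '' Iio k)).trans ?_
        rw [toFinset_image]
        exact Finset.card_image_le.trans (by simp)
      have := hn k (by omega)
      omega
    obtain ⟨x, hx, hxU, c, hc⟩ := exists_eigenvector_mod f hUf (hf k) hlt
    have himg : ∀ i ≤ k, Function.update v k x '' Iio i = v '' Iio i := fun i hi =>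
      image_congr fun j hj => Function.update_of_ne (by have : j < i := hj; omega) _ _
    refine ⟨Function.update v k x, fun i hi => ?_⟩
    rw [himg i (by omega)]
    rcases Nat.lt_succ_iff_lt_or_eq.1 hi with h | rfl
    · rw [Function.update_of_ne (by omega)]
      exact hv i h
    · rw [Function.update_self]
      exact ⟨hx, hxU, c, hc⟩

theorem exists_triangular_basis (f : V →ₗ[ℂ] V) (C : ℕ → Submodule ℂ V)
    (hf : ∀ k, ∀ v ∈ C k, f v ∈ C k) (n : ℕ) (hn : ∀ k < n, k < Module.finrank ℂ (C k))
    (hV : Module.finrank ℂ V = n) :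
    ∃ e : Module.Basis (Fin n) ℂ V, (∀ i : Fin n, e i ∈ C i) ∧
      ∀ i j : Fin n, j < i → e.repr (f (e j)) i = 0 := by
  obtain ⟨v, hv⟩ := exists_triangular_sequence f C hf n hn
  have hli : ∀ k ≤ n, LinearIndepOn ℂ v (Iio k) := by
    intro k
    induction k with
    | zero => simp
    | succ k ih =>
      intro hk
      rw [show Iio (k + 1) = insert k (Iio k) by ext; simp,
        linearIndepOn_insert (by simp)]
      exact ⟨ih (by omega), (hv k (by omega)).2.1⟩
  have hli' : LinearIndependent ℂ (fun i : Fin n => v i) :=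
    (hli n le_rfl).comp (fun i : Fin n => (⟨i, i.2⟩ : Iio n)) fun i j h =>
      Fin.ext (congrArg (fun x : Iio n => (x : ℕ)) h)
  let e : Module.Basis (Fin n) ℂ V :=
    Module.Basis.mk hli' (by
      rw [hli'.span_eq_top_of_card_eq_finrank' (by simp [hV])])
  have he : ∀ i, e i = v i := fun i => by simp [e]
  refine ⟨e, fun i => by rw [he]; exact (hv i i.2).1, fun i j hij => ?_⟩
  obtain ⟨c, hc⟩ := (hv j j.2).2.2
  have hker : ∀ x ∈ Submodule.span ℂ (v '' Iio (j : ℕ)), e.repr x i = 0 := by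
    intro x hx
    refine Submodule.span_induction (p := fun x _ => e.repr x i = 0) ?_ (by simp)
        (fun x y _ _ hx hy => by simp [hx, hy]) (fun a x _ hx => by simp [hx]) hx
    rintro _ ⟨k, hk, rfl⟩
    have hk' : k < j := hk
    have : v k = e ⟨k, by omega⟩ := (he ⟨k, by omega⟩).symm
    rw [this, e.repr_self, Finsupp.single_apply, if_neg]
    intro h
    have := congrArg Fin.val h
    simp only at this
    omega
  have h1 := hker _ hc
  rw [← he] at h1
  rw [map_sub, map_smul, e.repr_self] at h1
  simpa [Finsupp.single_apply, hij.ne] using h1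

end Flags

/-! ### The pairs of indices labelling coordinates on the parabolic Lie algebra -/

section Pairs

variable {r : ℕ}

/-- The coordinates `(i, j)` on which a skew form, zero on `W^⊥ × W`, may be nonzero, in terms of a
basis whose first `s` and `r - s` vectors span `W` and `W^⊥`. -/
def IsFree (s : ℕ) (i j : Fin r) : Prop :=
  i ≠ j ∧ ¬ ((i : ℕ) < s ∧ (j : ℕ) < r - s) ∧ ¬ ((j : ℕ) < s ∧ (i : ℕ) < r - s)

instance (s : ℕ) (i j : Fin r) : Decidable (IsFree s i j) := by
  unfold IsFree; infer_instance

theorem IsFree.symm {s : ℕ} {i j : Fin r} (h : IsFree s i j) : IsFree s j i :=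
  ⟨h.1.symm, h.2.2, h.2.1⟩

variable (r) in
/-- The index set for coordinates on the semisimple part of the parabolic Lie algebra. -/
def FreePairs (s : ℕ) : Type :=
  {p : Fin r ×ₗ Fin r // (ofLex p).1 < (ofLex p).2 ∧ IsFree s (ofLex p).1 (ofLex p).2}

instance (s : ℕ) : Fintype (FreePairs r s) := by unfold FreePairs; infer_instance

instance (s : ℕ) : LinearOrder (FreePairs r s) := by unfold FreePairs; infer_instance

def FreePairs.fst {s : ℕ} (p : FreePairs r s) : Fin r := (ofLex p.1).1

def FreePairs.snd {s : ℕ} (p : FreePairs r s) : Fin r := (ofLex p.1).2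

/-- The number of indices `j` such that `(i, j)` is free. -/
def freeCount (s : ℕ) (i : Fin r) : ℕ :=
  if (i : ℕ) < s then s else if (i : ℕ) < r - s then r - s - 1 else r - 1

theorem card_filter_isFree {s : ℕ} (hs : 2 * s ≤ r) (i : Fin r) :
    (Finset.univ.filter fun j => IsFree s i j).card = freeCount s i := by
  have hlt : ∀ m ≤ r, (Finset.univ.filter fun j : Fin r => (j : ℕ) < m).card = m := fun m hm => by
    rw [Fin.card_filter_val_lt, min_eq_right hm]
  have hge : ∀ m ≤ r, (Finset.univ.filter fun j : Fin r => m ≤ (j : ℕ)).card = r - m :=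
    fun m hm => by
      have h1 := Finset.card_filter_add_card_filter_not (s := (Finset.univ : Finset (Fin r)))
        (fun j : Fin r => (j : ℕ) < m)
      rw [hlt m hm] at h1
      simp only [not_lt, Finset.card_univ, Fintype.card_fin] at h1
      omega
  unfold freeCount
  split_ifs with h1 h2
  · refine Eq.trans ?_ ((hge (r - s) (by omega)).trans (by omega))
    congr 1
    ext j
    simp only [Finset.mem_filter, Finset.mem_univ, true_and, IsFree, ne_eq, Fin.ext_iff]
    omega
  · have : (Finset.univ.filter fun j => IsFree s i j) =
        (Finset.univ.filter fun j : Fin r => s ≤ (j : ℕ)).erase i := by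
      ext j
      simp only [Finset.mem_filter, Finset.mem_univ, true_and, IsFree, ne_eq, Fin.ext_iff,
        Finset.mem_erase]
      omega
    rw [this, Finset.card_erase_of_mem (by simp; omega), hge s (by omega)]
  · have : (Finset.univ.filter fun j => IsFree s i j) = Finset.univ.erase i := by
      ext j
      simp only [Finset.mem_filter, Finset.mem_univ, true_and, IsFree, ne_eq, Fin.ext_iff,
        Finset.mem_erase, and_true]
      omega
    rw [this, Finset.card_erase_of_mem (by simp)]
    simp

@[to_additive]
theorem prod_eq_prod_freePairs {M : Type*} [CommMonoid M] {s : ℕ} (G : Fin r → Fin r → M)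
    (hG : ∀ i j, ¬ IsFree s i j → G i j = 1) :
    ∏ i, ∏ j, G i j = ∏ p : FreePairs r s, (G p.fst p.snd * G p.snd p.fst) := by
  have h1 : ∀ F : Fin r → Fin r → M, ∏ p : FreePairs r s, F p.fst p.snd =
      ∏ p ∈ Finset.univ.filter (fun p : Fin r × Fin r => p.1 < p.2 ∧ IsFree s p.1 p.2),
        F p.1 p.2 := fun F =>
    Finset.prod_bij (fun p _ => ofLex p.1) (fun p _ => by simpa using p.2)
      (fun p _ q _ h => Subtype.ext (ofLex.injective h))
      (fun p hp => ⟨⟨toLex p, by simpa using hp⟩, Finset.mem_univ _, rfl⟩) (fun p _ => rfl)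
  have h2 : ∏ p ∈ Finset.univ.filter (fun p : Fin r × Fin r => p.1 < p.2 ∧ IsFree s p.1 p.2),
      G p.2 p.1 = ∏ p ∈ Finset.univ.filter
        (fun p : Fin r × Fin r => ¬ p.1 < p.2 ∧ IsFree s p.1 p.2), G p.1 p.2 := by
    refine Finset.prod_bij (fun p _ => p.swap) ?_ (fun p _ q _ h => Prod.swap_injective h) ?_
      (fun p _ => rfl)
    · intro p hp
      simp only [Finset.mem_filter, Finset.mem_univ, true_and, Prod.fst_swap, Prod.snd_swap,
        not_lt] at hp ⊢
      exact ⟨hp.1.le, hp.2.symm⟩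
    · intro p hp
      simp only [Finset.mem_filter, Finset.mem_univ, true_and, not_lt] at hp
      refine ⟨p.swap, ?_, Prod.swap_swap p⟩
      simp only [Finset.mem_filter, Finset.mem_univ, true_and, Prod.fst_swap, Prod.snd_swap]
      exact ⟨lt_of_le_of_ne hp.1 hp.2.1.symm, hp.2.symm⟩
  have h3 : ∀ (P Q : Fin r × Fin r → Prop) [DecidablePred P] [DecidablePred Q],
      (Finset.univ.filter fun p => P p ∧ Q p) = (Finset.univ.filter Q).filter P := by
    intro P Q _ _
    rw [Finset.filter_filter]
    ext p; simp [and_comm]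
  rw [Finset.prod_mul_distrib, h1 G, h1 fun i j => G j i, h2, h3, h3 (fun p => ¬ p.1 < p.2),
    Finset.prod_filter_mul_prod_filter_not, Finset.prod_filter_of_ne, Fintype.prod_prod_type]
  intro p _ hp
  by_contra h
  exact hp (hG _ _ h)

theorem prod_freePairs {M : Type*} [CommMonoid M] {s : ℕ} (hs : 2 * s ≤ r) (t : Fin r → M) :
    ∏ p : FreePairs r s, (t p.fst * t p.snd) = ∏ i, t i ^ freeCount s i := by
  have h := prod_eq_prod_freePairs (s := s) (fun i j => if IsFree s i j then t i else 1)
    (fun i j h => if_neg h)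
  refine Eq.trans (Finset.prod_congr rfl fun p _ => ?_) (h.symm.trans
    (Finset.prod_congr rfl fun i _ => ?_))
  · have hp : IsFree s p.fst p.snd := p.2.2
    rw [if_pos hp, if_pos hp.symm]
  · rw [← Finset.prod_filter, Finset.prod_const, card_filter_isFree hs]

theorem prod_blocks {M : Type*} [CommMonoid M] {s : ℕ} (hs : 2 * s ≤ r) (F : Fin r → M) :
    ∏ i, F i = (∏ i : Fin s, F ⟨i, by omega⟩) *
      (∏ i ∈ Finset.univ.filter (fun i : Fin r => s ≤ (i : ℕ) ∧ (i : ℕ) < r - s), F i) *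
      ∏ i : Fin s, F ⟨r - s + i, by omega⟩ := by
  have h1 : ∏ i : Fin s, F ⟨i, by omega⟩ =
      ∏ i ∈ Finset.univ.filter (fun i : Fin r => (i : ℕ) < s), F i :=
    Finset.prod_bij (fun i _ => ⟨i, by omega⟩) (fun i _ => by simp)
      (fun i _ j _ h => by simpa [Fin.ext_iff] using h)
      (fun i hi => ⟨⟨i, by simpa using hi⟩, Finset.mem_univ _, rfl⟩) (fun i _ => rfl)
  have h2 : ∏ i : Fin s, F ⟨r - s + i, by omega⟩ =
      ∏ i ∈ Finset.univ.filter (fun i : Fin r => ¬ (i : ℕ) < r - s), F i :=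
    Finset.prod_bij (fun i _ => ⟨r - s + i, by omega⟩)
      (fun i _ => by simp only [Finset.mem_filter, Finset.mem_univ, true_and]; omega)
      (fun i _ j _ h => by simpa [Fin.ext_iff] using h)
      (fun i hi => ⟨⟨i - (r - s), by simp at hi; omega⟩, Finset.mem_univ _, by
        simp at hi; ext; simp; omega⟩) (fun i _ => rfl)
  rw [h1, h2, ← Finset.prod_filter_mul_prod_filter_not Finset.univ (fun i : Fin r => (i : ℕ) < r - s),
    ← Finset.prod_filter_mul_prod_filter_not
      (Finset.univ.filter fun i : Fin r => (i : ℕ) < r - s) (fun i : Fin r => (i : ℕ) < s),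
    Finset.filter_filter, Finset.filter_filter]
  congr 2
  · refine Finset.prod_congr ?_ fun _ _ => rfl
    ext i; simp; omega
  · refine Finset.prod_congr ?_ fun _ _ => rfl
    ext i; simp; omega

theorem prod_freePairs_blocks {M : Type*} [CommMonoid M] {s : ℕ} (hs : 2 * s ≤ r) (t : Fin r → M) :
    ∏ p : FreePairs r s, (t p.fst * t p.snd) = (∏ i : Fin s, t ⟨i, by omega⟩) ^ s *
      (∏ i ∈ Finset.univ.filter (fun i : Fin r => s ≤ (i : ℕ) ∧ (i : ℕ) < r - s), t i)
        ^ (r - s - 1) *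
      (∏ i : Fin s, t ⟨r - s + i, by omega⟩) ^ (r - 1) := by
  rw [prod_freePairs hs, prod_blocks hs]
  simp only [← Finset.prod_pow]
  congr 1
  · congr 1
    · refine Finset.prod_congr rfl fun i _ => ?_
      simp [freeCount]
    · refine Finset.prod_congr rfl fun i hi => ?_
      simp only [Finset.mem_filter, Finset.mem_univ, true_and] at hi
      rw [freeCount, if_neg (by omega), if_pos (by omega)]
  · refine Finset.prod_congr rfl fun i _ => ?_
    rw [freeCount, if_neg (by simp; omega), if_neg (by simp)]

theorem two_mul_card_freePairs {s : ℕ} (hs : 2 * s ≤ r) :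
    2 * Fintype.card (FreePairs r s) = s * s + (r - 2 * s) * (r - s - 1) + s * (r - 1) := by
  have h := prod_freePairs_blocks hs (fun _ : Fin r => (2 : ℕ))
  have hc := congrArg Finset.card (rfl : (Finset.univ.filter
    (fun i : Fin r => s ≤ (i : ℕ) ∧ (i : ℕ) < r - s)) = _)
  have h1 := prod_blocks hs (fun _ : Fin r => (2 : ℕ))
  simp only [Finset.prod_const, Finset.card_univ, Fintype.card_fin, ← pow_add] at h h1
  have h2 := Nat.pow_right_injective le_rfl h1
  set m := (Finset.univ.filter
    (fun i : Fin r => s ≤ (i : ℕ) ∧ (i : ℕ) < r - s)).card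
  have hm : m = r - 2 * s := by omega
  rw [hm, ← pow_two, ← pow_mul, ← pow_mul, ← pow_mul, ← pow_mul, ← pow_add, ← pow_add] at h
  exact Nat.pow_right_injective le_rfl h

end Pairs

end OrthBundle

namespace OrthBundle

/-! ### The adjoint representation of the parabolic subgroup -/

section Adjoint

variable {r : ℕ}

theorem mem_parabolicLie {B : Matrix (Fin r) (Fin r) ℂ} {W : Submodule ℂ (Fin r → ℂ)}
    {A : Matrix (Fin r) (Fin r) ℂ} :
    A ∈ parabolicLie B W ↔ (∃ c : ℂ, Aᵀ * B + B * A = c • B) ∧ ∀ v ∈ W, A *ᵥ v ∈ W :=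
  inLieAlgebra_parabolic_iff B W A

theorem forall_dotProduct_mulVec_iff {M N : Matrix (Fin r) (Fin r) ℂ}
    (h : ∀ v w : Fin r → ℂ, v ⬝ᵥ M *ᵥ w = v ⬝ᵥ N *ᵥ w) : M = N := by
  refine Matrix.ext_of_mulVec_single fun k => dotProduct_eq _ _ fun v => ?_
  rw [dotProduct_comm, h, dotProduct_comm]

theorem bilin_conformal {B A : Matrix (Fin r) (Fin r) ℂ} {c : ℂ} (h : Aᵀ * B + B * A = c • B)
    (v w : Fin r → ℂ) : (A *ᵥ v) ⬝ᵥ B *ᵥ w + v ⬝ᵥ B *ᵥ (A *ᵥ w) = c * (v ⬝ᵥ B *ᵥ w) := by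
  have := congrArg (fun M => v ⬝ᵥ M *ᵥ w) h
  simp only [Matrix.add_mulVec, dotProduct_add, Matrix.smul_mulVec, dotProduct_smul,
    ← Matrix.mulVec_mulVec, Matrix.dotProduct_transpose_mulVec, smul_eq_mul] at this
  rw [← this, dotProduct_comm]

theorem conformal_of_bilin {B A : Matrix (Fin r) (Fin r) ℂ} {c : ℂ}
    (h : ∀ v w : Fin r → ℂ,
      (A *ᵥ v) ⬝ᵥ B *ᵥ w + v ⬝ᵥ B *ᵥ (A *ᵥ w) = c * (v ⬝ᵥ B *ᵥ w)) :
    Aᵀ * B + B * A = c • B := by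
  refine forall_dotProduct_mulVec_iff fun v w => ?_
  simp only [Matrix.add_mulVec, dotProduct_add, Matrix.smul_mulVec, dotProduct_smul,
    ← Matrix.mulVec_mulVec, Matrix.dotProduct_transpose_mulVec, smul_eq_mul]
  rw [← h, dotProduct_comm]

theorem bilin_similitude {B S : Matrix (Fin r) (Fin r) ℂ} {c : ℂ} (h : Sᵀ * B * S = c • B)
    (v w : Fin r → ℂ) : (S *ᵥ v) ⬝ᵥ B *ᵥ (S *ᵥ w) = c * (v ⬝ᵥ B *ᵥ w) := by
  rw [← dotProduct_transpose_mul_mul_mulVec, h, Matrix.smul_mulVec, dotProduct_smul, smul_eq_mul]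

/-- The multiplier of a conformal endomorphism is determined by its trace. -/
theorem conformal_trace {B A : Matrix (Fin r) (Fin r) ℂ} {c : ℂ}
    (hdet : B.det ≠ 0) (h : Aᵀ * B + B * A = c • B) : 2 * A.trace = c * r := by
  have hBu : IsUnit B.det := isUnit_iff_ne_zero.2 hdet
  have h1 := congrArg (fun M => (B⁻¹ * M).trace) h
  simp only [mul_add, Matrix.trace_add, Matrix.mul_smul, Matrix.trace_smul, smul_eq_mul,
    ← mul_assoc, Matrix.nonsing_inv_mul _ hBu, one_mul, Matrix.trace_one, Fintype.card_fin] at h1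
  rw [Matrix.trace_mul_comm, ← mul_assoc, Matrix.mul_nonsing_inv _ hBu, one_mul,
    Matrix.trace_transpose] at h1
  rw [← h1, two_mul]

theorem parabolic_inv_mulVec_mem {B : Matrix (Fin r) (Fin r) ℂ} {W : Submodule ℂ (Fin r → ℂ)}
    (g : parabolic B W) {v : Fin r → ℂ} (hv : v ∈ W) :
    ((g⁻¹ : parabolic B W) : GL (Fin r) ℂ) *ᵥ v ∈ W :=
  ((g⁻¹ : parabolic B W).2.2 v).2 hv

theorem parabolic_mul_inv {B : Matrix (Fin r) (Fin r) ℂ} {W : Submodule ℂ (Fin r → ℂ)}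
    (g : parabolic B W) : ((g : GL (Fin r) ℂ) : Matrix (Fin r) (Fin r) ℂ) *
      ((g⁻¹ : parabolic B W) : GL (Fin r) ℂ) = 1 := by
  rw [← Units.val_mul, ← Subgroup.coe_mul, mul_inv_cancel, Subgroup.coe_one, Units.val_one]

theorem parabolic_inv_mul {B : Matrix (Fin r) (Fin r) ℂ} {W : Submodule ℂ (Fin r → ℂ)}
    (g : parabolic B W) : (((g⁻¹ : parabolic B W) : GL (Fin r) ℂ) : Matrix (Fin r) (Fin r) ℂ) *
      (g : GL (Fin r) ℂ) = 1 := by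
  rw [← Units.val_mul, ← Subgroup.coe_mul, inv_mul_cancel, Subgroup.coe_one, Units.val_one]

theorem conj_mulVec_mulVec {B : Matrix (Fin r) (Fin r) ℂ} {W : Submodule ℂ (Fin r → ℂ)}
    (g : parabolic B W) (A : Matrix (Fin r) (Fin r) ℂ) (v : Fin r → ℂ) :
    (((g : GL (Fin r) ℂ) : Matrix (Fin r) (Fin r) ℂ) * A *
      (((g⁻¹ : parabolic B W) : GL (Fin r) ℂ) : Matrix (Fin r) (Fin r) ℂ)) *ᵥ
        (((g : GL (Fin r) ℂ) : Matrix (Fin r) (Fin r) ℂ) *ᵥ v) =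
      ((g : GL (Fin r) ℂ) : Matrix (Fin r) (Fin r) ℂ) *ᵥ (A *ᵥ v) := by
  rw [Matrix.mulVec_mulVec, Matrix.mulVec_mulVec, mul_assoc, parabolic_inv_mul, mul_one]

theorem parabolic_mulVec_inv {B : Matrix (Fin r) (Fin r) ℂ} {W : Submodule ℂ (Fin r → ℂ)}
    (g : parabolic B W) (v : Fin r → ℂ) : ((g : GL (Fin r) ℂ) : Matrix (Fin r) (Fin r) ℂ) *ᵥ
      ((((g⁻¹ : parabolic B W) : GL (Fin r) ℂ) : Matrix (Fin r) (Fin r) ℂ) *ᵥ v) = v := by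
  rw [Matrix.mulVec_mulVec, parabolic_mul_inv, Matrix.one_mulVec]

theorem parabolic_inv_mulVec {B : Matrix (Fin r) (Fin r) ℂ} {W : Submodule ℂ (Fin r → ℂ)}
    (g : parabolic B W) (v : Fin r → ℂ) :
    (((g⁻¹ : parabolic B W) : GL (Fin r) ℂ) : Matrix (Fin r) (Fin r) ℂ) *ᵥ
      (((g : GL (Fin r) ℂ) : Matrix (Fin r) (Fin r) ℂ) *ᵥ v) = v := by
  rw [Matrix.mulVec_mulVec, parabolic_inv_mul, Matrix.one_mulVec]

theorem conj_mem_parabolicLie {B : Matrix (Fin r) (Fin r) ℂ} {W : Submodule ℂ (Fin r → ℂ)}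
    (g : parabolic B W) {A : Matrix (Fin r) (Fin r) ℂ} (hA : A ∈ parabolicLie B W) :
    ((g : GL (Fin r) ℂ) : Matrix (Fin r) (Fin r) ℂ) * A *
      ((g⁻¹ : parabolic B W) : GL (Fin r) ℂ) ∈ parabolicLie B W := by
  rw [mem_parabolicLie] at *
  obtain ⟨⟨c, hc⟩, hAW⟩ := hA
  obtain ⟨γ, hγ0, hγ⟩ := g.2.1
  refine ⟨⟨c, conformal_of_bilin fun v w => ?_⟩, fun v hv => ?_⟩
  · obtain ⟨v, rfl⟩ : ∃ v', v = ((g : GL (Fin r) ℂ) : Matrix (Fin r) (Fin r) ℂ) *ᵥ v' :=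
      ⟨_, (parabolic_mulVec_inv g v).symm⟩
    obtain ⟨w, rfl⟩ : ∃ v', w = ((g : GL (Fin r) ℂ) : Matrix (Fin r) (Fin r) ℂ) *ᵥ v' :=
      ⟨_, (parabolic_mulVec_inv g w).symm⟩
    rw [conj_mulVec_mulVec, conj_mulVec_mulVec, bilin_similitude hγ, bilin_similitude hγ, bilin_similitude hγ, ← mul_add,
      bilin_conformal hc]
    ring
  · rw [← Matrix.mulVec_mulVec, ← Matrix.mulVec_mulVec]
    exact (g.2.2 _).2 (hAW _ (parabolic_inv_mulVec_mem g hv))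

/-- The adjoint action of the parabolic subgroup on its Lie algebra. -/
def adjointAction {B : Matrix (Fin r) (Fin r) ℂ} {W : Submodule ℂ (Fin r → ℂ)}
    (g : parabolic B W) : parabolicLie B W →ₗ[ℂ] parabolicLie B W where
  toFun A := ⟨_, conj_mem_parabolicLie g A.2⟩
  map_add' A A' := Subtype.ext (by simp [mul_add, add_mul])
  map_smul' c A := Subtype.ext (by simp)

/-- The restriction to `W` of an element of the parabolic subgroup. -/
def restrictToSubspace {B : Matrix (Fin r) (Fin r) ℂ} {W : Submodule ℂ (Fin r → ℂ)}
    (g : parabolic B W) : W →ₗ[ℂ] W :=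
  (Matrix.toLin' ((g : GL (Fin r) ℂ) : Matrix (Fin r) (Fin r) ℂ)).restrict
    fun v hv => (g.2.2 v).2 hv

theorem restrictToSubspace_apply {B : Matrix (Fin r) (Fin r) ℂ} {W : Submodule ℂ (Fin r → ℂ)}
    (g : parabolic B W) (w : W) : (restrictToSubspace g w : Fin r → ℂ) =
      ((g : GL (Fin r) ℂ) : Matrix (Fin r) (Fin r) ℂ) *ᵥ (w : Fin r → ℂ) := rfl

variable {B : Matrix (Fin r) (Fin r) ℂ} {W : Submodule ℂ (Fin r → ℂ)}

/-- The coordinates of an element of the parabolic Lie algebra: the entries of the skew form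
`(v, w) ↦ B (v, A w) - (tr A / r) B (v, w)` in the basis `e`, and the trace. -/
def parabolicCoords (B : Matrix (Fin r) (Fin r) ℂ) (W : Submodule ℂ (Fin r → ℂ)) (s : ℕ)
    (e : Fin r → Fin r → ℂ) : parabolicLie B W →ₗ[ℂ] (FreePairs r s → ℂ) × ℂ where
  toFun A := (fun p => e p.fst ⬝ᵥ B *ᵥ ((A : Matrix (Fin r) (Fin r) ℂ) *ᵥ e p.snd) -
    (A : Matrix (Fin r) (Fin r) ℂ).trace / r * (e p.fst ⬝ᵥ B *ᵥ e p.snd),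
    (A : Matrix (Fin r) (Fin r) ℂ).trace)
  map_add' A A' := by
    ext
    · simp only [Submodule.coe_add, Matrix.add_mulVec, Matrix.mulVec_add, dotProduct_add,
        Matrix.trace_add, Prod.mk_add_mk, Pi.add_apply]
      ring
    · simp
  map_smul' c A := by
    ext
    · simp only [Submodule.coe_smul, Matrix.smul_mulVec, Matrix.mulVec_smul, dotProduct_smul,
        Matrix.trace_smul, Prod.smul_mk, Pi.smul_apply, RingHom.id_apply, smul_eq_mul]
      ring
    · simp

/-- A basis of `ℂʳ` whose first `s` vectors lie in `W` and whose first `r - s` vectors lie in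
`W^⊥`. -/
def IsAdaptedBasis (B : Matrix (Fin r) (Fin r) ℂ) (W : Submodule ℂ (Fin r → ℂ))
    (e : Module.Basis (Fin r) ℂ (Fin r → ℂ)) : Prop :=
  (∀ i : Fin r, (i : ℕ) < Module.finrank ℂ W → e i ∈ W) ∧
    ∀ i : Fin r, (i : ℕ) < r - Module.finrank ℂ W → e i ∈ orthCompl B W

theorem IsIsotropic.two_mul_finrank_le (hdet : B.det ≠ 0) (hW : IsIsotropic B W) :
    2 * Module.finrank ℂ W ≤ r := by
  have h1 := Submodule.finrank_mono hW.le_orthCompl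
  rw [finrank_orthCompl hdet] at h1
  have h2 := W.finrank_le
  simp only [Module.finrank_fintype_fun_eq_card, Fintype.card_fin] at h2
  omega

theorem exists_adapted_triangular_basis (hdet : B.det ≠ 0)
    (hW : IsIsotropic B W) (g : parabolic B W) :
    ∃ e : Module.Basis (Fin r) ℂ (Fin r → ℂ), IsAdaptedBasis B W e ∧
      ∀ i j : Fin r, j < i →
        e.repr (((g : GL (Fin r) ℂ) : Matrix (Fin r) (Fin r) ℂ) *ᵥ e j) i = 0 := by
  have h2s := hW.two_mul_finrank_le hdet
  let C : ℕ → Submodule ℂ (Fin r → ℂ) := fun k =>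
    if k < Module.finrank ℂ W then W else if k < r - Module.finrank ℂ W then orthCompl B W else ⊤
  obtain ⟨γ, hγ0, hγ⟩ := g.2.1
  have hCg : ∀ k, ∀ v ∈ C k,
      Matrix.toLin' ((g : GL (Fin r) ℂ) : Matrix (Fin r) (Fin r) ℂ) v ∈ C k := by
    intro k v hv
    simp only [C] at hv ⊢
    split_ifs at hv ⊢
    · exact (g.2.2 v).2 hv
    · rw [mem_orthCompl] at hv ⊢
      intro w hw
      have hw' : w = ((g : GL (Fin r) ℂ) : Matrix (Fin r) (Fin r) ℂ) *ᵥ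
          (((g⁻¹ : parabolic B W) : GL (Fin r) ℂ) *ᵥ w) := by
        rw [parabolic_mulVec_inv]
      rw [hw', Matrix.toLin'_apply, bilin_similitude hγ,
        hv _ (parabolic_inv_mulVec_mem g hw), mul_zero]
    · trivial
  have hCr : ∀ k < r, k < Module.finrank ℂ (C k) := by
    intro k hk
    by_cases h1 : k < Module.finrank ℂ W
    · rwa [show C k = W from if_pos h1]
    · by_cases h2 : k < r - Module.finrank ℂ W
      · rwa [show C k = orthCompl B W from (if_neg h1).trans (if_pos h2), finrank_orthCompl hdet]
      · rw [show C k = ⊤ from (if_neg h1).trans (if_neg h2)]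
        simpa using hk
  obtain ⟨e, he, he'⟩ := exists_triangular_basis
    (Matrix.toLin' ((g : GL (Fin r) ℂ) : Matrix (Fin r) (Fin r) ℂ)) C hCg r hCr (by simp)
  refine ⟨e, ⟨fun i hi => ?_, fun i hi => ?_⟩, he'⟩
  · have := he i
    simpa only [C, if_pos hi] using this
  · by_cases h : (i : ℕ) < Module.finrank ℂ W
    · have := he i
      simp only [C, if_pos h] at this
      exact hW.le_orthCompl this
    · have := he i
      simpa only [C, if_neg h, if_pos hi] using this

theorem parabolicCoords_skew {A : Matrix (Fin r) (Fin r) ℂ} (hr : r ≠ 0) (hB : B.IsSymm)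
    (hdet : B.det ≠ 0) (hA : A ∈ parabolicLie B W) (v w : Fin r → ℂ) :
    v ⬝ᵥ B *ᵥ (A *ᵥ w) - A.trace / r * (v ⬝ᵥ B *ᵥ w) =
      -(w ⬝ᵥ B *ᵥ (A *ᵥ v) - A.trace / r * (w ⬝ᵥ B *ᵥ v)) := by
  obtain ⟨⟨c, hc⟩, -⟩ := mem_parabolicLie.1 hA
  have h1 := bilin_conformal hc w v
  have h2 := conformal_trace hdet hc
  have hr' : (r : ℂ) ≠ 0 := by exact_mod_cast hr
  rw [dotProduct_mulVec_comm hB (A *ᵥ w) v] at h1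
  have h3 : c = 2 * A.trace / r := by field_simp; linear_combination -h2
  rw [dotProduct_mulVec_comm hB v w]
  linear_combination h1 + (w ⬝ᵥ B *ᵥ v) * h3

theorem parabolicCoords_zero {A : Matrix (Fin r) (Fin r) ℂ}
    (hA : A ∈ parabolicLie B W) {v w : Fin r → ℂ} (hv : v ∈ orthCompl B W) (hw : w ∈ W)
    (hB : B.IsSymm) :
    v ⬝ᵥ B *ᵥ (A *ᵥ w) - A.trace / r * (v ⬝ᵥ B *ᵥ w) = 0 := by
  have hA' := (mem_parabolicLie.1 hA).2 w hw
  rw [dotProduct_mulVec_comm hB, mem_orthCompl.1 hv _ hA', dotProduct_mulVec_comm hB v,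
    mem_orthCompl.1 hv _ hw]
  simp

theorem bijective_parabolicCoords (hr : r ≠ 0) (hB : B.IsSymm) (hdet : B.det ≠ 0)
    (hW : IsIsotropic B W) (e : Module.Basis (Fin r) ℂ (Fin r → ℂ)) (he : IsAdaptedBasis B W e) :
    Function.Bijective (parabolicCoords B W (Module.finrank ℂ W) e) := by
  classical
  have hr' : (r : ℂ) ≠ 0 := by exact_mod_cast hr
  set s := Module.finrank ℂ W with hs
  have h2s : 2 * s ≤ r := hW.two_mul_finrank_le hdet
  constructor
  · rw [← LinearMap.ker_eq_bot, LinearMap.ker_eq_bot']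
    rintro ⟨A, hA⟩ h0
    have htr : A.trace = 0 := congrArg Prod.snd h0
    have hfree : ∀ i j : Fin r, i < j → IsFree s i j →
        e i ⬝ᵥ B *ᵥ (A *ᵥ e j) - A.trace / r * (e i ⬝ᵥ B *ᵥ e j) = 0 := fun i j hij hf =>
      congrFun (congrArg Prod.fst h0) (⟨toLex (i, j), hij, hf⟩ : FreePairs r s)
    have hle : ∀ i j : Fin r, i ≤ j →
        e i ⬝ᵥ B *ᵥ (A *ᵥ e j) - A.trace / r * (e i ⬝ᵥ B *ᵥ e j) = 0 := by
      intro i j hij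
      rcases eq_or_lt_of_le hij with rfl | hij'
      · have := parabolicCoords_skew hr hB hdet hA (e i) (e i)
        exact self_eq_neg.1 this
      · by_cases hf : IsFree s i j
        · exact hfree i j hij' hf
        · have hlt : (i : ℕ) < j := hij'
          have hi : (i : ℕ) < s ∧ (j : ℕ) < r - s := by
            by_contra hcon
            refine hf ⟨hij'.ne, hcon, fun h => hcon ⟨by omega, by omega⟩⟩
          rw [parabolicCoords_skew hr hB hdet hA,
            parabolicCoords_zero hA (he.2 j hi.2) (he.1 i hi.1) hB, neg_zero]
    have hall : ∀ i j : Fin r, e i ⬝ᵥ B *ᵥ (A *ᵥ e j) = 0 := by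
      intro i j
      have : e i ⬝ᵥ B *ᵥ (A *ᵥ e j) - A.trace / r * (e i ⬝ᵥ B *ᵥ e j) = 0 := by
        rcases le_total i j with h | h
        · exact hle i j h
        · rw [parabolicCoords_skew hr hB hdet hA, hle j i h, neg_zero]
      simpa [htr] using this
    ext1
    have hz : Matrix.toLin' A = 0 := by
      refine e.ext fun j => ?_
      refine (toBilin'_nondegenerate hdet).2 _ fun v => ?_
      rw [Matrix.toBilin'_apply']
      have : (Matrix.toBilin' B).flip (Matrix.toLin' A (e j)) = 0 :=
        e.ext fun i => by
          change Matrix.toBilin' B (e i) (Matrix.toLin' A (e j)) = 0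
          rw [Matrix.toBilin'_apply', Matrix.toLin'_apply, hall]
      have := LinearMap.congr_fun this v
      change Matrix.toBilin' B v (Matrix.toLin' A (e j)) = 0 at this
      rwa [Matrix.toBilin'_apply'] at this
    exact Matrix.toLin'.map_eq_zero_iff.1 hz
  · rintro ⟨m, τ⟩
    let M : Fin r → Fin r → ℂ := fun i j =>
      if h : i < j ∧ IsFree s i j then m ⟨toLex (i, j), h⟩
      else if h : j < i ∧ IsFree s j i then - m ⟨toLex (j, i), h⟩ else 0
    have hMskew : ∀ i j, M i j = - M j i := by
      intro i j
      simp only [M]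
      by_cases h1 : i < j ∧ IsFree s i j
      · rw [dif_pos h1, dif_neg (fun h => (lt_asymm h1.1 h.1)), dif_pos h1, neg_neg]
      · rw [dif_neg h1, dif_neg h1]
        by_cases h2 : j < i ∧ IsFree s j i
        · rw [dif_pos h2, dif_pos h2]
        · rw [dif_neg h2, dif_neg h2, neg_zero]
    have hM0 : ∀ i j, ¬ IsFree s i j → M i j = 0 := by
      intro i j h
      simp only [M]
      rw [dif_neg (fun h' => h h'.2), dif_neg (fun h' => h h'.2.symm)]
    let b := Matrix.toBilin' B
    have hb : b.Nondegenerate := toBilin'_nondegenerate hdet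
    have hbs : b.IsSymm := ⟨fun v w => by
      simp only [b, Matrix.toBilin'_apply']
      exact dotProduct_mulVec_comm hB v w⟩
    let d := b.dualBasis hb e
    have hd : ∀ i j, e i ⬝ᵥ B *ᵥ d j = if i = j then 1 else 0 := fun i j => by
      rw [← Matrix.toBilin'_apply']
      exact LinearMap.BilinForm.apply_dualBasis_right hb hbs e i j
    let A₀ := LinearMap.toMatrix' (e.constr ℂ fun j => ∑ i, M i j • d i)
    have hA₀ : ∀ j, A₀ *ᵥ e j = ∑ i, M i j • d i := fun j => by
      rw [LinearMap.toMatrix'_mulVec, Module.Basis.constr_basis]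
    have hA₀M : ∀ i j, e i ⬝ᵥ B *ᵥ (A₀ *ᵥ e j) = M i j := fun i j => by
      rw [hA₀, ← Matrix.toBilin'_apply', map_sum]
      simp only [map_smul, Matrix.toBilin'_apply', hd]
      simp
    have hskew : ∀ v w : Fin r → ℂ, (A₀ *ᵥ v) ⬝ᵥ B *ᵥ w + v ⬝ᵥ B *ᵥ (A₀ *ᵥ w) = 0 := by
      have : b.comp (Matrix.toLin' A₀) LinearMap.id + b.comp LinearMap.id (Matrix.toLin' A₀) = 0 :=
        LinearMap.BilinForm.ext_basis e fun i j => by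
          simp only [b, LinearMap.add_apply, LinearMap.BilinForm.comp_apply, Matrix.toLin'_apply,
            LinearMap.id_apply, Matrix.toBilin'_apply', LinearMap.zero_apply]
          rw [dotProduct_mulVec_comm hB, hA₀M, hA₀M, hMskew, neg_add_cancel]
      intro v w
      have := LinearMap.congr_fun (LinearMap.congr_fun this v) w
      simpa only [b, LinearMap.add_apply, LinearMap.BilinForm.comp_apply, Matrix.toLin'_apply,
            LinearMap.id_apply, Matrix.toBilin'_apply', LinearMap.zero_apply] using this
    have hA₀c : A₀ᵀ * B + B * A₀ = (0 : ℂ) • B :=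
      conformal_of_bilin fun v w => by rw [hskew, zero_mul]
    have hspanW : Submodule.span ℂ (e '' {i : Fin r | (i : ℕ) < s}) = W := by
      apply Submodule.eq_of_le_of_finrank_eq
      · rw [Submodule.span_le]
        rintro _ ⟨i, hi, rfl⟩
        exact he.1 i hi
      · rw [← hs, finrank_span_set_eq_card (e.linearIndependent.linearIndepOn _).id_image,
          toFinset_image, Finset.card_image_of_injective _ e.injective]
        simp only [toFinset_ofPred]
        rw [Fin.card_filter_val_lt, min_eq_right (by omega)]
    have hspanP : Submodule.span ℂ (e '' {i : Fin r | (i : ℕ) < r - s}) = orthCompl B W := by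
      apply Submodule.eq_of_le_of_finrank_eq
      · rw [Submodule.span_le]
        rintro _ ⟨i, hi, rfl⟩
        exact he.2 i hi
      · rw [finrank_orthCompl hdet,
          finrank_span_set_eq_card (e.linearIndependent.linearIndepOn _).id_image,
          toFinset_image, Finset.card_image_of_injective _ e.injective]
        simp only [toFinset_ofPred]
        rw [Fin.card_filter_val_lt, min_eq_right (by omega)]
    have hA₀W : ∀ w ∈ W, A₀ *ᵥ w ∈ W := by
      intro w hw
      rw [← hspanW] at hw
      refine Submodule.span_induction (p := fun x _ => A₀ *ᵥ x ∈ W) ?_ (by simp)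
        (fun x y _ _ hx hy => by rw [Matrix.mulVec_add]; exact W.add_mem hx hy)
        (fun a x _ hx => by rw [Matrix.mulVec_smul]; exact W.smul_mem a hx) hw
      rintro _ ⟨j, hj, rfl⟩
      have hj' : (j : ℕ) < s := hj
      refine mem_of_orthogonal_orthCompl hB hdet fun v hv => ?_
      rw [← hspanP] at hv
      refine Submodule.span_induction (p := fun x _ => x ⬝ᵥ B *ᵥ (A₀ *ᵥ e j) = 0) ?_ (by simp)
        (fun x y _ _ hx hy => by rw [add_dotProduct, hx, hy, add_zero])
        (fun a x _ hx => by rw [smul_dotProduct, hx, smul_zero]) hv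
      rintro _ ⟨i, hi, rfl⟩
      rw [hA₀M]
      exact hM0 i j fun h => h.2.2 ⟨hj', hi⟩
    have htr₀ : A₀.trace = 0 := by
      have := conformal_trace hdet hA₀c
      simpa using this
    refine ⟨⟨A₀ + (τ / r) • 1, mem_parabolicLie.2 ⟨⟨2 * (τ / r), ?_⟩, fun w hw => ?_⟩⟩, ?_⟩
    · rw [zero_smul] at hA₀c
      rw [Matrix.transpose_add, Matrix.transpose_smul, Matrix.transpose_one, add_mul, mul_add,
        add_add_add_comm, hA₀c, Matrix.smul_mul, Matrix.mul_smul, one_mul, mul_one, zero_add,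
        ← add_smul, two_mul]
    · rw [Matrix.add_mulVec, Matrix.smul_mulVec, Matrix.one_mulVec]
      exact W.add_mem (hA₀W w hw) (W.smul_mem _ hw)
    · have htr : (A₀ + (τ / r) • (1 : Matrix (Fin r) (Fin r) ℂ)).trace = τ := by
        rw [Matrix.trace_add, htr₀, Matrix.trace_smul, Matrix.trace_one, Fintype.card_fin]
        simp [hr']
      refine Prod.ext (funext fun p => ?_) htr
      change e p.fst ⬝ᵥ B *ᵥ ((A₀ + (τ / r) • (1 : Matrix (Fin r) (Fin r) ℂ)) *ᵥ e p.snd) -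
        (A₀ + (τ / r) • (1 : Matrix (Fin r) (Fin r) ℂ)).trace / r * _ = m p
      rw [htr, Matrix.add_mulVec, Matrix.mulVec_add, dotProduct_add, hA₀M, Matrix.smul_mulVec,
        Matrix.one_mulVec, Matrix.mulVec_smul, dotProduct_smul, smul_eq_mul, add_sub_cancel_right]
      exact dif_pos p.2

end Adjoint

end OrthBundle

namespace OrthBundle

section AdjointDet

variable {r : ℕ} {B : Matrix (Fin r) (Fin r) ℂ} {W : Submodule ℂ (Fin r → ℂ)}

theorem finrank_parabolicLie (hr : r ≠ 0) (hB : B.IsSymm) (hdet : B.det ≠ 0)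
    (hW : IsIsotropic B W) :
    Module.finrank ℂ (parabolicLie B W) = Fintype.card (FreePairs r (Module.finrank ℂ W)) + 1 := by
  obtain ⟨e, he, -⟩ := exists_adapted_triangular_basis hdet hW 1
  rw [(LinearEquiv.ofBijective _ (bijective_parabolicCoords hr hB hdet hW e he)).finrank_eq]
  simp

theorem finrank_parabolicLie_eq (hr : r ≠ 0) (hB : B.IsSymm) (hdet : B.det ≠ 0)
    (hW : IsIsotropic B W) :
    (Module.finrank ℂ (parabolicLie B W) : ℝ) = ((r : ℝ) ^ 2 - r) / 2 -
      (2 * (r : ℝ) * Module.finrank ℂ W - 3 * (Module.finrank ℂ W : ℝ) ^ 2 -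
        Module.finrank ℂ W) / 2 + 1 := by
  have h2s := hW.two_mul_finrank_le hdet
  have h := two_mul_card_freePairs h2s
  rw [finrank_parabolicLie hr hB hdet hW]
  set s := Module.finrank ℂ W
  have h' : (2 : ℝ) * Fintype.card (FreePairs r s) =
      s * s + (r - 2 * s) * (r - s - 1) + s * (r - 1) := by
    have := congrArg (Nat.cast : ℕ → ℝ) h
    push_cast [Nat.cast_sub h2s, Nat.cast_sub (show 1 ≤ r by omega),
      Nat.cast_sub (show 1 ≤ r - s by omega), Nat.cast_sub (show s ≤ r by omega)] at this
    exact this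
  push_cast
  linear_combination h' / 2

/-- The matrix of `h` in the basis `e`. -/
def basisMatrix (e : Module.Basis (Fin r) ℂ (Fin r → ℂ)) (h : Matrix (Fin r) (Fin r) ℂ) :
    Matrix (Fin r) (Fin r) ℂ :=
  Matrix.of fun i j => e.repr (h *ᵥ e j) i

theorem mulVec_basis (e : Module.Basis (Fin r) ℂ (Fin r → ℂ)) (h : Matrix (Fin r) (Fin r) ℂ)
    (j : Fin r) : h *ᵥ e j = ∑ i, basisMatrix e h i j • e i :=
  (e.sum_repr _).symm

theorem det_basisMatrix (e : Module.Basis (Fin r) ℂ (Fin r → ℂ)) (h : Matrix (Fin r) (Fin r) ℂ) :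
    (basisMatrix e h).det = h.det := by
  rw [← LinearMap.det_toLin' h, ← LinearMap.det_toMatrix e]
  refine congrArg Matrix.det (Matrix.ext fun i j => ?_)
  exact (LinearMap.toMatrix_apply e e (Matrix.toLin' h) i j).symm

theorem bilin_basis_expand (e : Module.Basis (Fin r) ℂ (Fin r → ℂ))
    (M h : Matrix (Fin r) (Fin r) ℂ) (i j : Fin r) :
    (h *ᵥ e i) ⬝ᵥ M *ᵥ (h *ᵥ e j) =
      ∑ k, ∑ l, basisMatrix e h k i * basisMatrix e h l j * (e k ⬝ᵥ M *ᵥ e l) := by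
  rw [mulVec_basis e h i, mulVec_basis e h j, sum_dotProduct]
  refine Finset.sum_congr rfl fun k _ => ?_
  rw [Matrix.mulVec_sum, dotProduct_sum]
  refine Finset.sum_congr rfl fun l _ => ?_
  rw [smul_dotProduct, Matrix.mulVec_smul, dotProduct_smul, smul_eq_mul, smul_eq_mul]
  ring

theorem det_adjointAction (hr : r ≠ 0) (hB : B.IsSymm) (hdet : B.det ≠ 0)
    (hW : IsIsotropic B W) (g : parabolic B W) {c : ℂ}
    (hc : ((g : GL (Fin r) ℂ) : Matrix (Fin r) (Fin r) ℂ)ᵀ * B * (g : GL (Fin r) ℂ) = c • B)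
    (e : Module.Basis (Fin r) ℂ (Fin r → ℂ)) (he : IsAdaptedBasis B W e)
    (htri : ∀ i j : Fin r, j < i →
      basisMatrix e ((g⁻¹ : parabolic B W) : GL (Fin r) ℂ) i j = 0) :
    LinearMap.det (adjointAction g) =
      ∏ p : FreePairs r (Module.finrank ℂ W),
        (c * (basisMatrix e ((g⁻¹ : parabolic B W) : GL (Fin r) ℂ) p.fst p.fst *
          basisMatrix e ((g⁻¹ : parabolic B W) : GL (Fin r) ℂ) p.snd p.snd)) := by
  set s := Module.finrank ℂ W with hs
  set H := basisMatrix e ((g⁻¹ : parabolic B W) : GL (Fin r) ℂ) with hH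
  let Ξ := LinearEquiv.ofBijective _ (bijective_parabolicCoords hr hB hdet hW e he)
  let N : Matrix (FreePairs r s) (FreePairs r s) ℂ := Matrix.of fun p q =>
    c * (H q.fst p.fst * H q.snd p.snd - H q.snd p.fst * H q.fst p.snd)
  have key : ∀ A, Ξ (adjointAction g A) = (LinearMap.prodMap (Matrix.toLin' N) LinearMap.id) (Ξ A) := by
    rintro ⟨A, hA⟩
    have htr : (((g : GL (Fin r) ℂ) : Matrix (Fin r) (Fin r) ℂ) * A *
      ((g⁻¹ : parabolic B W) : GL (Fin r) ℂ)).trace = A.trace := by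
      rw [Matrix.trace_mul_comm, ← mul_assoc, parabolic_inv_mul, one_mul]
    refine Prod.ext (funext fun p => ?_) htr
    let S : Matrix (Fin r) (Fin r) ℂ := B * A - (A.trace / r) • B
    have hS : ∀ v w : Fin r → ℂ,
        v ⬝ᵥ S *ᵥ w = v ⬝ᵥ B *ᵥ (A *ᵥ w) - A.trace / r * (v ⬝ᵥ B *ᵥ w) := fun v w => by
      rw [Matrix.sub_mulVec, dotProduct_sub, ← Matrix.mulVec_mulVec, Matrix.smul_mulVec,
        dotProduct_smul, smul_eq_mul]
    have hskew : ∀ v w, v ⬝ᵥ S *ᵥ w = - (w ⬝ᵥ S *ᵥ v) := fun v w => by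
      rw [hS, hS]; exact parabolicCoords_skew hr hB hdet hA v w
    have hzero : ∀ k l, ¬ IsFree s k l → e k ⬝ᵥ S *ᵥ e l = 0 := by
      intro k l hkl
      by_cases h0 : k = l
      · subst h0
        exact self_eq_neg.1 (hskew _ _)
      · by_cases h1 : (k : ℕ) < s ∧ (l : ℕ) < r - s
        · rw [hskew, hS, parabolicCoords_zero hA (he.2 l h1.2) (he.1 k h1.1) hB, neg_zero]
        · by_cases h2 : (l : ℕ) < s ∧ (k : ℕ) < r - s
          · rw [hS, parabolicCoords_zero hA (he.2 k h2.2) (he.1 l h2.1) hB]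
          · exact absurd ⟨h0, h1, h2⟩ hkl
    have hconj : ∀ v w : Fin r → ℂ,
        v ⬝ᵥ B *ᵥ ((((g : GL (Fin r) ℂ) : Matrix (Fin r) (Fin r) ℂ) * A *
          (((g⁻¹ : parabolic B W) : GL (Fin r) ℂ) : Matrix (Fin r) (Fin r) ℂ)) *ᵥ w) - A.trace / r * (v ⬝ᵥ B *ᵥ w) =
        c * (((((g⁻¹ : parabolic B W) : GL (Fin r) ℂ) : Matrix (Fin r) (Fin r) ℂ) *ᵥ v) ⬝ᵥ S *ᵥ
          ((((g⁻¹ : parabolic B W) : GL (Fin r) ℂ) : Matrix (Fin r) (Fin r) ℂ) *ᵥ w)) := by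
      intro v w
      obtain ⟨v, rfl⟩ : ∃ v', v = ((g : GL (Fin r) ℂ) : Matrix (Fin r) (Fin r) ℂ) *ᵥ v' :=
        ⟨_, (parabolic_mulVec_inv g v).symm⟩
      obtain ⟨w, rfl⟩ : ∃ v', w = ((g : GL (Fin r) ℂ) : Matrix (Fin r) (Fin r) ℂ) *ᵥ v' :=
        ⟨_, (parabolic_mulVec_inv g w).symm⟩
      rw [conj_mulVec_mulVec, bilin_similitude hc, bilin_similitude hc, hS,
        parabolic_inv_mulVec, parabolic_inv_mulVec]
      ring
    change e p.fst ⬝ᵥ B *ᵥ ((((g : GL (Fin r) ℂ) : Matrix (Fin r) (Fin r) ℂ) * A *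
      (((g⁻¹ : parabolic B W) : GL (Fin r) ℂ) : Matrix (Fin r) (Fin r) ℂ)) *ᵥ e p.snd) -
      (((g : GL (Fin r) ℂ) : Matrix (Fin r) (Fin r) ℂ) * A *
        (((g⁻¹ : parabolic B W) : GL (Fin r) ℂ) : Matrix (Fin r) (Fin r) ℂ)).trace / r * (e p.fst ⬝ᵥ B *ᵥ e p.snd) =
      ∑ q, N p q * (e q.fst ⬝ᵥ B *ᵥ (A *ᵥ e q.snd) - A.trace / r * (e q.fst ⬝ᵥ B *ᵥ e q.snd))
    rw [htr, hconj, bilin_basis_expand, sum_eq_sum_freePairs (s := s), Finset.mul_sum]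
    · refine Finset.sum_congr rfl fun q _ => ?_
      rw [hskew (e q.snd), ← hS]
      simp only [N, Matrix.of_apply]
      ring
    · intro k l hkl
      rw [hzero k l hkl, mul_zero]
  have hcomp : adjointAction g = (Ξ.symm : (FreePairs r s → ℂ) × ℂ →ₗ[ℂ] parabolicLie B W) ∘ₗ
      (LinearMap.prodMap (Matrix.toLin' N) LinearMap.id) ∘ₗ (Ξ.symm.symm : parabolicLie B W →ₗ[ℂ] (FreePairs r s → ℂ) × ℂ) := by
    ext1 A
    rw [LinearMap.comp_apply, LinearMap.comp_apply, LinearEquiv.symm_symm]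
    change _ = Ξ.symm ((LinearMap.prodMap (Matrix.toLin' N) LinearMap.id) (Ξ A))
    rw [← key, LinearEquiv.symm_apply_apply]
  rw [hcomp, LinearMap.det_conj, LinearMap.det_prodMap, LinearMap.det_id, mul_one,
    LinearMap.det_toLin', Matrix.det_of_isLowerTriangular]
  · refine Finset.prod_congr rfl fun p _ => ?_
    have h1 : p.fst < p.snd := p.2.1
    simp only [N, Matrix.of_apply]
    rw [htri p.snd p.fst h1, zero_mul, sub_zero]
  · intro p q hpq
    have hlt : p < q := hpq
    have h1 : p.fst < p.snd := p.2.1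
    have h2 : q.fst < q.snd := q.2.1
    simp only [N, Matrix.of_apply]
    have hlex : p.fst < q.fst ∨ p.fst = q.fst ∧ p.snd < q.snd := by
      have : p.1 < q.1 := hlt
      rwa [Prod.Lex.lt_iff] at this
    rcases hlex with h | ⟨h, h'⟩
    · rw [htri q.fst p.fst h, htri q.snd p.fst (h.trans h2)]
      ring
    · rw [htri q.snd p.snd h', htri q.snd p.fst (h ▸ h2)]
      ring

theorem det_restrictToSubspace (g : parabolic B W)
    (e : Module.Basis (Fin r) ℂ (Fin r → ℂ)) (he : IsAdaptedBasis B W e)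
    (hle : Module.finrank ℂ W ≤ r)
    (htri : ∀ i j : Fin r, j < i → basisMatrix e (g : GL (Fin r) ℂ) i j = 0) :
    LinearMap.det (restrictToSubspace g) =
      ∏ i : Fin (Module.finrank ℂ W), basisMatrix e (g : GL (Fin r) ℂ)
        ⟨i, i.2.trans_le hle⟩ ⟨i, i.2.trans_le hle⟩ := by
  set s := Module.finrank ℂ W with hs
  let lo : Fin s → Fin r := Fin.castLE hle
  let w : Fin s → W := fun i => ⟨e (lo i), he.1 _ i.2⟩
  have hw : LinearIndependent ℂ w := by
    refine LinearIndependent.of_comp W.subtype ?_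
    exact e.linearIndependent.comp lo (Fin.castLE_injective hle)
  let bw : Module.Basis (Fin s) ℂ W :=
    Module.Basis.mk hw (by rw [hw.span_eq_top_of_card_eq_finrank' (by simp [hs])])
  have hbw : ∀ i, (bw i : Fin r → ℂ) = e (lo i) := fun i => by simp [bw, w]
  have hrepr : ∀ (x : W) (i : Fin s), bw.repr x i = e.repr (x : Fin r → ℂ) (lo i) := by
    intro x i
    have : (bw.coord i) = (e.coord (lo i)) ∘ₗ W.subtype := bw.ext fun j => by
      simp only [Module.Basis.coord_apply, Module.Basis.repr_self, LinearMap.comp_apply,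
        Submodule.subtype_apply, hbw, Finsupp.single_apply]
      simp [(Fin.castLE_injective hle).eq_iff, lo]
    exact LinearMap.congr_fun this x
  rw [← LinearMap.det_toMatrix bw, Matrix.det_of_isUpperTriangular]
  · refine Finset.prod_congr rfl fun i _ => ?_
    rw [LinearMap.toMatrix_apply, hrepr, restrictToSubspace_apply, hbw]
    rfl
  · intro i j hij
    rw [LinearMap.toMatrix_apply, hrepr, restrictToSubspace_apply, hbw]
    exact htri (lo i) (lo j) hij

/-- The product of the first `s` and the last `s` eigenvalues of a similitude preserving `W`. -/
theorem prod_diag_pairing (hdet : B.det ≠ 0) {h : Matrix (Fin r) (Fin r) ℂ} {c : ℂ}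
    (hc : hᵀ * B * h = c • B) (e : Module.Basis (Fin r) ℂ (Fin r → ℂ))
    (he : IsAdaptedBasis B W e) (h2s : 2 * Module.finrank ℂ W ≤ r)
    (htri : ∀ i j : Fin r, j < i → basisMatrix e h i j = 0) :
    (∏ i : Fin (Module.finrank ℂ W), basisMatrix e h ⟨i, by omega⟩ ⟨i, by omega⟩) *
      (∏ i : Fin (Module.finrank ℂ W), basisMatrix e h
        ⟨r - Module.finrank ℂ W + i, by omega⟩ ⟨r - Module.finrank ℂ W + i, by omega⟩) =
      c ^ Module.finrank ℂ W := by
  set s := Module.finrank ℂ W with hs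
  set H := basisMatrix e h with hH
  let lo : Fin s → Fin r := fun i => ⟨i, by omega⟩
  let hi : Fin s → Fin r := fun i => ⟨r - s + i, by omega⟩
  let P : Matrix (Fin s) (Fin s) ℂ := Matrix.of fun i j => e (lo i) ⬝ᵥ B *ᵥ e (hi j)
  have hB0 : ∀ (k l : Fin r), (k : ℕ) < s → (l : ℕ) < r - s → e k ⬝ᵥ B *ᵥ e l = 0 :=
    fun k l hk hl => mem_orthCompl.1 (he.2 l hl) _ (he.1 k hk)
  have hP : (H.submatrix lo lo)ᵀ * P * H.submatrix hi hi = c • P := by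
    ext i j
    have h1 := bilin_similitude hc (e (lo i)) (e (hi j))
    rw [bilin_basis_expand] at h1
    have hsum : ∀ F : Fin r → ℂ, (∀ k : Fin r, ¬ (k : ℕ) < s → F k = 0) →
        ∑ k, F k = ∑ k : Fin s, F (lo k) := by
      intro F hF
      refine (Finset.sum_of_injOn lo (fun a _ b _ hab => ?_) (by simp) ?_ (fun _ _ => rfl)).symm
      · simpa [lo, Fin.ext_iff] using hab
      · intro k _ hk
        refine hF k fun hks => hk ⟨⟨k, hks⟩, by simp, rfl⟩
    have hsum' : ∀ F : Fin r → ℂ, (∀ k : Fin r, (k : ℕ) < r - s → F k = 0) →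
        ∑ k, F k = ∑ k : Fin s, F (hi k) := by
      intro F hF
      refine (Finset.sum_of_injOn hi (fun a _ b _ hab => ?_) (by simp) ?_ (fun _ _ => rfl)).symm
      · simpa [hi, Fin.ext_iff] using hab
      · intro k _ hk
        refine hF k ?_
        by_contra hks
        refine hk ⟨⟨k - (r - s), by omega⟩, by simp, ?_⟩
        ext; simp only [hi]; omega
    rw [hsum] at h1
    · rw [Matrix.smul_apply, smul_eq_mul]
      refine Eq.trans ?_ h1
      simp only [Matrix.mul_apply, Matrix.transpose_apply, Matrix.submatrix_apply, Finset.sum_mul]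
      rw [Finset.sum_comm]
      refine Finset.sum_congr rfl fun k _ => ?_
      rw [hsum']
      · refine Finset.sum_congr rfl fun l _ => ?_
        simp only [P, Matrix.of_apply]
        ring
      · intro l hl
        rw [hB0 (lo k) l k.2 hl, mul_zero]
    · intro k hk
      refine Finset.sum_eq_zero fun l _ => ?_
      have : basisMatrix e h k (lo i) = 0 := htri k (lo i) (by
        change (i : ℕ) < k
        omega)
      rw [this, zero_mul, zero_mul]
  have hPdet : P.det ≠ 0 := by
    intro h0
    obtain ⟨x, hx0, hx⟩ := Matrix.exists_vecMul_eq_zero_iff.2 h0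
    let v : Fin r → ℂ := ∑ i, x i • e (lo i)
    have hv : v = 0 := by
      refine (toBilin'_nondegenerate hdet).1 v fun w => ?_
      have : Matrix.toBilin' B v = 0 := e.ext fun j => by
        rw [Matrix.toBilin'_apply', LinearMap.zero_apply, sum_dotProduct]
        simp only [smul_dotProduct, smul_eq_mul]
        by_cases hj : (j : ℕ) < r - s
        · exact Finset.sum_eq_zero fun i _ => by rw [hB0 _ _ i.2 hj, mul_zero]
        · have hj' : j = hi ⟨j - (r - s), by omega⟩ := by ext; simp only [hi]; omega
          rw [hj']
          exact congrFun hx _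
      exact LinearMap.congr_fun this w
    refine hx0 (funext fun i => ?_)
    have hli := e.linearIndependent.comp lo fun a b hab => by simpa [lo, Fin.ext_iff] using hab
    exact Fintype.linearIndependent_iff.1 hli x hv i
  have h2 := congrArg Matrix.det hP
  rw [Matrix.det_mul, Matrix.det_mul, Matrix.det_transpose, Matrix.det_smul, Fintype.card_fin,
    Matrix.det_of_isUpperTriangular (M := H.submatrix lo lo),
    Matrix.det_of_isUpperTriangular (M := H.submatrix hi hi)] at h2
  · refine mul_right_cancel₀ hPdet (Eq.trans ?_ h2)
    simp only [Matrix.submatrix_apply]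
    ring
  · intro i j hij
    refine htri _ _ ?_
    change r - s + (j : ℕ) < r - s + i
    have : (j : ℕ) < i := hij
    omega
  · intro i j hij
    exact htri _ _ hij

theorem log_norm_det_adjointAction (hr : r ≠ 0) (hB : B.IsSymm) (hdet : B.det ≠ 0)
    (hW : IsIsotropic B W) (g : parabolic B W) :
    Real.log ‖LinearMap.det (adjointAction g)‖ =
      ((r : ℝ) - Module.finrank ℂ W - 1) * Real.log ‖LinearMap.det (restrictToSubspace g)‖ -
      (Module.finrank ℂ W : ℝ) * ((r : ℝ) - Module.finrank ℂ W - 1) / r *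
        Real.log ‖((g : GL (Fin r) ℂ) : Matrix (Fin r) (Fin r) ℂ).det‖ := by
  have h2s := hW.two_mul_finrank_le hdet
  obtain ⟨e, he, htri⟩ := exists_adapted_triangular_basis hdet hW g⁻¹
  replace htri : ∀ i j : Fin r, j < i → basisMatrix e
    (((g⁻¹ : parabolic B W) : GL (Fin r) ℂ) : Matrix (Fin r) (Fin r) ℂ) i j = 0 := htri
  obtain ⟨c, hc0, hc⟩ := g.2.1
  obtain ⟨c', hc'0, hc'⟩ := (g⁻¹).2.1
  set s := Module.finrank ℂ W with hs
  have hdetg : ((g : GL (Fin r) ℂ) : Matrix (Fin r) (Fin r) ℂ).det *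
      (((g⁻¹ : parabolic B W) : GL (Fin r) ℂ) : Matrix (Fin r) (Fin r) ℂ).det = 1 := by
    rw [← Matrix.det_mul, parabolic_mul_inv, Matrix.det_one]
  have hdetW : LinearMap.det (restrictToSubspace g) *
      LinearMap.det (restrictToSubspace g⁻¹) = 1 := by
    rw [← LinearMap.det_comp, ← LinearMap.det_id (A := ℂ) (M := W)]
    congr 1
    ext1 w
    exact Subtype.ext (parabolic_mulVec_inv g w)
  have hcc : c * c' = 1 := by
    have h0 : ∃ v w, v ⬝ᵥ B *ᵥ w ≠ 0 := by
      by_contra! hcon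
      refine hdet ?_
      have : Nonempty (Fin r) := ⟨⟨0, Nat.pos_of_ne_zero hr⟩⟩
      rw [forall_dotProduct_mulVec_iff (M := B) (N := 0) (by simpa using hcon), Matrix.det_zero]
    obtain ⟨v, w, hvw⟩ := h0
    have h1 := bilin_similitude hc ((((g⁻¹ : parabolic B W) : GL (Fin r) ℂ) :
      Matrix (Fin r) (Fin r) ℂ) *ᵥ v) ((((g⁻¹ : parabolic B W) : GL (Fin r) ℂ) :
      Matrix (Fin r) (Fin r) ℂ) *ᵥ w)
    rw [parabolic_mulVec_inv, parabolic_mulVec_inv, bilin_similitude hc', ← mul_assoc] at h1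
    exact (mul_right_cancel₀ hvw ((one_mul _).trans h1)).symm
  have hAd := det_adjointAction hr hB hdet hW g hc e he htri
  have hWdet := det_restrictToSubspace g⁻¹ e he (by omega) htri
  have hpair := prod_diag_pairing hdet hc' e he h2s htri
  have hdeth := det_basisMatrix e
    (((g⁻¹ : parabolic B W) : GL (Fin r) ℂ) : Matrix (Fin r) (Fin r) ℂ)
  rw [Matrix.det_of_isUpperTriangular htri, prod_blocks h2s] at hdeth
  have hdet2 := congrArg Matrix.det hc'
  rw [Matrix.det_mul, Matrix.det_mul, Matrix.det_transpose, Matrix.det_smul,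
    Fintype.card_fin] at hdet2
  rw [Finset.prod_mul_distrib, Finset.prod_const, Finset.card_univ] at hAd
  have hfree := prod_freePairs_blocks h2s fun i => basisMatrix e
    (((g⁻¹ : parabolic B W) : GL (Fin r) ℂ) : Matrix (Fin r) (Fin r) ℂ) i i
  replace hAd := hAd.trans (congrArg _ hfree)
  set H := basisMatrix e
    (((g⁻¹ : parabolic B W) : GL (Fin r) ℂ) : Matrix (Fin r) (Fin r) ℂ) with hH
  set a := ∏ i : Fin s, H ⟨i, by omega⟩ ⟨i, by omega⟩ with ha
  set d := ∏ i : Fin s, H ⟨r - s + i, by omega⟩ ⟨r - s + i, by omega⟩ with hd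
  set m := ∏ i ∈ Finset.univ.filter (fun i : Fin r => s ≤ (i : ℕ) ∧ (i : ℕ) < r - s), H i i with hm
  set δ := (((g⁻¹ : parabolic B W) : GL (Fin r) ℂ) : Matrix (Fin r) (Fin r) ℂ).det
  set δ' := ((g : GL (Fin r) ℂ) : Matrix (Fin r) (Fin r) ℂ).det
  replace hWdet : LinearMap.det (restrictToSubspace g⁻¹) = a := hWdet
  replace hpair : a * d = c' ^ s := hpair
  replace hAd : LinearMap.det (adjointAction g) = c ^ Fintype.card (FreePairs r s) *
    (a ^ s * m ^ (r - s - 1) * d ^ (r - 1)) := hAd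
  replace hdeth : a * m * d = δ := hdeth
  have hδ : δ ≠ 0 := right_ne_zero_of_mul_eq_one hdetg
  have ha0 : a ≠ 0 := fun h => hδ (by rw [← hdeth, h]; ring)
  have hm0 : m ≠ 0 := fun h => hδ (by rw [← hdeth, h]; ring)
  have hd0 : d ≠ 0 := fun h => hδ (by rw [← hdeth, h]; ring)
  have hlog : ∀ x y : ℂ, x ≠ 0 → y ≠ 0 →
      Real.log ‖x * y‖ = Real.log ‖x‖ + Real.log ‖y‖ := fun x y hx hy => by
    rw [norm_mul, Real.log_mul (norm_ne_zero_iff.2 hx) (norm_ne_zero_iff.2 hy)]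
  have hlogp : ∀ (x : ℂ) (n : ℕ), Real.log ‖x ^ n‖ = n * Real.log ‖x‖ := fun x n => by
    rw [norm_pow, Real.log_pow]
  have e1 := congrArg (fun z : ℂ => Real.log ‖z‖) hcc
  have e2 := congrArg (fun z : ℂ => Real.log ‖z‖) hdetg
  have e3 := congrArg (fun z : ℂ => Real.log ‖z‖) hdetW
  have e4 := congrArg (fun z : ℂ => Real.log ‖z‖) hpair
  have e5 := congrArg (fun z : ℂ => Real.log ‖z‖) hdeth
  have e6 := congrArg (fun z : ℂ => Real.log ‖z‖) (mul_right_cancel₀ hdet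
    (show δ * δ * B.det = c' ^ r * B.det by rw [← hdet2]; ring))
  have e7 := congrArg (fun z : ℂ => Real.log ‖z‖) hAd
  rw [hlog _ _ hc0 hc'0, norm_one, Real.log_one] at e1
  rw [hlog _ _ (left_ne_zero_of_mul_eq_one hdetg) hδ, norm_one, Real.log_one] at e2
  rw [hlog _ _ (left_ne_zero_of_mul_eq_one hdetW) (right_ne_zero_of_mul_eq_one hdetW), norm_one,
    Real.log_one, hWdet] at e3
  rw [hlog _ _ ha0 hd0, hlogp] at e4
  rw [hlog _ _ (mul_ne_zero ha0 hm0) hd0, hlog _ _ ha0 hm0] at e5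
  rw [hlog _ _ hδ hδ, hlogp] at e6
  rw [hlog _ _ (pow_ne_zero _ hc0) (mul_ne_zero (mul_ne_zero (pow_ne_zero _ ha0)
    (pow_ne_zero _ hm0)) (pow_ne_zero _ hd0)), hlog _ _ (mul_ne_zero (pow_ne_zero _ ha0)
    (pow_ne_zero _ hm0)) (pow_ne_zero _ hd0), hlog _ _ (pow_ne_zero _ ha0)
    (pow_ne_zero _ hm0), hlogp, hlogp, hlogp, hlogp] at e7
  have hcard : (2 : ℝ) * Fintype.card (FreePairs r s) =
      s * s + (r - 2 * s) * (r - s - 1) + s * (r - 1) := by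
    have := congrArg (Nat.cast : ℕ → ℝ) (two_mul_card_freePairs h2s)
    push_cast [Nat.cast_sub h2s, Nat.cast_sub (show 1 ≤ r by omega),
      Nat.cast_sub (show 1 ≤ r - s by omega), Nat.cast_sub (show s ≤ r by omega)] at this
    exact this
  rw [Nat.cast_sub (show 1 ≤ r - s by omega), Nat.cast_sub (show s ≤ r by omega),
    Nat.cast_sub (show 1 ≤ r by omega), Nat.cast_one] at e7
  have hr' : (r : ℝ) ≠ 0 := by exact_mod_cast hr
  have hC' : Real.log ‖c'‖ = - Real.log ‖c‖ := by linarith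
  rw [hC'] at e4 e6
  have hδδ : Real.log ‖δ'‖ = (r : ℝ) / 2 * Real.log ‖c‖ := by linarith
  have hM : Real.log ‖m‖ = (s - (r : ℝ) / 2) * Real.log ‖c‖ := by
    linear_combination e5 - e4 + (1 / 2 : ℝ) * e6
  have hD : Real.log ‖d‖ = - s * Real.log ‖c‖ - Real.log ‖a‖ := by linear_combination e4
  have hWl : Real.log ‖LinearMap.det (restrictToSubspace g)‖ = - Real.log ‖a‖ := by linarith
  rw [e7, hδδ, hM, hD, hWl]
  field_simp
  linear_combination Real.log ‖c‖ * hcard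

end AdjointDet

end OrthBundle

namespace OrthBundle

/-! ### The Laplacian and holomorphic maps -/

section Laplacian

open Laplacian

theorem laplacian_apply_complex (f : ℂ → ℝ) (z : ℂ) :
    Laplacian.laplacian f z =
      fderiv ℝ (fderiv ℝ f) z 1 1 + fderiv ℝ (fderiv ℝ f) z Complex.I Complex.I := by
  rw [InnerProductSpace.laplacian_eq_iteratedFDeriv_complexPlane]
  simp [iteratedFDeriv_two_apply]

theorem fderiv_fderiv_apply {f : ℂ → ℝ} {z : ℂ} (hf : ContDiffAt ℝ 2 f z) (v w : ℂ) :
    fderiv ℝ (fun x => fderiv ℝ f x w) z v = fderiv ℝ (fderiv ℝ f) z v w := by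
  have h : DifferentiableAt ℝ (fderiv ℝ f) z :=
    (hf.fderiv_right (m := 1) (by norm_num)).differentiableAt (by norm_num)
  rw [fderiv_clm_apply h (differentiableAt_const w)]
  simp

theorem laplacian_comp_holomorphic {f : ℂ → ℝ} {T : ℂ → ℂ} {z : ℂ} (hT : ContDiffAt ℂ ω T z)
    (hf : ContDiffAt ℝ 2 f (T z)) :
    Laplacian.laplacian (f ∘ T) z = ‖deriv T z‖ ^ 2 * Laplacian.laplacian f (T z) := by
  have hTR : ContDiffAt ℝ 2 T z := (hT.restrict_scalars ℝ).of_le le_top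
  have hfT : ContDiffAt ℝ 2 (f ∘ T) z := hf.comp z hTR
  have hT' : ContDiffAt ℂ ω (deriv T) z := by
    have h1 : ContDiffAt ℂ ω (fun x => fderiv ℂ T x 1) z :=
      (hT.fderiv_right (m := ω) le_rfl).clm_apply contDiffAt_const
    exact h1
  have hTd : ∀ᶠ x in 𝓝 z, DifferentiableAt ℂ T x :=
    (hT.eventually (by simp)).mono fun x hx => hx.differentiableAt (by simp)
  have hfd : ∀ᶠ x in 𝓝 z, DifferentiableAt ℝ f (T x) :=
    hT.continuousAt.eventually
      ((hf.eventually (by norm_num)).mono fun x hx => hx.differentiableAt (by norm_num))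
  have hTderiv : ∀ x v, DifferentiableAt ℂ T x → fderiv ℝ T x v = deriv T x * v := by
    intro x v hx
    rw [hx.fderiv_restrictScalars ℝ]
    change fderiv ℂ T x v = _
    rw [← mul_one v, ← smul_eq_mul v 1, map_smul, smul_eq_mul, fderiv_apply_one_eq_deriv]
    simp [mul_comm]
  have hfirst : ∀ v, (fun x => fderiv ℝ (f ∘ T) x v) =ᶠ[𝓝 z]
      fun x => fderiv ℝ f (T x) (deriv T x * v) := by
    intro v
    filter_upwards [hTd, hfd] with x hx hx'
    rw [fderiv_comp x hx' (hx.restrictScalars ℝ), ContinuousLinearMap.comp_apply, hTderiv x v hx]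
  have hsecond : ∀ v, fderiv ℝ (fderiv ℝ (f ∘ T)) z v v =
      fderiv ℝ (fderiv ℝ f) (T z) (deriv T z * v) (deriv T z * v) +
        fderiv ℝ f (T z) (deriv (deriv T) z * v * v) := by
    intro v
    rw [← fderiv_fderiv_apply hfT, (hfirst v).fderiv_eq]
    have h1 : DifferentiableAt ℝ (fderiv ℝ f) (T z) :=
      (hf.fderiv_right (m := 1) (by norm_num)).differentiableAt (by norm_num)
    have h2 : DifferentiableAt ℝ T z := hTR.differentiableAt (by norm_num)
    have h3 : DifferentiableAt ℂ (deriv T) z := hT'.differentiableAt (by simp)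
    have h4 : HasFDerivAt (fun x => fderiv ℝ f (T x))
        ((fderiv ℝ (fderiv ℝ f) (T z)).comp (fderiv ℝ T z)) z :=
      h1.hasFDerivAt.comp z h2.hasFDerivAt
    have h5 : HasFDerivAt (fun x => deriv T x * v)
        ((ContinuousLinearMap.mul ℝ ℂ).flip v ∘L fderiv ℝ (deriv T) z) z :=
      ((ContinuousLinearMap.mul ℝ ℂ).flip v).hasFDerivAt.comp z
        (h3.restrictScalars ℝ).hasFDerivAt
    have h6 := h4.clm_apply h5
    rw [h6.fderiv]
    have h7 : fderiv ℝ (deriv T) z v = deriv (deriv T) z * v := by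
      rw [h3.fderiv_restrictScalars ℝ]
      change fderiv ℂ (deriv T) z v = _
      rw [← mul_one v, ← smul_eq_mul v 1, map_smul, smul_eq_mul, fderiv_apply_one_eq_deriv]
      simp [mul_comm]
    simp only [_root_.add_apply, ContinuousLinearMap.comp_apply,
      ContinuousLinearMap.flip_apply, ContinuousLinearMap.mul_apply', h7,
      hTderiv z v (hT.differentiableAt (by simp))]
    ring
  rw [laplacian_apply_complex, laplacian_apply_complex, hsecond, hsecond]
  set D := fderiv ℝ (fderiv ℝ f) (T z)
  set a := deriv T z
  have h8 : deriv (deriv T) z * Complex.I * Complex.I = - (deriv (deriv T) z * 1 * 1) := by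
    rw [mul_assoc, Complex.I_mul_I]; ring
  have ha : a * 1 = a.re • (1 : ℂ) + a.im • Complex.I := by
    apply Complex.ext <;> simp
  have hai : a * Complex.I = (-a.im) • (1 : ℂ) + a.re • Complex.I := by
    apply Complex.ext <;> simp
  rw [h8, map_neg, ha, hai]
  simp only [map_add, map_smul, _root_.add_apply, _root_.smul_apply,
    smul_eq_mul]
  rw [← Complex.normSq_eq_norm_sq, Complex.normSq_apply]
  ring

theorem laplacian_log_norm_eq_zero {h : ℂ → ℂ} {z : ℂ} (hh : ContDiffAt ℂ ω h z) (h0 : h z ≠ 0) :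
    Laplacian.laplacian (fun w => Real.log ‖h w‖) z = 0 :=
  (hh.analyticAt.harmonicAt_log_norm h0).2.self_of_nhds

open MeasureTheory in
theorem integral_laplacian_eq_zero {f : ℂ → ℝ} (hf : ContDiff ℝ 2 f) (hc : HasCompactSupport f) :
    ∫ z, Laplacian.laplacian f z = 0 := by
  have key : ∀ v : ℂ, Integrable (fun z => fderiv ℝ (fderiv ℝ f) z v v) ∧
      ∫ z, fderiv ℝ (fderiv ℝ f) z v v = 0 := by
    intro v
    let g : ℂ → ℝ := fun z => fderiv ℝ f z v
    have hg : ContDiff ℝ 1 g := (hf.fderiv_right (m := 1) (by norm_num)).clm_apply contDiff_const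
    have hgc : HasCompactSupport g := (hc.fderiv (𝕜 := ℝ)).comp_left (g := fun l : ℂ →L[ℝ] ℝ => l v) rfl
    have hgv : ∀ z, fderiv ℝ g z v = fderiv ℝ (fderiv ℝ f) z v v := fun z =>
      fderiv_fderiv_apply hf.contDiffAt v v
    have hcont : Continuous fun z => fderiv ℝ g z v :=
      (hg.continuous_fderiv (by norm_num)).clm_apply continuous_const
    have hcs : HasCompactSupport fun z => fderiv ℝ g z v :=
      (hgc.fderiv (𝕜 := ℝ)).comp_left (g := fun l : ℂ →L[ℝ] ℝ => l v) rfl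
    have hint := hcont.integrable_of_hasCompactSupport hcs (μ := volume)
    have h1 := integral_bilinear_fderiv_right_eq_neg_left_of_integrable (μ := volume)
      (f := fun _ : ℂ => (1 : ℝ)) (g := g) (v := v) (B := ContinuousLinearMap.mul ℝ ℝ)
      (by simp) (by simpa using hint)
      (by simpa using hg.continuous.integrable_of_hasCompactSupport hgc)
      (fun x _ => differentiableAt_const _) (fun x _ => (hg.differentiable (by norm_num)) x)
    simp only [ContinuousLinearMap.mul_apply', one_mul, fderiv_fun_const, Pi.zero_apply,
      _root_.zero_apply, zero_mul, integral_zero, neg_zero] at h1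
    simp only [hgv] at h1 hint
    exact ⟨hint, h1⟩
  simp only [laplacian_apply_complex]
  rw [integral_add (key 1).1 (key _).1, (key 1).2, (key _).2, add_zero]

end Laplacian

end OrthBundle

namespace OrthBundle

/-! ### Holomorphic and smooth functions in charts -/

theorem two_le_smooth : (2 : WithTop ℕ∞) ≤ ∞ := WithTop.coe_le_coe.2 le_top

section Charts

variable {X : Type*} [TopologicalSpace X] [ChartedSpace ℂ X]

theorem contDiffOn_transition [IsManifold 𝓘(ℂ) ω X] (x y : X) :
    ContDiffOn ℂ ω (chartAt ℂ y ∘ (chartAt ℂ x).symm)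
      ((chartAt ℂ x).symm.trans (chartAt ℂ y)).source := by
  rw [← contMDiffOn_iff_contDiffOn]
  refine (contMDiffOn_chart (I := 𝓘(ℂ)) (n := ω) (x := y)).comp
    ((contMDiffOn_chart_symm (I := 𝓘(ℂ)) (n := ω) (x := x)).mono ?_) ?_
  · intro z hz
    rw [OpenPartialHomeomorph.trans_source] at hz
    exact hz.1
  · intro z hz
    rw [OpenPartialHomeomorph.trans_source] at hz
    exact hz.2

theorem isManifold_real [IsManifold 𝓘(ℂ) ω X] : IsManifold 𝓘(ℝ, ℂ) ∞ X := by
  refine isManifold_of_contDiffOn _ _ _ fun e e' he he' => ?_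
  have h1 : ContDiffOn ℂ ω (e' ∘ e.symm) (e.symm.trans e').source := by
    rw [← contMDiffOn_iff_contDiffOn]
    have he1 := IsManifold.subset_maximalAtlas (I := 𝓘(ℂ)) (n := ω) he
    have he2 := IsManifold.subset_maximalAtlas (I := 𝓘(ℂ)) (n := ω) he'
    refine (contMDiffOn_of_mem_maximalAtlas he2).comp
      ((contMDiffOn_symm_of_mem_maximalAtlas he1).mono ?_) ?_
    · intro z hz
      rw [OpenPartialHomeomorph.trans_source] at hz
      exact hz.1
    · intro z hz
      rw [OpenPartialHomeomorph.trans_source] at hz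
      exact hz.2
  refine ((h1.restrict_scalars ℝ).of_le le_top).mono ?_
  intro z hz
  exact hz.1

theorem contMDiffAt_real_of_holomorphic {f : X → ℂ} {x : X}
    (hf : ContMDiffAt 𝓘(ℂ) 𝓘(ℂ) ω f x) : ContMDiffAt 𝓘(ℝ, ℂ) 𝓘(ℝ, ℂ) ∞ f x := by
  rw [contMDiffAt_iff] at hf ⊢
  exact ⟨hf.1, ((hf.2.restrict_scalars ℝ).of_le le_top)⟩

theorem contDiffAt_comp_chart_symm [IsManifold 𝓘(ℂ) ω X] {F : X → ℝ} (x : X) {z : ℂ}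
    (hz : z ∈ (chartAt ℂ x).target)
    (hF : ContMDiffAt 𝓘(ℝ, ℂ) 𝓘(ℝ) ∞ F ((chartAt ℂ x).symm z)) :
    ContDiffAt ℝ ∞ (F ∘ (chartAt ℂ x).symm) z := by
  have := isManifold_real (X := X)
  rw [← contMDiffAt_iff_contDiffAt]
  exact hF.comp z ((contMDiffOn_chart_symm (I := 𝓘(ℝ, ℂ)) (n := ∞) (x := x)).contMDiffAt
    ((chartAt ℂ x).open_target.mem_nhds hz))

theorem contDiffAt_comp_chart_symm_complex [IsManifold 𝓘(ℂ) ω X] {F : X → ℂ} (x : X) {z : ℂ}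
    (hz : z ∈ (chartAt ℂ x).target)
    (hF : ContMDiffAt 𝓘(ℂ) 𝓘(ℂ) ω F ((chartAt ℂ x).symm z)) :
    ContDiffAt ℂ ω (F ∘ (chartAt ℂ x).symm) z := by
  rw [← contMDiffAt_iff_contDiffAt]
  exact hF.comp z ((contMDiffOn_chart_symm (I := 𝓘(ℂ)) (n := ω) (x := x)).contMDiffAt
    ((chartAt ℂ x).open_target.mem_nhds hz))

end Charts

theorem continuousAt_laplacian {f : ℂ → ℝ} {z : ℂ} (hf : ContDiffAt ℝ ∞ f z) :
    ContinuousAt (Laplacian.laplacian f) z := by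
  have h : ContDiffAt ℝ 0 (fderiv ℝ (fderiv ℝ f)) z :=
    (hf.fderiv_right (m := 1) (one_add_one_eq_two.trans_le two_le_smooth)).fderiv_right (m := 0)
      (by norm_num)
  have h2 : Laplacian.laplacian f = fun w => fderiv ℝ (fderiv ℝ f) w 1 1 +
      fderiv ℝ (fderiv ℝ f) w Complex.I Complex.I := by
    funext w
    rw [laplacian_apply_complex]
  rw [h2]
  exact ((h.continuousAt.clm_apply continuousAt_const).clm_apply continuousAt_const).add
    ((h.continuousAt.clm_apply continuousAt_const).clm_apply continuousAt_const)

/-! ### Properties of the surface integral -/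

section SurfaceIntegral

open MeasureTheory

variable {X : Type*} [TopologicalSpace X] [T2Space X] [CompactSpace X] [ChartedSpace ℂ X]

/-- The 2-form with coefficients `κ` is continuous in the preferred charts. -/
def IsContForm (κ : OpenPartialHomeomorph X ℂ → ℂ → ℝ) : Prop :=
  ∀ x : X, ContinuousOn (κ (chartAt ℂ x)) (chartAt ℂ x).target

theorem integrableOn_cutoff {ρ : X → ℝ} (hρ : Continuous ρ) (x : X)
    (hsub : tsupport ρ ⊆ (chartAt ℂ x).source) {κ : ℂ → ℝ}
    (hκ : ContinuousOn κ (chartAt ℂ x).target) :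
    IntegrableOn (fun z => ρ ((chartAt ℂ x).symm z) * κ z) (chartAt ℂ x).target := by
  set c := chartAt ℂ x
  have hK : IsCompact (c '' tsupport ρ) :=
    (isClosed_tsupport ρ).isCompact.image_of_continuousOn (c.continuousOn.mono hsub)
  have hKt : c '' tsupport ρ ⊆ c.target := by
    rintro _ ⟨p, hp, rfl⟩
    exact c.map_source (hsub hp)
  have hcont : ContinuousOn (fun z => ρ (c.symm z) * κ z) (c '' tsupport ρ) :=
    (hρ.comp_continuousOn (c.continuousOn_symm.mono hKt)).mul (hκ.mono hKt)
  refine (hcont.integrableOn_compact hK).of_forall_sdiff_eq_zero c.open_target.measurableSet ?_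
  rintro z ⟨hz, hz'⟩
  have : ρ (c.symm z) = 0 := image_eq_zero_of_notMem_tsupport fun h =>
    hz' ⟨_, h, c.right_inv hz⟩
  rw [this, zero_mul]

theorem finite_chartPartition : {x : X | (Function.support (chartPartition X x)).Nonempty}.Finite :=
  (chartPartition X).locallyFinite.finite_nonempty_of_compact

theorem tsupport_chartPartition (x : X) :
    tsupport (chartPartition X x) ⊆ (chartAt ℂ x).source :=
  (exists_chartPartition X).choose_spec x

theorem surfaceIntegral_eq_sum (κ : OpenPartialHomeomorph X ℂ → ℂ → ℝ) :
    surfaceIntegral X κ = ∑ x ∈ finite_chartPartition.toFinset,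
      ∫ z in (chartAt ℂ x).target,
        chartPartition X x ((chartAt ℂ x).symm z) * κ (chartAt ℂ x) z := by
  refine finsum_eq_sum_of_support_subset _ fun x hx => ?_
  simp only [Finite.coe_toFinset, mem_ofPred_eq]
  by_contra h
  refine hx ?_
  have h0 : ∀ p, chartPartition X x p = 0 := fun p => by
    by_contra hp
    exact h ⟨p, hp⟩
  simp [h0]

theorem surfaceIntegral_congr {κ κ' : OpenPartialHomeomorph X ℂ → ℂ → ℝ}
    (h : ∀ x : X, ∀ z ∈ (chartAt ℂ x).target, κ (chartAt ℂ x) z = κ' (chartAt ℂ x) z) :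
    surfaceIntegral X κ = surfaceIntegral X κ' := by
  rw [surfaceIntegral_eq_sum, surfaceIntegral_eq_sum]
  refine Finset.sum_congr rfl fun x _ => ?_
  refine setIntegral_congr_fun (chartAt ℂ x).open_target.measurableSet fun z hz => ?_
  simp only [h x z hz]

theorem surfaceIntegral_add {κ κ' : OpenPartialHomeomorph X ℂ → ℂ → ℝ} (h : IsContForm κ)
    (h' : IsContForm κ') :
    surfaceIntegral X (fun c z => κ c z + κ' c z) = surfaceIntegral X κ + surfaceIntegral X κ' := by
  simp only [surfaceIntegral_eq_sum]
  rw [← Finset.sum_add_distrib]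
  refine Finset.sum_congr rfl fun x _ => ?_
  simp only [mul_add]
  exact integral_add (integrableOn_cutoff (chartPartition X x).continuous x
    (tsupport_chartPartition x) (h x)) (integrableOn_cutoff (chartPartition X x).continuous x
    (tsupport_chartPartition x) (h' x))

theorem surfaceIntegral_const_mul (a : ℝ) (κ : OpenPartialHomeomorph X ℂ → ℂ → ℝ) :
    surfaceIntegral X (fun c z => a * κ c z) = a * surfaceIntegral X κ := by
  simp only [surfaceIntegral_eq_sum]
  rw [Finset.mul_sum]
  refine Finset.sum_congr rfl fun x _ => ?_
  rw [← integral_const_mul]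
  congr 1
  funext z
  ring

theorem surfaceIntegral_sum {ι : Type*} (s : Finset ι)
    (κ : ι → OpenPartialHomeomorph X ℂ → ℂ → ℝ) (h : ∀ i, IsContForm (κ i)) :
    surfaceIntegral X (fun c z => ∑ i ∈ s, κ i c z) = ∑ i ∈ s, surfaceIntegral X (κ i) := by
  simp only [surfaceIntegral_eq_sum]
  rw [Finset.sum_comm]
  refine Finset.sum_congr rfl fun x _ => ?_
  simp only [Finset.mul_sum]
  exact integral_finsetSum _ fun i _ => integrableOn_cutoff (chartPartition X x).continuous x
    (tsupport_chartPartition x) (h i x)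

variable [IsManifold 𝓘(ℂ) ω X]

theorem isContForm_laplacian {F : X → ℝ} (hF : ContMDiff 𝓘(ℝ, ℂ) 𝓘(ℝ) ∞ F) :
    IsContForm (fun c z => Laplacian.laplacian (F ∘ c.symm) z) := by
  intro x z hz
  exact (continuousAt_laplacian (contDiffAt_comp_chart_symm x hz (hF _))).continuousWithinAt

theorem laplacian_chart_eq_zero {F : X → ℝ} (x : X) {z : ℂ} (hz : z ∈ (chartAt ℂ x).target)
    (h : (chartAt ℂ x).symm z ∉ tsupport F) :
    Laplacian.laplacian (F ∘ (chartAt ℂ x).symm) z = 0 := by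
  have h1 : ∀ᶠ w in 𝓝 z, (F ∘ (chartAt ℂ x).symm) w = (fun _ => (0 : ℝ)) w :=
    ((chartAt ℂ x).continuousAt_symm hz).eventually
      (Filter.mem_of_superset ((isClosed_tsupport F).isOpen_compl.mem_nhds h)
        fun p hp => image_eq_zero_of_notMem_tsupport hp)
  rw [(InnerProductSpace.laplacian_congr_nhds h1).self_of_nhds]
  simp

theorem integral_laplacian_chart_eq_zero {F : X → ℝ} (hF : ContMDiff 𝓘(ℝ, ℂ) 𝓘(ℝ) ∞ F) (y : X)
    (hy : tsupport F ⊆ (chartAt ℂ y).source) :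
    ∫ z in (chartAt ℂ y).target, Laplacian.laplacian (F ∘ (chartAt ℂ y).symm) z = 0 := by
  classical
  set c := chartAt ℂ y with hc
  let f : ℂ → ℝ := c.target.indicator (F ∘ c.symm)
  have hK : IsCompact (c '' tsupport F) :=
    (isClosed_tsupport F).isCompact.image_of_continuousOn (c.continuousOn.mono hy)
  have hfc : ∀ z ∈ c.target, f =ᶠ[𝓝 z] F ∘ c.symm := fun z hz => by
    filter_upwards [c.open_target.mem_nhds hz] with w hw
    exact indicator_of_mem hw _
  have hf0 : ∀ z, z ∉ c '' tsupport F → f z = 0 := by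
    intro z hz
    by_cases hzt : z ∈ c.target
    · rw [show f z = F (c.symm z) from indicator_of_mem hzt _]
      exact image_eq_zero_of_notMem_tsupport fun h => hz ⟨_, h, c.right_inv hzt⟩
    · exact indicator_of_notMem hzt _
  have hfs : HasCompactSupport f := HasCompactSupport.intro hK hf0
  have hf : ContDiff ℝ 2 f := by
    rw [contDiff_iff_contDiffAt]
    intro z
    by_cases hz : z ∈ c '' tsupport F
    · have hzt : z ∈ c.target := by
        obtain ⟨p, hp, rfl⟩ := hz
        exact c.map_source (hy hp)
      exact ((contDiffAt_comp_chart_symm y hzt (hF _)).of_le two_le_smooth).congr_of_eventuallyEq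
        (hfc z hzt)
    · have : f =ᶠ[𝓝 z] fun _ => 0 := by
        filter_upwards [hK.isClosed.isOpen_compl.mem_nhds hz] with w hw
        exact hf0 w hw
      exact contDiffAt_const.congr_of_eventuallyEq this
  refine Eq.trans ?_ ((setIntegral_eq_integral_of_forall_compl_eq_zero (s := c.target) ?_).trans
    (integral_laplacian_eq_zero hf hfs))
  · refine setIntegral_congr_fun c.open_target.measurableSet fun z hz => ?_
    exact ((InnerProductSpace.laplacian_congr_nhds (hfc z hz)).self_of_nhds).symm
  · intro z hz
    have : f =ᶠ[𝓝 z] fun _ => 0 := by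
      have hz' : z ∉ c '' tsupport F := by
        rintro ⟨p, hp, rfl⟩
        exact hz (c.map_source (hy hp))
      filter_upwards [hK.isClosed.isOpen_compl.mem_nhds hz'] with w hw
      exact hf0 w hw
    rw [(InnerProductSpace.laplacian_congr_nhds this).self_of_nhds]
    simp

/-- The 2-form `ρ Δ F dx ∧ dy` has the same integral in any two charts containing the supports of
`ρ` and `F` respectively. -/
theorem integral_cutoff_laplacian_change {ρ F : X → ℝ} (hF : ContMDiff 𝓘(ℝ, ℂ) 𝓘(ℝ) ∞ F) (x y : X)
    (hx : tsupport ρ ⊆ (chartAt ℂ x).source) (hy : tsupport F ⊆ (chartAt ℂ y).source) :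
    ∫ z in (chartAt ℂ x).target,
        ρ ((chartAt ℂ x).symm z) * Laplacian.laplacian (F ∘ (chartAt ℂ x).symm) z =
      ∫ z in (chartAt ℂ y).target,
        ρ ((chartAt ℂ y).symm z) * Laplacian.laplacian (F ∘ (chartAt ℂ y).symm) z := by
  have hTc := contDiffOn_transition x y
  set c := chartAt ℂ x with hc
  set c' := chartAt ℂ y with hc'
  let T := c.symm.trans c'
  have hTs : T.source = c.target ∩ c.symm ⁻¹' c'.source := OpenPartialHomeomorph.trans_source _ _
  have hTt : T.target = c'.target ∩ c'.symm ⁻¹' c.source := by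
    simp [T]
  have hT : ∀ z ∈ T.source, ContDiffAt ℂ ω T z := fun z hz =>
    hTc.contDiffAt (T.open_source.mem_nhds hz)
  have hsymm : ∀ z ∈ T.source, c'.symm (T z) = c.symm z := fun z hz => by
    rw [hTs] at hz
    exact c'.left_inv hz.2
  have h1 : ∫ z in c.target, ρ (c.symm z) * Laplacian.laplacian (F ∘ c.symm) z =
      ∫ z in T.source, ρ (c.symm z) * Laplacian.laplacian (F ∘ c.symm) z := by
    refine (setIntegral_eq_of_subset_of_forall_sdiff_eq_zero c.open_target.measurableSet
      (by rw [hTs]; exact inter_subset_left) ?_)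
    rintro z ⟨hz, hz'⟩
    rw [laplacian_chart_eq_zero x hz (fun h => hz' (by rw [hTs]; exact ⟨hz, hy h⟩)), mul_zero]
  have h2 : ∫ z in c'.target, ρ (c'.symm z) * Laplacian.laplacian (F ∘ c'.symm) z =
      ∫ z in T.target, ρ (c'.symm z) * Laplacian.laplacian (F ∘ c'.symm) z := by
    refine (setIntegral_eq_of_subset_of_forall_sdiff_eq_zero c'.open_target.measurableSet
      (by rw [hTt]; exact inter_subset_left) ?_)
    rintro z ⟨hz, hz'⟩
    rw [image_eq_zero_of_notMem_tsupport (f := ρ)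
      (fun h => hz' (by rw [hTt]; exact ⟨hz, hx h⟩)), zero_mul]
  rw [h1, h2, ← T.image_source_eq_target, integral_image_eq_integral_abs_det_fderiv_smul volume
    T.open_source.measurableSet (f' := fun z => (fderiv ℂ T z).restrictScalars ℝ)
    (fun z hz => (((hT z hz).differentiableAt (by simp)).hasFDerivAt.restrictScalars
      ℝ).hasFDerivWithinAt) T.injOn]
  refine setIntegral_congr_fun T.open_source.measurableSet fun z hz => ?_
  have hdet : |((fderiv ℂ T z).restrictScalars ℝ).det| = ‖deriv T z‖ ^ 2 := by
    have : ((fderiv ℂ T z).restrictScalars ℝ).det = ‖deriv T z‖ ^ 2 := by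
      rw [ContinuousLinearMap.det, ContinuousLinearMap.coe_restrictScalars,
        LinearMap.det_restrictScalars, Algebra.norm_complex_eq]
      rw [← Complex.normSq_eq_norm_sq]
      refine congrArg Complex.normSq ?_
      rw [← fderiv_apply_one_eq_deriv]
      exact LinearMap.det_ring _
    rw [this, abs_of_nonneg (by positivity)]
  have hloc : F ∘ c.symm =ᶠ[𝓝 z] (F ∘ c'.symm) ∘ T := by
    filter_upwards [T.open_source.mem_nhds hz] with w hw
    simp only [Function.comp_apply, hsymm w hw]
  have hTz : T z ∈ c'.target := by
    have := T.map_source hz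
    rw [hTt] at this
    exact this.1
  simp only [hdet, smul_eq_mul, hsymm z hz]
  rw [(InnerProductSpace.laplacian_congr_nhds hloc).self_of_nhds,
    laplacian_comp_holomorphic (hT z hz)
      ((contDiffAt_comp_chart_symm y hTz (hF _)).of_le two_le_smooth)]
  ring

theorem surfaceIntegral_laplacian_of_tsupport {F : X → ℝ} (hF : ContMDiff 𝓘(ℝ, ℂ) 𝓘(ℝ) ∞ F)
    (y : X) (hy : tsupport F ⊆ (chartAt ℂ y).source) :
    surfaceIntegral X (fun c z => Laplacian.laplacian (F ∘ c.symm) z) = 0 := by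
  rw [surfaceIntegral_eq_sum]
  rw [Finset.sum_congr rfl fun x _ => integral_cutoff_laplacian_change hF x y
    (tsupport_chartPartition x) hy, ← integral_finsetSum]
  · rw [← integral_laplacian_chart_eq_zero hF y hy]
    refine setIntegral_congr_fun (chartAt ℂ y).open_target.measurableSet fun z hz => ?_
    rw [← Finset.sum_mul, ← finsum_eq_sum_of_support_subset, (chartPartition X).sum_eq_one
      (mem_univ _), one_mul]
    intro x hx
    simp only [Finite.coe_toFinset, mem_ofPred_eq]
    exact ⟨_, hx⟩
  · intro x _
    have hcont := isContForm_laplacian hF y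
    have hK : IsCompact (chartAt ℂ y '' tsupport F) :=
      (isClosed_tsupport F).isCompact.image_of_continuousOn ((chartAt ℂ y).continuousOn.mono hy)
    have hKt : chartAt ℂ y '' tsupport F ⊆ (chartAt ℂ y).target := by
      rintro _ ⟨p, hp, rfl⟩
      exact (chartAt ℂ y).map_source (hy hp)
    refine ((((chartPartition X x).continuous.comp_continuousOn
      ((chartAt ℂ y).continuousOn_symm.mono hKt)).mul
      (hcont.mono hKt)).integrableOn_compact hK).of_forall_sdiff_eq_zero
      (chartAt ℂ y).open_target.measurableSet ?_
    rintro z ⟨hz, hz'⟩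
    exact mul_eq_zero_of_right _
      (laplacian_chart_eq_zero y hz fun h => hz' ⟨_, h, (chartAt ℂ y).right_inv hz⟩)

/-- Stokes' theorem for `d dᶜ F` on a compact Riemann surface. -/
theorem surfaceIntegral_laplacian {F : X → ℝ} (hF : ContMDiff 𝓘(ℝ, ℂ) 𝓘(ℝ) ∞ F) :
    surfaceIntegral X (fun c z => Laplacian.laplacian (F ∘ c.symm) z) = 0 := by
  have := isManifold_real (X := X)
  obtain ⟨η, hη⟩ := SmoothPartitionOfUnity.exists_isSubordinate_chartAt_source (I := 𝓘(ℝ, ℂ)) X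
  have hfin : {x : X | (Function.support (η x)).Nonempty}.Finite :=
    η.locallyFinite.finite_nonempty_of_compact
  let G : X → X → ℝ := fun x p => η x p * F p
  have hG : ∀ x, ContMDiff 𝓘(ℝ, ℂ) 𝓘(ℝ) ∞ (G x) := fun x => (η x).contMDiff.mul hF
  have hsum : ∀ p, F p = ∑ x ∈ hfin.toFinset, G x p := by
    intro p
    rw [← Finset.sum_mul, ← finsum_eq_sum_of_support_subset, η.sum_eq_one (mem_univ _), one_mul]
    intro x hx
    simp only [Finite.coe_toFinset, mem_ofPred_eq]
    exact ⟨_, hx⟩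
  have hlap : ∀ x : X, ∀ z ∈ (chartAt ℂ x).target,
      Laplacian.laplacian (F ∘ (chartAt ℂ x).symm) z =
        ∑ y ∈ hfin.toFinset, Laplacian.laplacian (G y ∘ (chartAt ℂ x).symm) z := by
    intro x z hz
    have h1 : F ∘ (chartAt ℂ x).symm = ∑ y ∈ hfin.toFinset, G y ∘ (chartAt ℂ x).symm := by
      funext w
      simp [hsum]
    rw [h1]
    have h2 : ∀ y, ContDiffAt ℝ 2 (G y ∘ (chartAt ℂ x).symm) z := fun y =>
      (contDiffAt_comp_chart_symm x hz (hG y _)).of_le two_le_smooth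
    generalize hfin.toFinset = s
    classical
    induction s using Finset.induction_on with
    | empty => simp only [Finset.sum_empty]; exact congrFun (InnerProductSpace.laplacian_const (c := (0 : ℝ))) z
    | insert a s ha ih =>
      rw [Finset.sum_insert ha, Finset.sum_insert ha, ContDiffAt.laplacian_add (h2 a), ih]
      have : (∑ y ∈ s, G y ∘ (chartAt ℂ x).symm) = fun w => ∑ y ∈ s, (G y ∘ (chartAt ℂ x).symm) w := by
        funext w; simp
      rw [this]
      exact ContDiffAt.sum fun y _ => h2 y
  rw [surfaceIntegral_congr (κ' := fun c z => ∑ y ∈ hfin.toFinset,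
    Laplacian.laplacian (G y ∘ c.symm) z) hlap, surfaceIntegral_sum hfin.toFinset
    (fun y c z => Laplacian.laplacian (G y ∘ c.symm) z) fun y => isContForm_laplacian (hG y)]
  refine Finset.sum_eq_zero fun y _ => surfaceIntegral_laplacian_of_tsupport (hG y) y ?_
  exact (closure_mono (Function.support_mul_subset_left _ _)).trans (hη y)

end SurfaceIntegral

end OrthBundle

namespace OrthBundle

/-! ### Metrics on determinant line bundles and the degree -/

section DetMetrics

variable {X : Type*} [TopologicalSpace X] [ChartedSpace ℂ X]
  {V : X → Type*} [∀ x, AddCommGroup (V x)] [∀ x, Module ℂ (V x)]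
  {hol : (∀ x, V x) → Set X → Prop} {n : ℕ}

/-- The determinant of the change of holomorphic frames is holomorphic. -/
def HasHolTransitions (hol : (∀ x, V x) → Set X → Prop) (n : ℕ) : Prop :=
  ∀ (b b' : ∀ x, Module.Basis (Fin n) ℂ (V x)) (U U' : Set X), IsHolFrame hol b U →
    IsHolFrame hol b' U' → ∀ x ∈ U, x ∈ U' →
      ContMDiffAt 𝓘(ℂ) 𝓘(ℂ) ω (fun x => (b x).det (fun i => b' x i)) x

theorem contMDiffAt_log_normSq {h : X → ℂ} {x : X} (hh : ContMDiffAt 𝓘(ℂ) 𝓘(ℂ) ω h x)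
    (h0 : h x ≠ 0) : ContMDiffAt 𝓘(ℝ, ℂ) 𝓘(ℝ) ∞ (fun p => Real.log (‖h p‖ ^ 2)) x := by
  have h1 : ContDiffAt ℝ ∞ (fun z : ℂ => Real.log (‖z‖ ^ 2)) (h x) :=
    (contDiff_norm_sq ℝ).contDiffAt.log (by positivity)
  exact h1.contMDiffAt.comp x (contMDiffAt_real_of_holomorphic hh)

theorem det_basis_ne_zero {M : Type*} [AddCommGroup M] [Module ℂ M]
    (b b' : Module.Basis (Fin n) ℂ M) : b.det (fun i => b' i) ≠ 0 :=
  (b.isUnit_det b').ne_zero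

theorem DetMetric.log_change (N : DetMetric V hol n) (x : X)
    (b b' : Module.Basis (Fin n) ℂ (V x)) :
    Real.log (N.normSq x b') =
      2 * Real.log ‖b.det (fun i => b' i)‖ + Real.log (N.normSq x b) := by
  have h0 : ‖b.det (fun i => b' i)‖ ≠ 0 := norm_ne_zero_iff.2 (det_basis_ne_zero b b')
  rw [N.change x b b', Real.log_mul (pow_ne_zero 2 h0) (N.pos x b).ne', Real.log_pow]
  norm_num

theorem DetMetric.contMDiffAt_log (N : DetMetric V hol n)
    {b : ∀ x, Module.Basis (Fin n) ℂ (V x)} {U : Set X} (hb : IsHolFrame hol b U) {x : X}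
    (hx : x ∈ U) : ContMDiffAt 𝓘(ℝ, ℂ) 𝓘(ℝ) ∞ (fun x => Real.log (N.normSq x (b x))) x := by
  have h1 : ContMDiffAt 𝓘(ℝ, ℂ) 𝓘(ℝ) ∞ (fun x => N.normSq x (b x)) x :=
    (N.smooth b U hb).contMDiffAt (hb.1.mem_nhds hx)
  exact (Real.contDiffAt_log.2 (N.pos x (b x)).ne').contMDiffAt.comp x h1

variable [IsManifold 𝓘(ℂ) ω X]

theorem DetMetric.laplacian_frame_congr (N : DetMetric V hol n) (htrans : HasHolTransitions hol n)
    {b b' : ∀ x, Module.Basis (Fin n) ℂ (V x)} {U U' : Set X} (hb : IsHolFrame hol b U)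
    (hb' : IsHolFrame hol b' U') (x : X) {z : ℂ} (hz : z ∈ (chartAt ℂ x).target)
    (hU : (chartAt ℂ x).symm z ∈ U) (hU' : (chartAt ℂ x).symm z ∈ U') :
    Laplacian.laplacian ((fun p => Real.log (N.normSq p (b' p))) ∘ (chartAt ℂ x).symm) z =
      Laplacian.laplacian ((fun p => Real.log (N.normSq p (b p))) ∘ (chartAt ℂ x).symm) z := by
  set c := chartAt ℂ x with hc
  let h : ℂ → ℂ := (fun p => (b p).det (fun i => b' p i)) ∘ c.symm
  have hh : ContDiffAt ℂ ω h z :=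
    contDiffAt_comp_chart_symm_complex x hz (htrans b b' U U' hb hb' _ hU hU')
  have h0 : h z ≠ 0 := det_basis_ne_zero _ _
  have hN := contDiffAt_comp_chart_symm x hz (N.contMDiffAt_log hb hU)
  have hlog : ContDiffAt ℝ 2 (fun w => Real.log ‖h w‖) z :=
    (((hh.restrict_scalars ℝ).of_le le_top).norm ℝ h0).log (norm_ne_zero_iff.2 h0)
  have heq : (fun p => Real.log (N.normSq p (b' p))) ∘ c.symm =
      (2 : ℝ) • (fun w => Real.log ‖h w‖) + (fun p => Real.log (N.normSq p (b p))) ∘ c.symm := by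
    funext w
    simp [h, N.log_change _ (b (c.symm w)) (b' (c.symm w))]
  have hlog2 : ContDiffAt ℝ 2 ((2 : ℝ) • fun w => Real.log ‖h w‖) z :=
    contDiffAt_const.smul hlog
  rw [heq, ContDiffAt.laplacian_add hlog2 (hN.of_le two_le_smooth),
    InnerProductSpace.laplacian_smul _ hlog, laplacian_log_norm_eq_zero hh h0, smul_zero, zero_add]

theorem DetMetric.chernForm_eq (N : DetMetric V hol n) (htrans : HasHolTransitions hol n)
    {b : ∀ x, Module.Basis (Fin n) ℂ (V x)} {U : Set X} (hb : IsHolFrame hol b U)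
    (x : X) {z : ℂ} (hz : z ∈ (chartAt ℂ x).target) (hU : (chartAt ℂ x).symm z ∈ U) :
    N.chernForm (chartAt ℂ x) z = -(1 / (4 * Real.pi)) *
      Laplacian.laplacian ((fun p => Real.log (N.normSq p (b p))) ∘ (chartAt ℂ x).symm) z := by
  have h : ∃ (b : ∀ x, Module.Basis (Fin n) ℂ (V x)) (U : Set X),
      (chartAt ℂ x).symm z ∈ U ∧ IsHolFrame hol b U := ⟨b, U, hU, hb⟩
  rw [DetMetric.chernForm, dif_pos h]
  obtain ⟨U', hU', hb'⟩ := h.choose_spec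
  congr 1
  exact N.laplacian_frame_congr htrans hb hb' x hz hU hU'

theorem DetMetric.isContForm_chernForm (N : DetMetric V hol n) (hloc : HasLocalFrames hol n)
    (htrans : HasHolTransitions hol n) : IsContForm (X := X) N.chernForm := by
  intro x z hz
  obtain ⟨b, U, hU, hb⟩ := hloc ((chartAt ℂ x).symm z)
  have h1 := continuousAt_laplacian (contDiffAt_comp_chart_symm x hz (N.contMDiffAt_log hb hU))
  refine ((h1.const_mul (-(1 / (4 * Real.pi)))).congr ?_).continuousWithinAt
  filter_upwards [(chartAt ℂ x).open_target.mem_nhds hz,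
    ((chartAt ℂ x).continuousAt_symm hz).preimage_mem_nhds (hb.1.mem_nhds hU)] with w hw hwU
  exact (N.chernForm_eq htrans hb x hw hwU).symm

variable [T2Space X] [CompactSpace X]

theorem surfaceIntegral_chernForm_congr (N N' : DetMetric V hol n) (hloc : HasLocalFrames hol n)
    (htrans : HasHolTransitions hol n) :
    surfaceIntegral X N.chernForm = surfaceIntegral X N'.chernForm := by
  choose b₀ U₀ hU₀ hb₀ using hloc
  let F : X → ℝ := fun x => Real.log (N.normSq x (b₀ x x)) - Real.log (N'.normSq x (b₀ x x))
  have hF : ∀ x (b : Module.Basis (Fin n) ℂ (V x)),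
      F x = Real.log (N.normSq x b) - Real.log (N'.normSq x b) := fun x b => by
    simp only [F, N.log_change x b (b₀ x x), N'.log_change x b (b₀ x x)]
    ring
  have hsm : ContMDiff 𝓘(ℝ, ℂ) 𝓘(ℝ) ∞ F := by
    intro x
    have : F = fun p => Real.log (N.normSq p (b₀ x p)) - Real.log (N'.normSq p (b₀ x p)) :=
      funext fun p => hF p _
    rw [this]
    exact (N.contMDiffAt_log (hb₀ x) (hU₀ x)).sub (N'.contMDiffAt_log (hb₀ x) (hU₀ x))
  have key : ∀ x : X, ∀ z ∈ (chartAt ℂ x).target, N.chernForm (chartAt ℂ x) z =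
      N'.chernForm (chartAt ℂ x) z +
        -(1 / (4 * Real.pi)) * Laplacian.laplacian (F ∘ (chartAt ℂ x).symm) z := by
    intro x z hz
    set c := chartAt ℂ x with hc
    have hb := hb₀ (c.symm z)
    have hU := hU₀ (c.symm z)
    have h1 := (contDiffAt_comp_chart_symm x hz (N'.contMDiffAt_log hb hU)).of_le two_le_smooth
    have h2 := (contDiffAt_comp_chart_symm x hz (hsm (c.symm z))).of_le two_le_smooth
    rw [N.chernForm_eq htrans hb x hz hU, N'.chernForm_eq htrans hb x hz hU, ← mul_add,
      ← ContDiffAt.laplacian_add h1 h2]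
    congr 2
    refine congrArg (fun f : ℂ → ℝ => Laplacian.laplacian f z) (funext fun w => ?_)
    simp [← hc, hF _ (b₀ (c.symm z) (c.symm w))]
  rw [surfaceIntegral_congr (κ' := fun c z => N'.chernForm c z +
      -(1 / (4 * Real.pi)) * Laplacian.laplacian (F ∘ c.symm) z) key,
    surfaceIntegral_add (N'.isContForm_chernForm (fun x => ⟨_, _, hU₀ x, hb₀ x⟩) htrans)
      (fun x => continuousOn_const.mul (isContForm_laplacian hsm x)),
    surfaceIntegral_const_mul _ (fun c z => Laplacian.laplacian (F ∘ c.symm) z),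
    surfaceIntegral_laplacian hsm, mul_zero, add_zero]

/-- The degree can be computed with any metric. -/
theorem degreeOf_eq (N : DetMetric V hol n) (hloc : HasLocalFrames hol n)
    (htrans : HasHolTransitions hol n) :
    degreeOf V hol n = surfaceIntegral X N.chernForm := by
  rw [degreeOf, dif_pos ⟨N⟩]
  exact surfaceIntegral_chernForm_congr _ _ hloc htrans

theorem nonempty_detMetric (hloc : HasLocalFrames hol n) (htrans : HasHolTransitions hol n) :
    Nonempty (DetMetric V hol n) := by
  have := isManifold_real (X := X)
  choose b₀ U₀ hU₀ hb₀ using hloc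
  obtain ⟨η, hη⟩ := SmoothPartitionOfUnity.exists_isSubordinate 𝓘(ℝ, ℂ) isClosed_univ U₀
    (fun x => (hb₀ x).1) (fun x _ => mem_iUnion.2 ⟨x, hU₀ x⟩)
  have hfin : ∀ x, (Function.support fun y => η y x).Finite := fun x =>
    η.locallyFinite.point_finite x
  refine ⟨⟨fun x b => Real.exp (∑ᶠ y, η y x • Real.log (‖(b₀ y x).det (fun i => b i)‖ ^ 2)),
    fun _ _ => Real.exp_pos _, fun x b b' => ?_, fun b U hb => ?_⟩⟩
  · have h0 : ∀ c c' : Module.Basis (Fin n) ℂ (V x), 0 < ‖c.det (fun i => c' i)‖ ^ 2 := fun c c' =>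
      pow_pos (norm_pos_iff.2 (det_basis_ne_zero c c')) 2
    have h1 : ∀ y, η y x • Real.log (‖(b₀ y x).det (fun i => b' i)‖ ^ 2) =
        η y x * Real.log (‖b.det (fun i => b' i)‖ ^ 2) +
          η y x * Real.log (‖(b₀ y x).det (fun i => b i)‖ ^ 2) := by
      intro y
      have h2 : (b₀ y x).det (fun i => b' i) =
          (b₀ y x).det (fun i => b i) * b.det (fun i => b' i) :=
        ((b₀ y x).det_mul_det b b').symm
      rw [h2, norm_mul, mul_pow, Real.log_mul (h0 _ _).ne' (h0 _ _).ne', smul_eq_mul]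
      ring
    have h3 : ∀ g : X → ℝ, (Function.support fun y => η y x * g y).Finite := fun g =>
      (hfin x).subset (Function.support_mul_subset_left _ _)
    simp only [smul_eq_mul] at h1 ⊢
    rw [finsum_congr h1, finsum_add_distrib (h3 _) (h3 _), ← finsum_mul' _ _ (hfin x),
      η.sum_eq_one (mem_univ x), one_mul, Real.exp_add, Real.exp_log (h0 _ _)]
  · intro x hx
    refine ContMDiffAt.contMDiffWithinAt ?_
    refine Real.contDiff_exp.contDiffAt.contMDiffAt.comp x ?_
    refine SmoothPartitionOfUnity.contMDiffAt_finsum η (n := ⊤) fun y hy => ?_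
    exact contMDiffAt_log_normSq (htrans _ _ _ _ (hb₀ y) hb x (hη y hy) hx)
      (det_basis_ne_zero _ _)

end DetMetrics

end OrthBundle

namespace OrthBundle

/-! ### Holomorphic matrix functions -/

section HolFun

variable {X : Type*} [TopologicalSpace X] [ChartedSpace ℂ X]

/-- `f` is holomorphic near `x`. -/
abbrev HolFun (f : X → ℂ) (x : X) : Prop := ContMDiffAt 𝓘(ℂ) 𝓘(ℂ) ω f x

theorem HolFun.mul {f g : X → ℂ} {x : X} (hf : HolFun f x) (hg : HolFun g x) :
    HolFun (fun y => f y * g y) x :=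
  ContMDiffAt.mul hf hg

theorem HolFun.sum {ι : Type*} {s : Finset ι} {f : ι → X → ℂ} {x : X}
    (h : ∀ i ∈ s, HolFun (f i) x) : HolFun (fun y => ∑ i ∈ s, f i y) x :=
  ContMDiffAt.sum h

variable {n m : ℕ}

theorem HolFun.det {A : X → Matrix (Fin n) (Fin n) ℂ} {x : X}
    (h : ∀ i j, HolFun (fun y => A y i j) x) : HolFun (fun y => (A y).det) x := by
  simp only [Matrix.det_apply']
  exact HolFun.sum fun σ _ => HolFun.mul contMDiffAt_const (ContMDiffAt.prod fun i _ => h _ _)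

theorem HolFun.matrix_mul {k : ℕ} {A : X → Matrix (Fin n) (Fin m) ℂ}
    {B : X → Matrix (Fin m) (Fin k) ℂ} {x : X} (hA : ∀ i j, HolFun (fun y => A y i j) x)
    (hB : ∀ i j, HolFun (fun y => B y i j) x) (i : Fin n) (j : Fin k) :
    HolFun (fun y => (A y * B y) i j) x := by
  simp only [Matrix.mul_apply]
  exact HolFun.sum fun l _ => (hA _ _).mul (hB _ _)

theorem HolFun.mulVec {A : X → Matrix (Fin n) (Fin m) ℂ} {v : X → Fin m → ℂ} {x : X}
    (hA : ∀ i j, HolFun (fun y => A y i j) x) (hv : ∀ j, HolFun (fun y => v y j) x) (i : Fin n) :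
    HolFun (fun y => (A y *ᵥ v y) i) x := by
  simp only [Matrix.mulVec, dotProduct]
  exact HolFun.sum fun l _ => (hA _ _).mul (hv _)

theorem HolFun.matrix_inv {A : X → Matrix (Fin n) (Fin n) ℂ} {x : X}
    (hA : ∀ i j, HolFun (fun y => A y i j) x) (h0 : (A x).det ≠ 0) (i j : Fin n) :
    HolFun (fun y => (A y)⁻¹ i j) x := by
  simp only [Matrix.inv_def, Ring.inverse_eq_inv', Matrix.smul_apply, smul_eq_mul,
    Matrix.adjugate_apply]
  refine HolFun.mul ((HolFun.det hA).inv₀ h0) (HolFun.det fun k l => ?_)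
  simp only [Matrix.updateRow_apply]
  split_ifs
  · exact contMDiffAt_const
  · exact hA k l

end HolFun

/-! ### Holomorphic sections of vector bundles -/

section HolSections

variable {X : Type*} [TopologicalSpace X] [ChartedSpace ℂ X]
  {F : Type*} [NormedAddCommGroup F] [NormedSpace ℂ F]
  {E : X → Type*} [TopologicalSpace (TotalSpace F E)]
  [∀ x, AddCommGroup (E x)] [∀ x, Module ℂ (E x)] [∀ x, TopologicalSpace (E x)]
  [FiberBundle F E]

variable (F E) in
/-- The section `σ` is holomorphic near `x`. -/
abbrev HolAt (σ : ∀ x, E x) (x : X) : Prop :=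
  ContMDiffAt 𝓘(ℂ) (𝓘(ℂ).prod 𝓘(ℂ, F)) ω (fun x => TotalSpace.mk' F x (σ x)) x

theorem IsHolSection.holAt {σ : ∀ x, E x} {U : Set X} (h : IsHolSection F E σ U) (hU : IsOpen U)
    {x : X} (hx : x ∈ U) : HolAt F E σ x :=
  h.contMDiffAt (hU.mem_nhds hx)

theorem isHolSection_of_holAt {σ : ∀ x, E x} {U : Set X} (h : ∀ x ∈ U, HolAt F E σ x) :
    IsHolSection F E σ U :=
  fun x hx => (h x hx).contMDiffWithinAt

theorem HolAt.congr {σ τ : ∀ x, E x} {x : X} (h : HolAt F E σ x) (he : ∀ᶠ y in 𝓝 x, τ y = σ y) :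
    HolAt F E τ x :=
  h.congr_of_eventuallyEq (he.mono fun y hy => by simp only [hy])

variable [VectorBundle ℂ F E]

theorem HolAt.sum_smul {ι : Type*} {s : Finset ι} {f : ι → X → ℂ} {σ : ι → ∀ x, E x} {x : X}
    (hf : ∀ i ∈ s, HolFun (f i) x) (hσ : ∀ i ∈ s, HolAt F E (σ i) x) :
    HolAt F E (fun y => ∑ i ∈ s, f i y • σ i y) x :=
  ContMDiffAt.sum_section fun i hi => (hf i hi).smul_section (hσ i hi)

variable [ContMDiffVectorBundle ω F E 𝓘(ℂ)] [FiniteDimensional ℂ F] {n : ℕ}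

theorem HolAt.eventually [IsManifold 𝓘(ℂ) ω X] {σ : ∀ x, E x} {x : X} (h : HolAt F E σ x) :
    ∀ᶠ y in 𝓝 x, HolAt F E σ y :=
  (contMDiffAt_iff_contMDiffAt_nhds (by simp)).1 h

theorem exists_holFrame_coeff (hn : Module.finrank ℂ F = n) (x₀ : X) :
    ∃ (b : ∀ x, Module.Basis (Fin n) ℂ (E x)) (U : Set X), x₀ ∈ U ∧
      IsHolFrame (IsHolSection F E) b U ∧ ∀ (σ : ∀ x, E x), ∀ x ∈ U, HolAt F E σ x →
        ∀ i, HolFun (fun y => (b y).repr (σ y) i) x := by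
  classical
  have h1 : ContMDiffVectorBundle 1 F E 𝓘(ℂ) := ContMDiffVectorBundle.of_le (n := ω) le_top
  let b₀ : Module.Basis (Fin n) ℂ F := Module.finBasisOfFinrankEq ℂ F hn
  let e := trivializationAt F E x₀
  let b : ∀ x, Module.Basis (Fin n) ℂ (E x) := fun x =>
    if hx : x ∈ e.baseSet then e.basisAt b₀ hx else
      (trivializationAt F E x).basisAt b₀ (mem_baseSet_trivializationAt F E x)
  have hb : ∀ x (hx : x ∈ e.baseSet), b x = e.basisAt b₀ hx := fun x hx => dif_pos hx
  refine ⟨b, e.baseSet, mem_baseSet_trivializationAt F E x₀, ⟨e.open_baseSet, fun i => ?_⟩,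
    fun σ x hx hσ i => ?_⟩
  · refine (e.contMDiffOn_localFrame_baseSet ω b₀ i).congr fun x hx => ?_
    simp only [hb x hx, Bundle.Trivialization.localFrame_apply_of_mem_baseSet _ _ hx]
  · refine (contMDiffAt_localFrameCoeff (I := 𝓘(ℂ)) b₀ hx hσ i).congr_of_eventuallyEq ?_
    filter_upwards [e.open_baseSet.mem_nhds hx] with y hy
    rw [hb y hy]
    exact (e.localFrameCoeff_apply_of_mem_baseSet b₀ hy σ i).symm

theorem hasLocalFrames_vectorBundle (hn : Module.finrank ℂ F = n) :
    HasLocalFrames (IsHolSection F E) n := fun x₀ => by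
  obtain ⟨b, U, hx, hb, -⟩ := exists_holFrame_coeff (F := F) (E := E) hn x₀
  exact ⟨b, U, hx, hb⟩

/-- The coefficients of a holomorphic section in a holomorphic frame are holomorphic. -/
theorem HolAt.repr (hn : Module.finrank ℂ F = n) {b : ∀ x, Module.Basis (Fin n) ℂ (E x)} {x : X}
    (hb : ∀ i, HolAt F E (fun y => b y i) x) {σ : ∀ x, E x} (hσ : HolAt F E σ x) (i : Fin n) :
    HolFun (fun y => (b y).repr (σ y) i) x := by
  obtain ⟨c, U, hx, -, hc⟩ := exists_holFrame_coeff (F := F) (E := E) hn x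
  let A : X → Matrix (Fin n) (Fin n) ℂ := fun y => (c y).toMatrix (b y)
  have hA : ∀ i j, HolFun (fun y => A y i j) x := fun i j => hc _ x hx (hb j) i
  have h0 : ∀ y, (A y).det ≠ 0 := fun y => by
    have := (c y).isUnit_det (b y)
    rw [Module.Basis.det_apply] at this
    exact this.ne_zero
  have h1 : ∀ y, (b y).repr (σ y) i = ((A y)⁻¹ *ᵥ (fun j => (c y).repr (σ y) j)) i := fun y => by
    have h2 : (A y)⁻¹ = (b y).toMatrix (c y) :=
      Matrix.inv_eq_left_inv ((b y).toMatrix_mul_toMatrix_flip (c y))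
    rw [h2]
    exact (congrFun ((c y).toMatrix_mulVec_repr (b y) (σ y)) i).symm
  simp only [h1]
  exact HolFun.mulVec (HolFun.matrix_inv hA (h0 x)) (fun j => hc σ x hx hσ j) i

theorem HolAt.det (hn : Module.finrank ℂ F = n) {b : ∀ x, Module.Basis (Fin n) ℂ (E x)} {x : X}
    (hb : ∀ i, HolAt F E (fun y => b y i) x) {σ : Fin n → ∀ x, E x}
    (hσ : ∀ i, HolAt F E (σ i) x) : HolFun (fun y => (b y).det (fun i => σ i y)) x := by
  simp only [Module.Basis.det_apply]
  exact HolFun.det fun i j => HolAt.repr hn hb (hσ j) i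

theorem hasHolTransitions_vectorBundle (hn : Module.finrank ℂ F = n) :
    HasHolTransitions (IsHolSection F E) n := fun _ _ _ _ hb hb' _ hx hx' =>
  HolAt.det hn (fun i => (hb.2 i).holAt hb.1 hx) (fun i => (hb'.2 i).holAt hb'.1 hx')

end HolSections

end OrthBundle

namespace OrthBundle

/-! ### Existence of adapted frames at a point -/

section Pointwise

variable {X : Type*} [TopologicalSpace X] [ChartedSpace ℂ X]
  {F : Type*} [NormedAddCommGroup F] [NormedSpace ℂ F]
  {FL : Type*} [NormedAddCommGroup FL] [NormedSpace ℂ FL]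
  {FH : Type*} [NormedAddCommGroup FH] [NormedSpace ℂ FH]
  {E : X → Type*} [TopologicalSpace (TotalSpace F E)]
  [∀ x, AddCommGroup (E x)] [∀ x, Module ℂ (E x)] [∀ x, TopologicalSpace (E x)]
  [FiberBundle F E]
  {L : X → Type*} [TopologicalSpace (TotalSpace FL L)]
  [∀ x, AddCommGroup (L x)] [∀ x, Module ℂ (L x)] [∀ x, TopologicalSpace (L x)]
  [FiberBundle FL L]
  {H : X → Type*} [TopologicalSpace (TotalSpace FH H)]
  [∀ x, AddCommGroup (H x)] [∀ x, Module ℂ (H x)] [∀ x, TopologicalSpace (H x)]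
  [FiberBundle FH H] {φ : OrthogonalForm F FL E L} {j : IsotropicSubbundle FH H φ}
  {r : ℕ} {B : Matrix (Fin r) (Fin r) ℂ} {W : Submodule ℂ (Fin r → ℂ)} {x : X}

variable (φ) in
/-- The Gram matrix of the orthogonal form in a linear parametrization `f` of a fibre, with respect
to a basis of the fibre of `L`. -/
def gram (f : (Fin r → ℂ) →ₗ[ℂ] E x) (c : Module.Basis (Fin 1) ℂ (L x)) :
    Matrix (Fin r) (Fin r) ℂ :=
  LinearMap.toMatrix₂' ℂ (((φ.form x).compl₁₂ f f).compr₂ (c.coord 0))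

theorem gram_apply (f : (Fin r → ℂ) →ₗ[ℂ] E x) (c : Module.Basis (Fin 1) ℂ (L x)) (k l : Fin r) :
    gram φ f c k l = c.repr (φ.form x (f (Pi.single k 1)) (f (Pi.single l 1))) 0 := by
  rw [gram, LinearMap.toMatrix₂'_apply]
  rfl

theorem dotProduct_gram_mulVec (f : (Fin r → ℂ) →ₗ[ℂ] E x) (c : Module.Basis (Fin 1) ℂ (L x))
    (v w : Fin r → ℂ) : v ⬝ᵥ gram φ f c *ᵥ w = c.repr (φ.form x (f v) (f w)) 0 := by
  rw [← Matrix.toLinearMap₂'_apply', gram, Matrix.toLinearMap₂'_toMatrix']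
  rfl

theorem form_eq_gram (f : (Fin r → ℂ) →ₗ[ℂ] E x) (c : Module.Basis (Fin 1) ℂ (L x))
    (v w : Fin r → ℂ) : φ.form x (f v) (f w) = (v ⬝ᵥ gram φ f c *ᵥ w) • c 0 := by
  rw [dotProduct_gram_mulVec]
  conv_lhs => rw [← c.sum_repr (φ.form x (f v) (f w))]
  simp

theorem gram_isSymm (f : (Fin r → ℂ) →ₗ[ℂ] E x) (c : Module.Basis (Fin 1) ℂ (L x)) :
    (gram φ f c).IsSymm := by
  ext k l
  rw [Matrix.transpose_apply, gram_apply, gram_apply, φ.symm]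

theorem gram_isIsotropic (j : IsotropicSubbundle FH H φ) {f : (Fin r → ℂ) →ₗ[ℂ] E x}
    (hf : ∀ w ∈ W, f w ∈ LinearMap.range (j.incl x)) (c : Module.Basis (Fin 1) ℂ (L x)) :
    IsIsotropic (gram φ f c) W := by
  intro v hv w hw
  obtain ⟨a, ha⟩ := hf v hv
  obtain ⟨b, hb⟩ := hf w hw
  rw [dotProduct_gram_mulVec, ← ha, ← hb, j.isotropic, map_zero c.repr]
  rfl

theorem gram_det_ne_zero {f : (Fin r → ℂ) →ₗ[ℂ] E x} (hf : Function.Bijective f)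
    (c : Module.Basis (Fin 1) ℂ (L x)) : (gram φ f c).det ≠ 0 := by
  intro h
  obtain ⟨v, hv0, hv⟩ := Matrix.exists_mulVec_eq_zero_iff.2 h
  refine hv0 (hf.1 ?_)
  rw [map_zero]
  refine φ.nondegenerate x _ fun w => ?_
  obtain ⟨w, rfl⟩ := hf.2 w
  rw [φ.symm, form_eq_gram f c, hv, dotProduct_zero, zero_smul]

theorem mem_range_incl_iff [FiniteDimensional ℂ (H x)]
    (hW : Module.finrank ℂ W = Module.finrank ℂ (H x))
    {f : (Fin r → ℂ) →ₗ[ℂ] E x} (hf : Function.Injective f)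
    (hfW : ∀ w ∈ W, f w ∈ LinearMap.range (j.incl x)) (v : Fin r → ℂ) :
    f v ∈ LinearMap.range (j.incl x) ↔ v ∈ W := by
  have hmap : W.map f = LinearMap.range (j.incl x) := by
    have hle : W.map f ≤ LinearMap.range (j.incl x) := by
      rintro _ ⟨w, hw, rfl⟩
      exact hfW w hw
    refine Submodule.eq_of_le_of_finrank_eq hle ?_
    rw [LinearMap.finrank_range_of_inj (j.injective x), ← hW]
    exact (LinearEquiv.finrank_eq (Submodule.equivMapOfInjective f hf W)).symm
  rw [← hmap]
  constructor
  · rintro ⟨w, hw, he⟩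
    rwa [← hf he]
  · exact fun hv => ⟨v, hv, rfl⟩

/-- A parametrization whose Gram matrix is `Sᵗ B S` yields an adapted frame. -/
theorem exists_adaptedFrame_of_gram {f : (Fin r → ℂ) →ₗ[ℂ] E x} (hf : Function.Bijective f)
    (hfW : ∀ v, f v ∈ LinearMap.range (j.incl x) ↔ v ∈ W) {t : L x} (ht : t ≠ 0)
    {G : Matrix (Fin r) (Fin r) ℂ} (hG : ∀ v w, φ.form x (f v) (f w) = (v ⬝ᵥ G *ᵥ w) • t)
    {S : Matrix (Fin r) (Fin r) ℂ} (hS : S.det ≠ 0) (hSW : ∀ w ∈ W, S *ᵥ w ∈ W)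
    (hSG : Sᵀ * B * S = G) :
    ∃ a : AdaptedFrame j B W x, ∀ v, a.1.1 v = f (S⁻¹ *ᵥ v) := by
  have h1 : S⁻¹ * S = 1 := Matrix.nonsing_inv_mul _ (isUnit_iff_ne_zero.2 hS)
  have h2 : S * S⁻¹ = 1 := Matrix.mul_nonsing_inv _ (isUnit_iff_ne_zero.2 hS)
  let u : (Fin r → ℂ) ≃ₗ[ℂ] E x :=
    (Matrix.toLin'OfInv h2 h1).trans (LinearEquiv.ofBijective f hf)
  have hu : ∀ v, u v = f (S⁻¹ *ᵥ v) := fun v => rfl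
  have hcancel : ∀ v, S *ᵥ S⁻¹ *ᵥ v = v := fun v => by
    rw [Matrix.mulVec_mulVec, h2, Matrix.one_mulVec]
  refine ⟨⟨⟨u, t, ht, fun v w => ?_⟩, fun v => ?_⟩, hu⟩
  · rw [hu, hu, hG, ← hSG, dotProduct_transpose_mul_mul_mulVec, hcancel, hcancel]
  · change u v ∈ _ ↔ _
    rw [hu, hfW]
    refine ⟨fun h => ?_, fun h => inv_mulVec_mem hS hSW h⟩
    have := hSW _ h
    rwa [hcancel] at this

theorem nonempty_adaptedFrame (hB : B.IsSymm) (hdet : B.det ≠ 0) (hW : IsIsotropic B W)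
    (bE : Module.Basis (Fin r) ℂ (E x)) (c : Module.Basis (Fin 1) ℂ (L x))
    (bH : Module.Basis (Fin (Module.finrank ℂ W)) ℂ (H x)) : Nonempty (AdaptedFrame j B W x) := by
  have : FiniteDimensional ℂ (H x) := bH.finiteDimensional_of_finite
  have : FiniteDimensional ℂ (E x) := bE.finiteDimensional_of_finite
  let K := LinearMap.range (j.incl x)
  have hK : Module.finrank ℂ K = Module.finrank ℂ W := by
    rw [LinearMap.finrank_range_of_inj (j.injective x), Module.finrank_eq_card_basis bH,
      Fintype.card_fin]
  obtain ⟨W', hW'⟩ := W.exists_isCompl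
  obtain ⟨K', hK'⟩ := K.exists_isCompl
  have hdim : Module.finrank ℂ W' = Module.finrank ℂ K' := by
    have h1 := Submodule.finrank_add_eq_of_isCompl hW'
    have h2 := Submodule.finrank_add_eq_of_isCompl hK'
    rw [Module.finrank_eq_card_basis bE, Fintype.card_fin] at h2
    rw [Module.finrank_fin_fun] at h1
    omega
  let e1 : W ≃ₗ[ℂ] K := LinearEquiv.ofFinrankEq _ _ hK.symm
  let e2 : W' ≃ₗ[ℂ] K' := LinearEquiv.ofFinrankEq _ _ hdim
  let u : (Fin r → ℂ) ≃ₗ[ℂ] E x := (Submodule.prodEquivOfIsCompl W W' hW').symm.trans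
    ((e1.prodCongr e2).trans (Submodule.prodEquivOfIsCompl K K' hK'))
  have huW : ∀ w ∈ W, u w ∈ K := fun w hw => by
    have : u w = e1 (⟨w, hw⟩ : W) := by
      have h1 : (Submodule.prodEquivOfIsCompl W W' hW').symm w = ((⟨w, hw⟩ : W), 0) :=
        Submodule.prodEquivOfIsCompl_symm_apply_left _ _ hW' (⟨w, hw⟩ : W)
      simp [u, h1]
    rw [this]
    exact (e1 _).2
  have hbij : Function.Bijective (u : (Fin r → ℂ) →ₗ[ℂ] E x) := u.bijective
  have hHW : Module.finrank ℂ W = Module.finrank ℂ (H x) := by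
    rw [Module.finrank_eq_card_basis bH, Fintype.card_fin]
  have hG := gram_det_ne_zero (φ := φ) hbij c
  obtain ⟨S, hSW, hSG⟩ := exists_isotropic_equivalence B (gram φ (u : (Fin r → ℂ) →ₗ[ℂ] E x) c) hB
    hdet (gram_isSymm _ _) hG W hW (gram_isIsotropic j huW c)
  have hS : S.det ≠ 0 := fun h => hG (by rw [← hSG, Matrix.det_mul, h, mul_zero])
  exact ⟨(exists_adaptedFrame_of_gram hbij (mem_range_incl_iff hHW hbij.1 huW) (c.ne_zero 0)
    (form_eq_gram _ c) hS hSW hSG).choose⟩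

end Pointwise

end OrthBundle

namespace OrthBundle

/-! ### Local holomorphic adapted frames -/

section MatrixComp

variable {X : Type*} [TopologicalSpace X] [ChartedSpace ℂ X] {r : ℕ}

attribute [local instance] Matrix.linftyOpNormedRing Matrix.linftyOpNormedAlgebra in
theorem HolFun.matrix_comp {Θ : Matrix (Fin r) (Fin r) ℂ → Matrix (Fin r) (Fin r) ℂ}
    {G : X → Matrix (Fin r) (Fin r) ℂ} {x : X} (hΘ : ContDiffAt ℂ ω Θ (G x))
    (hG : ∀ i j, HolFun (fun y => G y i j) x) (i j : Fin r) :
    HolFun (fun y => Θ (G y) i j) x := by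
  let l := LinearMap.toContinuousLinearMap (Matrix.ofLinearEquiv ℂ :
    (Fin r → Fin r → ℂ) ≃ₗ[ℂ] Matrix (Fin r) (Fin r) ℂ).toLinearMap
  let p := LinearMap.toContinuousLinearMap (Matrix.entryLinearMap ℂ ℂ i j)
  let g : X → Fin r → Fin r → ℂ := fun y k l => G y k l
  have hg : ContMDiffAt 𝓘(ℂ) 𝓘(ℂ, Fin r → Fin r → ℂ) ω g x :=
    contMDiffAt_pi_space.2 fun k => contMDiffAt_pi_space.2 fun l => hG k l
  have h1 : ContDiffAt ℂ ω (p ∘ Θ ∘ l) (g x) :=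
    p.contDiff.contDiffAt.comp (g x) (ContDiffAt.comp (g x) hΘ l.contDiff.contDiffAt)
  exact h1.contMDiffAt.comp x hg

attribute [local instance] Matrix.linftyOpNormedRing Matrix.linftyOpNormedAlgebra in
theorem continuousAt_of_holFun {G : X → Matrix (Fin r) (Fin r) ℂ} {x : X}
    (hG : ∀ i j, HolFun (fun y => G y i j) x) : ContinuousAt G x :=
  continuousAt_pi.2 fun i => continuousAt_pi.2 fun j => (hG i j).continuousAt

end MatrixComp

section Local

variable {X : Type*} [TopologicalSpace X] [ChartedSpace ℂ X] [IsManifold 𝓘(ℂ) ω X]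
  {F : Type*} [NormedAddCommGroup F] [NormedSpace ℂ F]
  {FL : Type*} [NormedAddCommGroup FL] [NormedSpace ℂ FL]
  {FH : Type*} [NormedAddCommGroup FH] [NormedSpace ℂ FH]
  {E : X → Type*} [TopologicalSpace (TotalSpace F E)]
  [∀ x, AddCommGroup (E x)] [∀ x, Module ℂ (E x)] [∀ x, TopologicalSpace (E x)]
  [FiberBundle F E] [VectorBundle ℂ F E] [ContMDiffVectorBundle ω F E 𝓘(ℂ)]
  {L : X → Type*} [TopologicalSpace (TotalSpace FL L)]
  [∀ x, AddCommGroup (L x)] [∀ x, Module ℂ (L x)] [∀ x, TopologicalSpace (L x)]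
  [FiberBundle FL L] [VectorBundle ℂ FL L] [ContMDiffVectorBundle ω FL L 𝓘(ℂ)]
  {H : X → Type*} [TopologicalSpace (TotalSpace FH H)]
  [∀ x, AddCommGroup (H x)] [∀ x, Module ℂ (H x)] [∀ x, TopologicalSpace (H x)]
  [FiberBundle FH H] [VectorBundle ℂ FH H] [ContMDiffVectorBundle ω FH H 𝓘(ℂ)]
  {φ : OrthogonalForm F FL E L}
  {r : ℕ} {B : Matrix (Fin r) (Fin r) ℂ} {W : Submodule ℂ (Fin r → ℂ)}

theorem HolAt.exists_isOpen [FiniteDimensional ℂ F] {σ : ∀ x, E x} {x : X} (h : HolAt F E σ x) :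
    ∃ U, IsOpen U ∧ x ∈ U ∧ IsHolSection F E σ U := by
  obtain ⟨U, hU, hUo, hx⟩ := mem_nhds_iff.1 h.eventually
  exact ⟨U, hUo, hx, isHolSection_of_holAt hU⟩

theorem OrthogonalForm.holAt [FiniteDimensional ℂ F] (φ : OrthogonalForm F FL E L)
    {σ τ : ∀ x, E x} {x : X} (hσ : HolAt F E σ x) (hτ : HolAt F E τ x) :
    HolAt FL L (fun y => φ.form y (σ y) (τ y)) x := by
  obtain ⟨U, hU, hx, h⟩ := hσ.exists_isOpen
  obtain ⟨U', hU', hx', h'⟩ := hτ.exists_isOpen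
  exact (φ.holomorphic (U ∩ U') σ τ (hU.inter hU') (h.mono inter_subset_left)
    (h'.mono inter_subset_right)).holAt (hU.inter hU') ⟨hx, hx'⟩

theorem IsotropicSubbundle.holAt [FiniteDimensional ℂ FH] (j : IsotropicSubbundle FH H φ)
    {σ : ∀ x, H x} {x : X} (hσ : HolAt FH H σ x) : HolAt F E (fun y => j.incl y (σ y)) x := by
  obtain ⟨U, hU, hx, h⟩ := hσ.exists_isOpen
  exact (j.holomorphic U σ hU h).holAt hU hx

variable [FiniteDimensional ℂ F] [FiniteDimensional ℂ FL] [FiniteDimensional ℂ FH]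

/-- A linear isomorphism of a fibre extends to a holomorphic family of linear maps respecting the
subbundle. -/
theorem exists_holomorphic_extension (hF : Module.finrank ℂ F = r)
    (hFH : Module.finrank ℂ FH = Module.finrank ℂ W) (j : IsotropicSubbundle FH H φ) {x₀ : X}
    (u : AdaptedFrame j B W x₀) :
    ∃ f : ∀ x, (Fin r → ℂ) →ₗ[ℂ] E x, f x₀ = u.1.1 ∧ (∀ v, HolAt F E (fun x => f x v) x₀) ∧
      ∀ x, ∀ w ∈ W, f x w ∈ LinearMap.range (j.incl x) := by
  obtain ⟨bE, U, hU, hbE⟩ := hasLocalFrames_vectorBundle (F := F) (E := E) hF x₀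
  obtain ⟨bH, U', hU', hbH⟩ := hasLocalFrames_vectorBundle (F := FH) (E := H) hFH x₀
  obtain ⟨P, hP⟩ := LinearMap.exists_leftInverse_of_injective W.subtype (Submodule.ker_subtype W)
  have hPW : ∀ w (hw : w ∈ W), P w = ⟨w, hw⟩ := fun w hw => LinearMap.congr_fun hP ⟨w, hw⟩
  let i₀ : H x₀ ≃ₗ[ℂ] LinearMap.range (j.incl x₀) := LinearEquiv.ofInjective _ (j.injective x₀)
  let h : W →ₗ[ℂ] H x₀ := i₀.symm.toLinearMap ∘ₗ
    ((u.1.1 : (Fin r → ℂ) →ₗ[ℂ] E x₀) ∘ₗ W.subtype).codRestrict _ fun w => (u.2 w).2 w.2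
  have hh : ∀ w : W, j.incl x₀ (h w) = u.1.1 w := fun w =>
    congrArg Subtype.val (i₀.apply_symm_apply _)
  let τE : ∀ x, E x₀ →ₗ[ℂ] E x := fun x => ((bE x₀).equiv (bE x) (Equiv.refl _)).toLinearMap
  let τH : ∀ x, H x₀ →ₗ[ℂ] H x := fun x => ((bH x₀).equiv (bH x) (Equiv.refl _)).toLinearMap
  have hτE : ∀ x v, τE x v = ∑ k, (bE x₀).repr v k • bE x k := fun x v => by
    conv_lhs => rw [← (bE x₀).sum_repr v]
    simp only [τE, LinearEquiv.coe_coe, map_sum, map_smul, Module.Basis.equiv_apply,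
      Equiv.refl_apply]
  have hτH : ∀ x v, τH x v = ∑ k, (bH x₀).repr v k • bH x k := fun x v => by
    conv_lhs => rw [← (bH x₀).sum_repr v]
    simp only [τH, LinearEquiv.coe_coe, map_sum, map_smul, Module.Basis.equiv_apply,
      Equiv.refl_apply]
  refine ⟨fun x => j.incl x ∘ₗ τH x ∘ₗ h ∘ₗ P +
    τE x ∘ₗ (u.1.1 : (Fin r → ℂ) →ₗ[ℂ] E x₀) ∘ₗ (LinearMap.id - W.subtype ∘ₗ P), ?_, ?_, ?_⟩
  · refine LinearMap.ext fun v => ?_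
    have h1 : τH x₀ (h (P v)) = h (P v) := by rw [hτH, (bH x₀).sum_repr]
    have h2 : ∀ e, τE x₀ e = e := fun e => by rw [hτE, (bE x₀).sum_repr]
    simp [h1, h2, hh]
  · intro v
    have h1 : HolAt FH H (fun x => τH x (h (P v))) x₀ := by
      simp only [hτH]
      exact HolAt.sum_smul (fun _ _ => contMDiffAt_const) fun k _ => (hbH.2 k).holAt hbH.1 hU'
    have h2 : HolAt F E (fun x => τE x (u.1.1 (v - P v))) x₀ := by
      simp only [hτE]
      exact HolAt.sum_smul (fun _ _ => contMDiffAt_const) fun k _ => (hbE.2 k).holAt hbE.1 hU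
    exact (j.holAt h1).add_section h2
  · intro x w hw
    refine ⟨τH x (h (P w)), ?_⟩
    simp [hPW w hw]

theorem exists_holomorphic_adaptedFrame (hB : B.IsSymm) (hdet : B.det ≠ 0) (hW : IsIsotropic B W)
    (hF : Module.finrank ℂ F = r) (hFL : Module.finrank ℂ FL = 1)
    (hFH : Module.finrank ℂ FH = Module.finrank ℂ W) (j : IsotropicSubbundle FH H φ) (x₀ : X) :
    ∃ (u : ∀ x, AdaptedFrame j B W x) (U : Set X), x₀ ∈ U ∧ IsHolAdaptedFrame u U := by
  classical
  obtain ⟨bE, U, hU, hbE⟩ := hasLocalFrames_vectorBundle (F := F) (E := E) hF x₀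
  obtain ⟨bH, -⟩ := hasLocalFrames_vectorBundle (F := FH) (E := H) hFH x₀
  obtain ⟨bL, U', hU', hbL⟩ := hasLocalFrames_vectorBundle (F := FL) (E := L) hFL x₀
  have hne : ∀ x, Nonempty (AdaptedFrame j B W x) := fun x =>
    nonempty_adaptedFrame hB hdet hW (bE x) (bL x) (bH x)
  obtain ⟨u₀⟩ := hne x₀
  obtain ⟨f, hf₀, hfh, hfW⟩ := exists_holomorphic_extension hF hFH j u₀
  obtain ⟨t₀, ht₀, hut⟩ := u₀.1.2
  have hbij₀ : Function.Bijective (f x₀) := by rw [hf₀]; exact u₀.1.1.bijective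
  let a : ℂ := (bL x₀).repr t₀ 0
  have hat : t₀ = a • bL x₀ 0 := by
    conv_lhs => rw [← (bL x₀).sum_repr t₀]
    simp [a]
  have ha : a ≠ 0 := fun h => ht₀ (by rw [hat, h, zero_smul])
  let G : X → Matrix (Fin r) (Fin r) ℂ := fun x => a⁻¹ • gram φ (f x) (bL x)
  have hG₀ : G x₀ = B := by
    have h1 : gram φ (f x₀) (bL x₀) = a • B := by
      ext k l
      rw [gram_apply, hf₀]
      have := hut (Pi.single k 1) (Pi.single l 1)
      change φ.form x₀ (u₀.1.1 _) (u₀.1.1 _) = _ at this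
      rw [LinearEquiv.coe_coe, this, hat, smul_smul]
      simp [mul_comm]
    simp only [G]
    rw [h1, smul_smul, inv_mul_cancel₀ ha, one_smul]
  have hGh : ∀ k l, HolFun (fun x => G x k l) x₀ := by
    intro k l
    simp only [G, Matrix.smul_apply, gram_apply, smul_eq_mul]
    exact HolFun.mul contMDiffAt_const (HolAt.repr hFL (fun i => (hbL.2 i).holAt hbL.1 hU')
      (φ.holAt (hfh _) (hfh _)) 0)
  have hGform : ∀ x v w, φ.form x (f x v) (f x w) = (v ⬝ᵥ G x *ᵥ w) • (a • bL x 0) := by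
    intro x v w
    rw [form_eq_gram (f x) (bL x), smul_smul]
    simp only [G, Matrix.smul_mulVec, dotProduct_smul, smul_eq_mul]
    congr 1
    field_simp
  obtain ⟨Θ, hΘ, hΘ₁, hΘG⟩ := exists_analytic_normalization B hB hdet W hW
  have hΘh : ∀ k l, HolFun (fun x => Θ (G x) k l) x₀ :=
    HolFun.matrix_comp (by rw [hG₀]; exact hΘ) hGh
  have hΘdet : (Θ (G x₀)).det ≠ 0 := by rw [hG₀, hΘ₁]; simp
  let e : Module.Basis (Fin r) ℂ (Fin r → ℂ) := Pi.basisFun ℂ (Fin r)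
  let M : X → Matrix (Fin r) (Fin r) ℂ := fun x => LinearMap.toMatrix e (bE x) (f x)
  have hMh : ∀ k l, HolFun (fun x => M x k l) x₀ := by
    intro k l
    simp only [M, LinearMap.toMatrix_apply]
    exact HolAt.repr hF (fun i => (hbE.2 i).holAt hbE.1 hU) (hfh _) k
  have hM₀ : (M x₀).det ≠ 0 := by
    have := LinearEquiv.isUnit_det (LinearEquiv.ofBijective (f x₀) hbij₀) e (bE x₀)
    exact this.ne_zero
  have hbH' : ∀ x, FiniteDimensional ℂ (H x) := fun x => (bH x).finiteDimensional_of_finite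
  have hex : ∀ᶠ x in 𝓝 x₀, ∃ b : AdaptedFrame j B W x, ∀ v, b.1.1 v = f x ((Θ (G x))⁻¹ *ᵥ v) := by
    have hGc := continuousAt_of_holFun hGh
    rw [ContinuousAt, hG₀] at hGc
    filter_upwards [(HolFun.det hMh).continuousAt.eventually_ne hM₀,
      (HolFun.det hΘh).continuousAt.eventually_ne hΘdet, hGc.eventually hΘG] with x hx1 hx2 hx3
    have hbij : Function.Bijective (f x) :=
      (LinearEquiv.ofIsUnitDet (f := f x) (v := e) (v' := bE x)
        (isUnit_iff_ne_zero.2 hx1)).bijective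
    have hsymm : (G x).IsSymm := by
      simp only [G, Matrix.IsSymm, Matrix.transpose_smul]
      rw [gram_isSymm]
    have hiso : IsIsotropic (G x) W := fun v hv w hw => by
      simp only [G, Matrix.smul_mulVec, dotProduct_smul]
      rw [gram_isIsotropic j (hfW x) (bL x) v hv w hw, smul_zero]
    obtain ⟨hSW, hSG⟩ := hx3 hsymm hiso
    exact exists_adaptedFrame_of_gram hbij (mem_range_incl_iff
      (by rw [Module.finrank_eq_card_basis (bH x), Fintype.card_fin]) hbij.1 (hfW x))
      (smul_ne_zero ha ((bL x).ne_zero 0)) (hGform x) hx2 hSW hSG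
  let u : ∀ x, AdaptedFrame j B W x := fun x =>
    if h : ∃ b : AdaptedFrame j B W x, ∀ v, b.1.1 v = f x ((Θ (G x))⁻¹ *ᵥ v) then h.choose
    else (hne x).some
  have hu : ∀ᶠ x in 𝓝 x₀, ∀ v, (u x).1.1 v = f x ((Θ (G x))⁻¹ *ᵥ v) := by
    filter_upwards [hex] with x hx
    simp only [u, dif_pos hx]
    exact hx.choose_spec
  have hsum : ∀ x v, f x v = ∑ k, v k • f x (Pi.single k 1) := fun x v => by
    conv_lhs => rw [← Finset.univ_sum_single v, map_sum]
    refine Finset.sum_congr rfl fun k _ => ?_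
    rw [← map_smul, ← Pi.single_smul, smul_eq_mul, mul_one]
  have huh : ∀ v, HolAt F E (fun x => (u x).1.1 v) x₀ := fun v => by
    have h1 : HolAt F E (fun x => ∑ k, ((Θ (G x))⁻¹ *ᵥ v) k • f x (Pi.single k 1)) x₀ :=
      HolAt.sum_smul (fun k _ => HolFun.mulVec (v := fun _ => v) (HolFun.matrix_inv hΘh hΘdet)
        (fun _ => contMDiffAt_const) k) fun k _ => hfh _
    refine h1.congr (hu.mono fun x hx => ?_)
    rw [hx, hsum]
  obtain ⟨V, hV, hVo, hxV⟩ := mem_nhds_iff.1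
    (Filter.eventually_all.2 fun k : Fin r => (huh (Pi.single k 1)).eventually)
  refine ⟨u, V, hxV, hVo, fun v => isHolSection_of_holAt fun x hx => ?_⟩
  have h1 : ∀ y, (u y).1.1 v = ∑ k, v k • (u y).1.1 (Pi.single k 1) := fun y => by
    conv_lhs => rw [← Finset.univ_sum_single v, map_sum]
    refine Finset.sum_congr rfl fun k _ => ?_
    rw [← map_smul, ← Pi.single_smul, smul_eq_mul, mul_one]
  simp only [h1]
  exact HolAt.sum_smul (fun _ _ => contMDiffAt_const) fun k _ => hV hx k

end Local

end OrthBundle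

namespace OrthBundle

/-! ### Frames attached to an adapted frame -/

section AttachedFrames

variable {X : Type*} [TopologicalSpace X] [ChartedSpace ℂ X]
  {F : Type*} [NormedAddCommGroup F] [NormedSpace ℂ F]
  {FL : Type*} [NormedAddCommGroup FL] [NormedSpace ℂ FL]
  {FH : Type*} [NormedAddCommGroup FH] [NormedSpace ℂ FH]
  {E : X → Type*} [TopologicalSpace (TotalSpace F E)]
  [∀ x, AddCommGroup (E x)] [∀ x, Module ℂ (E x)] [∀ x, TopologicalSpace (E x)]
  [FiberBundle F E]
  {L : X → Type*} [TopologicalSpace (TotalSpace FL L)]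
  [∀ x, AddCommGroup (L x)] [∀ x, Module ℂ (L x)] [∀ x, TopologicalSpace (L x)]
  [FiberBundle FL L]
  {H : X → Type*} [TopologicalSpace (TotalSpace FH H)]
  [∀ x, AddCommGroup (H x)] [∀ x, Module ℂ (H x)] [∀ x, TopologicalSpace (H x)]
  [FiberBundle FH H] {φ : OrthogonalForm F FL E L} {j : IsotropicSubbundle FH H φ}
  {r : ℕ} {B : Matrix (Fin r) (Fin r) ℂ} {W : Submodule ℂ (Fin r → ℂ)} {x : X}

/-- The basis of the fibre of `E` given by an adapted frame. -/
def AdaptedFrame.basisE (u : AdaptedFrame j B W x) : Module.Basis (Fin r) ℂ (E x) :=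
  (Pi.basisFun ℂ (Fin r)).map u.1.1

theorem AdaptedFrame.basisE_apply (u : AdaptedFrame j B W x) (i : Fin r) :
    u.basisE i = u.1.1 (Pi.single i 1) := by
  simp [AdaptedFrame.basisE]

theorem AdaptedFrame.map_eq_range (u : AdaptedFrame j B W x) :
    Submodule.map (u.1.1 : (Fin r → ℂ) →ₗ[ℂ] E x) W = LinearMap.range (j.incl x) := by
  ext e
  constructor
  · rintro ⟨w, hw, rfl⟩
    exact (u.2 w).2 hw
  · intro he
    refine ⟨u.1.1.symm e, (u.2 _).1 ?_, u.1.1.apply_symm_apply e⟩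
    rwa [u.1.1.apply_symm_apply]

/-- The isomorphism of `W` with the fibre of `H` given by an adapted frame. -/
def AdaptedFrame.equivH (u : AdaptedFrame j B W x) : W ≃ₗ[ℂ] H x :=
  (u.1.1.ofSubmodules W _ u.map_eq_range).trans
    (LinearEquiv.ofInjective (j.incl x) (j.injective x)).symm

theorem AdaptedFrame.incl_equivH (u : AdaptedFrame j B W x) (w : W) :
    j.incl x (u.equivH w) = u.1.1 w :=
  congrArg Subtype.val ((LinearEquiv.ofInjective (j.incl x) (j.injective x)).apply_symm_apply _)

theorem AdaptedFrame.act_apply (u : AdaptedFrame j B W x) (g : parabolic B W) (v : Fin r → ℂ) :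
    (u.act g).1.1 v = u.1.1 (((g : GL (Fin r) ℂ) : Matrix (Fin r) (Fin r) ℂ) *ᵥ v) := rfl

theorem AdaptedFrame.act_act (u : AdaptedFrame j B W x) (g g' : parabolic B W) :
    (u.act g).act g' = u.act (g * g') := by
  refine Subtype.ext (Subtype.ext (LinearEquiv.ext fun v => ?_))
  rw [act_apply, act_apply, act_apply, Matrix.mulVec_mulVec]
  rfl

theorem AdaptedFrame.act_one (u : AdaptedFrame j B W x) : u.act 1 = u := by
  refine Subtype.ext (Subtype.ext (LinearEquiv.ext fun v => ?_))
  rw [act_apply, Subgroup.coe_one, Units.val_one, Matrix.one_mulVec]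

theorem AdaptedFrame.equivH_act (u : AdaptedFrame j B W x) (g : parabolic B W) (w : W) :
    (u.act g).equivH w = u.equivH (restrictToSubspace g w) :=
  j.injective x (by rw [incl_equivH, incl_equivH, act_apply, restrictToSubspace_apply])

theorem AdaptedFrame.basisE_toMatrix_act (u : AdaptedFrame j B W x) (g : parabolic B W) :
    u.basisE.toMatrix (u.act g).basisE = ((g : GL (Fin r) ℂ) : Matrix (Fin r) (Fin r) ℂ) := by
  ext k l
  rw [Module.Basis.toMatrix_apply, basisE_apply, act_apply, basisE, Module.Basis.map_repr]
  simp

theorem AdaptedFrame.basisE_det_act (u : AdaptedFrame j B W x) (g : parabolic B W) :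
    u.basisE.det (fun i => (u.act g).basisE i) =
      ((g : GL (Fin r) ℂ) : Matrix (Fin r) (Fin r) ℂ).det := by
  rw [Module.Basis.det_apply]
  exact congrArg Matrix.det (u.basisE_toMatrix_act g)

theorem AdaptedFrame.basisH_det_act {s : ℕ} (p : Module.Basis (Fin s) ℂ W)
    (u : AdaptedFrame j B W x) (g : parabolic B W) :
    (p.map u.equivH).det (fun i => (p.map (u.act g).equivH) i) =
      LinearMap.det (restrictToSubspace g) := by
  have h : u.equivH.symm ∘ (fun i => (p.map (u.act g).equivH) i) =
      restrictToSubspace g ∘ p := by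
    funext i
    simp only [Function.comp_apply, Module.Basis.map_apply, equivH_act,
      LinearEquiv.symm_apply_apply]
  rw [Module.Basis.det_map, h, Module.Basis.det_comp, p.det_self, mul_one]

theorem adjointAction_coe (g : parabolic B W) (A : parabolicLie B W) :
    (adjointAction g A : Matrix (Fin r) (Fin r) ℂ) = ((g : GL (Fin r) ℂ) : Matrix (Fin r) (Fin r) ℂ) *
      A * (((g⁻¹ : parabolic B W) : GL (Fin r) ℂ) : Matrix (Fin r) (Fin r) ℂ) := rfl

theorem adjointAction_inv_coe (g : parabolic B W) (A : parabolicLie B W) :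
    (adjointAction g⁻¹ A : Matrix (Fin r) (Fin r) ℂ) =
      (((g⁻¹ : parabolic B W) : GL (Fin r) ℂ) : Matrix (Fin r) (Fin r) ℂ) * A *
        ((g : GL (Fin r) ℂ) : Matrix (Fin r) (Fin r) ℂ) := by
  rw [adjointAction_coe, inv_inv]

theorem adjointAction_mul (g g' : parabolic B W) (A : parabolicLie B W) :
    adjointAction (g * g') A = adjointAction g (adjointAction g' A) := by
  refine Subtype.ext ?_
  rw [adjointAction_coe, adjointAction_coe, adjointAction_coe, mul_inv_rev]
  simp only [Subgroup.coe_mul, Units.val_mul, mul_assoc]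

theorem adjointFibre_act (f : adjointFibre j B W x) (u : AdaptedFrame j B W x)
    (g : parabolic B W) :
    (f : AdaptedFrame j B W x → parabolicLie B W) (u.act g) =
      adjointAction g⁻¹ ((f : AdaptedFrame j B W x → parabolicLie B W) u) :=
  Subtype.ext ((f.2 u g).trans (adjointAction_inv_coe g _).symm)

/-- Evaluation at an adapted frame identifies the fibre of the adjoint bundle with the Lie
algebra. -/
def AdaptedFrame.adjointEval (u : AdaptedFrame j B W x) :
    adjointFibre j B W x ≃ₗ[ℂ] parabolicLie B W :=
  LinearEquiv.ofBijective
    ((LinearMap.proj u : (AdaptedFrame j B W x → parabolicLie B W) →ₗ[ℂ] parabolicLie B W) ∘ₗ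
      (adjointFibre j B W x).subtype) (by
    constructor
    · rw [injective_iff_map_eq_zero]
      intro f hf
      refine Subtype.ext (funext fun u' => ?_)
      obtain ⟨g, hg, -⟩ := u.existsUnique_act u'
      have hf' : (f : AdaptedFrame j B W x → parabolicLie B W) u = 0 := hf
      rw [← hg, adjointFibre_act, hf', map_zero]
      rfl
    · intro A
      choose g hg hg' using fun u' : AdaptedFrame j B W x => u.existsUnique_act u'
      refine ⟨⟨fun u' => adjointAction (g u')⁻¹ A, fun u' h => ?_⟩, ?_⟩
      · have h1 : g (u'.act h) = g u' * h := by
          refine (hg' _ _ ?_).symm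
          have h2 : u.act (g u') = u' := hg u'
          change u.act (g u' * h) = u'.act h
          rw [← AdaptedFrame.act_act, h2]
        change (adjointAction (g (u'.act h))⁻¹ A : Matrix (Fin r) (Fin r) ℂ) = _
        rw [h1, mul_inv_rev, adjointAction_mul]
        exact adjointAction_inv_coe h _
      · have h1 : g u = 1 := (hg' u 1 u.act_one).symm
        change adjointAction (g u)⁻¹ A = A
        rw [h1]
        refine Subtype.ext ?_
        rw [adjointAction_inv_coe, inv_one, Subgroup.coe_one, Units.val_one, one_mul, mul_one])

theorem AdaptedFrame.adjointEval_apply (u : AdaptedFrame j B W x) (f : adjointFibre j B W x) :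
    u.adjointEval f = (f : AdaptedFrame j B W x → parabolicLie B W) u := rfl

theorem AdaptedFrame.adjointEval_act (u : AdaptedFrame j B W x) (g : parabolic B W)
    (f : adjointFibre j B W x) :
    u.adjointEval f = adjointAction g ((u.act g).adjointEval f) := by
  rw [adjointEval_apply, adjointEval_apply, adjointFibre_act, ← adjointAction_mul, mul_inv_cancel]
  refine Subtype.ext ?_
  rw [adjointAction_coe, inv_one, Subgroup.coe_one, Units.val_one, one_mul, mul_one]

variable {n : ℕ} (p : Module.Basis (Fin n) ℂ (parabolicLie B W))

theorem AdaptedFrame.det_adjointBasis (u : AdaptedFrame j B W x)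
    (b : Fin n → adjointFibre j B W x) :
    (p.map u.adjointEval.symm).det b = p.det (fun i => u.adjointEval (b i)) := by
  rw [Module.Basis.det_map]
  rfl

end AttachedFrames

/-! ### Holomorphy of the attached frames -/

section HolAttached

variable {X : Type*} [TopologicalSpace X] [ChartedSpace ℂ X] [IsManifold 𝓘(ℂ) ω X]
  {F : Type*} [NormedAddCommGroup F] [NormedSpace ℂ F]
  {FL : Type*} [NormedAddCommGroup FL] [NormedSpace ℂ FL]
  {FH : Type*} [NormedAddCommGroup FH] [NormedSpace ℂ FH]
  {E : X → Type*} [TopologicalSpace (TotalSpace F E)]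
  [∀ x, AddCommGroup (E x)] [∀ x, Module ℂ (E x)] [∀ x, TopologicalSpace (E x)]
  [FiberBundle F E] [VectorBundle ℂ F E] [ContMDiffVectorBundle ω F E 𝓘(ℂ)]
  {L : X → Type*} [TopologicalSpace (TotalSpace FL L)]
  [∀ x, AddCommGroup (L x)] [∀ x, Module ℂ (L x)] [∀ x, TopologicalSpace (L x)]
  [FiberBundle FL L] [VectorBundle ℂ FL L] [ContMDiffVectorBundle ω FL L 𝓘(ℂ)]
  {H : X → Type*} [TopologicalSpace (TotalSpace FH H)]
  [∀ x, AddCommGroup (H x)] [∀ x, Module ℂ (H x)] [∀ x, TopologicalSpace (H x)]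
  [FiberBundle FH H] [VectorBundle ℂ FH H] [ContMDiffVectorBundle ω FH H 𝓘(ℂ)]
  {φ : OrthogonalForm F FL E L} {j : IsotropicSubbundle FH H φ}
  {r : ℕ} {B : Matrix (Fin r) (Fin r) ℂ} {W : Submodule ℂ (Fin r → ℂ)}
  [FiniteDimensional ℂ F] [FiniteDimensional ℂ FH] {s n : ℕ}

/-- A section of a holomorphic subbundle is holomorphic if it is so as a section of the ambient
bundle. -/
theorem IsotropicSubbundle.holAt_of_incl (hF : Module.finrank ℂ F = r)
    (hFH : Module.finrank ℂ FH = s) {σ : ∀ x, H x} {x : X}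
    (hσ : HolAt F E (fun y => j.incl y (σ y)) x) : HolAt FH H σ x := by
  obtain ⟨bE, U, hU, hbE⟩ := hasLocalFrames_vectorBundle (F := F) (E := E) hF x
  obtain ⟨bH, U', hU', hbH⟩ := hasLocalFrames_vectorBundle (F := FH) (E := H) hFH x
  obtain ⟨g, hg⟩ := LinearMap.exists_leftInverse_of_injective (j.incl x)
    (LinearMap.ker_eq_bot.2 (j.injective x))
  let T : Matrix (Fin s) (Fin r) ℂ := LinearMap.toMatrix (bE x) (bH x) g
  let M : X → Matrix (Fin r) (Fin s) ℂ := fun y => LinearMap.toMatrix (bH y) (bE y) (j.incl y)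
  let A : X → Matrix (Fin s) (Fin s) ℂ := fun y => T * M y
  have hE : ∀ {τ : ∀ x, E x}, HolAt F E τ x → ∀ k, HolFun (fun y => (bE y).repr (τ y) k) x :=
    fun hτ k => HolAt.repr hF (fun i => (hbE.2 i).holAt hbE.1 hU) hτ k
  have hA : ∀ k l, HolFun (fun y => A y k l) x := by
    refine HolFun.matrix_mul (fun _ _ => contMDiffAt_const) fun k l => ?_
    simp only [M, LinearMap.toMatrix_apply]
    exact hE (j.holAt ((hbH.2 l).holAt hbH.1 hU')) k
  have hA₀ : (A x).det ≠ 0 := by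
    have : A x = 1 := by
      simp only [A, T, M]
      rw [← LinearMap.toMatrix_comp, hg, LinearMap.toMatrix_id]
    rw [this, Matrix.det_one]
    exact one_ne_zero
  let c : X → Fin s → ℂ := fun y =>
    (A y)⁻¹ *ᵥ (T *ᵥ fun k => (bE y).repr (j.incl y (σ y)) k)
  have hc : ∀ k, HolFun (fun y => c y k) x :=
    HolFun.mulVec (HolFun.matrix_inv hA hA₀) (HolFun.mulVec (fun _ _ => contMDiffAt_const) (hE hσ))
  have h1 : HolAt FH H (fun y => ∑ k, c y k • bH y k) x :=
    HolAt.sum_smul (fun k _ => hc k) fun k _ => (hbH.2 k).holAt hbH.1 hU'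
  refine h1.congr ?_
  filter_upwards [(HolFun.det hA).continuousAt.eventually_ne hA₀] with y hy
  have h2 : c y = (bH y).repr (σ y) := by
    have h3 : (fun k => (bE y).repr (j.incl y (σ y)) k) = M y *ᵥ (bH y).repr (σ y) :=
      (LinearMap.toMatrix_mulVec_repr (bH y) (bE y) (j.incl y) (σ y)).symm
    simp only [c, h3]
    rw [Matrix.mulVec_mulVec, Matrix.mulVec_mulVec, Matrix.mul_assoc,
      Matrix.nonsing_inv_mul _ (isUnit_iff_ne_zero.2 hy), Matrix.one_mulVec]
  rw [h2, (bH y).sum_repr]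

theorem IsHolAdaptedFrame.isHolFrame_basisE {u : ∀ x, AdaptedFrame j B W x} {U : Set X}
    (hu : IsHolAdaptedFrame u U) :
    IsHolFrame (IsHolSection F E) (fun x => (u x).basisE) U := by
  refine ⟨hu.1, fun i => ?_⟩
  simp only [AdaptedFrame.basisE_apply]
  exact hu.2 _

theorem IsHolAdaptedFrame.isHolFrame_basisH (hF : Module.finrank ℂ F = r)
    (hFH : Module.finrank ℂ FH = s) (p : Module.Basis (Fin s) ℂ W)
    {u : ∀ x, AdaptedFrame j B W x} {U : Set X} (hu : IsHolAdaptedFrame u U) :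
    IsHolFrame (IsHolSection FH H) (fun x => p.map (u x).equivH) U := by
  refine ⟨hu.1, fun i => isHolSection_of_holAt fun x hx => j.holAt_of_incl hF hFH ?_⟩
  simp only [Module.Basis.map_apply, AdaptedFrame.incl_equivH]
  exact (hu.2 _).holAt hu.1 hx

theorem IsHolAdaptedFrame.mono {u : ∀ x, AdaptedFrame j B W x} {U U' : Set X}
    (hu : IsHolAdaptedFrame u U) (hU' : IsOpen U') (h : U' ⊆ U) : IsHolAdaptedFrame u U' :=
  ⟨hU', fun v => (hu.2 v).mono h⟩

theorem IsHolAdaptedFrame.isHolFrame_adjointBasis (hF : Module.finrank ℂ F = r)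
    (p : Module.Basis (Fin n) ℂ (parabolicLie B W)) {u : ∀ x, AdaptedFrame j B W x} {U : Set X}
    (hu : IsHolAdaptedFrame u U) :
    IsHolFrame (IsHolAdjointSection (j := j) (B := B) (W := W))
      (fun x => p.map (u x).adjointEval.symm) U := by
  refine ⟨hu.1, fun i u' U' hU' hu' k l x hx => ContMDiffAt.contMDiffWithinAt ?_⟩
  let M : X → Matrix (Fin r) (Fin r) ℂ := fun y => (u y).basisE.toMatrix (u' y).basisE
  have hM : ∀ k l, HolFun (fun y => M y k l) x := fun k l =>
    HolAt.repr hF (fun i => (hu.isHolFrame_basisE.2 i).holAt hu.1 (hU' hx))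
      ((hu'.isHolFrame_basisE.2 l).holAt hu'.1 hx) k
  have hM₀ : (M x).det ≠ 0 := by
    have := (u x).basisE.isUnit_det (u' x).basisE
    rw [Module.Basis.det_apply] at this
    exact this.ne_zero
  have key : ∀ y, (((p.map (u y).adjointEval.symm) i : AdaptedFrame j B W y → parabolicLie B W)
      (u' y) : Matrix (Fin r) (Fin r) ℂ) = (M y)⁻¹ * (p i : Matrix (Fin r) (Fin r) ℂ) * M y := by
    intro y
    obtain ⟨g, hg, -⟩ := (u y).existsUnique_act (u' y)
    have hMg : M y = ((g : GL (Fin r) ℂ) : Matrix (Fin r) (Fin r) ℂ) := by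
      simp only [M]
      rw [← hg, AdaptedFrame.basisE_toMatrix_act]
    have hMi : (M y)⁻¹ = (((g⁻¹ : parabolic B W) : GL (Fin r) ℂ) : Matrix (Fin r) (Fin r) ℂ) :=
      Matrix.inv_eq_left_inv (by rw [hMg, parabolic_inv_mul])
    rw [← hg, adjointFibre_act, adjointAction_inv_coe, ← AdaptedFrame.adjointEval_apply,
      Module.Basis.map_apply, LinearEquiv.apply_symm_apply, hMi, hMg]
  have h1 := HolFun.matrix_mul (HolFun.matrix_mul (HolFun.matrix_inv hM hM₀)
    (B := fun _ => (p i : Matrix (Fin r) (Fin r) ℂ)) fun _ _ => contMDiffAt_const) hM k l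
  exact h1.congr_of_eventuallyEq
    (Filter.Eventually.of_forall fun y => congrFun (congrFun (key y) k) l)

/-- The determinant of a holomorphic frame of the adjoint bundle with respect to the frame attached
to a holomorphic adapted frame is holomorphic. -/
theorem holFun_det_adjointBasis (p : Module.Basis (Fin n) ℂ (parabolicLie B W))
    {u : ∀ x, AdaptedFrame j B W x} {U : Set X} (hu : IsHolAdaptedFrame u U)
    {b : ∀ x, Module.Basis (Fin n) ℂ (adjointFibre j B W x)} {U' : Set X}
    (hb : IsHolFrame (IsHolAdjointSection (j := j) (B := B) (W := W)) b U') {x : X} (hx : x ∈ U)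
    (hx' : x ∈ U') :
    HolFun (fun y => (p.map (u y).adjointEval.symm).det (fun i => b y i)) x := by
  have hopen := hu.1.inter hb.1
  have h1 : ∀ i k l, HolFun (fun y => ((u y).adjointEval (b y i) : Matrix (Fin r) (Fin r) ℂ) k l) x :=
    fun i k l => (hb.2 i u (U ∩ U') inter_subset_right (hu.mono hopen inter_subset_left) k
      l).contMDiffAt (hopen.mem_nhds ⟨hx, hx'⟩)
  have h0 : (fun y => (p.map (u y).adjointEval.symm).det (fun i => b y i)) =
      fun y => p.det (fun i => (u y).adjointEval (b y i)) :=
    funext fun y => (u y).det_adjointBasis p _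
  rw [h0]
  simp only [Module.Basis.det_apply]
  refine HolFun.det fun k i => ?_
  obtain ⟨q, hq⟩ := LinearMap.exists_extend (p.coord k)
  have h2 : ∀ A : parabolicLie B W, p.repr A k =
      ∑ a, ∑ c, (A : Matrix (Fin r) (Fin r) ℂ) a c * q (Matrix.single a c 1) := by
    intro A
    have h3 : p.repr A k = q (A : Matrix (Fin r) (Fin r) ℂ) := (LinearMap.congr_fun hq A).symm
    rw [h3]
    conv_lhs => rw [Matrix.matrix_eq_sum_single (A : Matrix (Fin r) (Fin r) ℂ)]
    simp only [map_sum]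
    refine Finset.sum_congr rfl fun a _ => Finset.sum_congr rfl fun c _ => ?_
    rw [← smul_eq_mul, ← map_smul, Matrix.smul_single, smul_eq_mul, mul_one]
  simp only [Module.Basis.toMatrix_apply, h2]
  exact HolFun.sum fun a _ => HolFun.sum fun c _ => (h1 i a c).mul contMDiffAt_const

end HolAttached

end OrthBundle

namespace OrthBundle

/-! ### The induced metric on the determinant of the adjoint bundle -/

section InducedMetric

variable {X : Type*} [TopologicalSpace X] [ChartedSpace ℂ X] [IsManifold 𝓘(ℂ) ω X]
  {F : Type*} [NormedAddCommGroup F] [NormedSpace ℂ F]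
  {FL : Type*} [NormedAddCommGroup FL] [NormedSpace ℂ FL]
  {FH : Type*} [NormedAddCommGroup FH] [NormedSpace ℂ FH]
  {E : X → Type*} [TopologicalSpace (TotalSpace F E)]
  [∀ x, AddCommGroup (E x)] [∀ x, Module ℂ (E x)] [∀ x, TopologicalSpace (E x)]
  [FiberBundle F E] [VectorBundle ℂ F E] [ContMDiffVectorBundle ω F E 𝓘(ℂ)]
  {L : X → Type*} [TopologicalSpace (TotalSpace FL L)]
  [∀ x, AddCommGroup (L x)] [∀ x, Module ℂ (L x)] [∀ x, TopologicalSpace (L x)]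
  [FiberBundle FL L] [VectorBundle ℂ FL L] [ContMDiffVectorBundle ω FL L 𝓘(ℂ)]
  {H : X → Type*} [TopologicalSpace (TotalSpace FH H)]
  [∀ x, AddCommGroup (H x)] [∀ x, Module ℂ (H x)] [∀ x, TopologicalSpace (H x)]
  [FiberBundle FH H] [VectorBundle ℂ FH H] [ContMDiffVectorBundle ω FH H 𝓘(ℂ)]
  {φ : OrthogonalForm F FL E L} {j : IsotropicSubbundle FH H φ}
  {r : ℕ} {B : Matrix (Fin r) (Fin r) ℂ} {W : Submodule ℂ (Fin r → ℂ)} {n : ℕ}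

variable (j B W) in
/-- A system of frames, attached to adapted frames, of a bundle on which the structure group acts
with the determinant of the adjoint representation. -/
structure AttachedFraming (V : X → Type*) [∀ x, AddCommGroup (V x)] [∀ x, Module ℂ (V x)]
    (hol : (∀ x, V x) → Set X → Prop) (n : ℕ) where
  frame : ∀ x, AdaptedFrame j B W x → Module.Basis (Fin n) ℂ (V x)
  det_act : ∀ x (u : AdaptedFrame j B W x) (g : parabolic B W),
    (frame x u).det (fun i => frame x (u.act g) i) = LinearMap.det (adjointAction g)
  isHolFrame : ∀ (u : ∀ x, AdaptedFrame j B W x) (U : Set X), IsHolAdaptedFrame u U →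
    IsHolFrame hol (fun x => frame x (u x)) U
  holFun_det : ∀ (u : ∀ x, AdaptedFrame j B W x) (U : Set X)
    (b : ∀ x, Module.Basis (Fin n) ℂ (V x)) (U' : Set X), IsHolAdaptedFrame u U →
    IsHolFrame hol b U' → ∀ x ∈ U, x ∈ U' → HolFun (fun y => (frame y (u y)).det (fun i => b y i)) x

variable {V : X → Type*} [∀ x, AddCommGroup (V x)] [∀ x, Module ℂ (V x)]
  {hol : (∀ x, V x) → Set X → Prop}

/-- The logarithm of the squared length of the determinant of a basis `b` of a fibre of `V`, for the
metric induced by metrics on the determinants of `E` and `H`; it is computed in the frame attached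
to an adapted frame `u`. -/
def inducedLogNorm (A : AttachedFraming j B W V hol n) (NE : DetMetric E (IsHolSection F E) r)
    (NH : DetMetric H (IsHolSection FH H) (Module.finrank ℂ W)) {x : X} (u : AdaptedFrame j B W x)
    (b : Module.Basis (Fin n) ℂ (V x)) : ℝ :=
  2 * Real.log ‖(A.frame x u).det (fun i => b i)‖ +
    (((r : ℝ) - Module.finrank ℂ W - 1) *
        Real.log (NH.normSq x ((Module.finBasis ℂ W).map u.equivH)) +
      -((Module.finrank ℂ W : ℝ) * ((r : ℝ) - Module.finrank ℂ W - 1) / r) *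
        Real.log (NE.normSq x u.basisE))

variable (A : AttachedFraming j B W V hol n) (NE : DetMetric E (IsHolSection F E) r)
  (NH : DetMetric H (IsHolSection FH H) (Module.finrank ℂ W))

theorem log_norm_det_mul {M : Type*} [AddCommGroup M] [Module ℂ M]
    (b b' b'' : Module.Basis (Fin n) ℂ M) :
    Real.log ‖b.det (fun i => b'' i)‖ =
      Real.log ‖b.det (fun i => b' i)‖ + Real.log ‖b'.det (fun i => b'' i)‖ := by
  rw [← Real.log_mul (norm_ne_zero_iff.2 (det_basis_ne_zero b b'))
    (norm_ne_zero_iff.2 (det_basis_ne_zero b' b'')), ← norm_mul]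
  exact congrArg (fun z : ℂ => Real.log ‖z‖) (b.det_mul_det b' b'').symm

theorem inducedLogNorm_congr (hr : r ≠ 0) (hB : B.IsSymm) (hdet : B.det ≠ 0)
    (hW : IsIsotropic B W) {x : X} (u u' : AdaptedFrame j B W x)
    (b : Module.Basis (Fin n) ℂ (V x)) :
    inducedLogNorm A NE NH u b = inducedLogNorm A NE NH u' b := by
  obtain ⟨g, rfl, -⟩ := u.existsUnique_act u'
  have h4 := log_norm_det_adjointAction hr hB hdet hW g
  rw [inducedLogNorm, inducedLogNorm, log_norm_det_mul _ (A.frame x (u.act g)) b, A.det_act, h4,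
    NE.log_change x u.basisE (u.act g).basisE, u.basisE_det_act g,
    NH.log_change x ((Module.finBasis ℂ W).map u.equivH)
      ((Module.finBasis ℂ W).map (u.act g).equivH), AdaptedFrame.basisH_det_act]
  ring

theorem inducedLogNorm_change {x : X} (u : AdaptedFrame j B W x)
    (b b' : Module.Basis (Fin n) ℂ (V x)) :
    inducedLogNorm A NE NH u b' =
      Real.log (‖b.det (fun i => b' i)‖ ^ 2) + inducedLogNorm A NE NH u b := by
  rw [inducedLogNorm, inducedLogNorm, log_norm_det_mul _ b b', Real.log_pow]
  push_cast
  ring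

theorem inducedLogNorm_self {x : X} (u : AdaptedFrame j B W x) :
    inducedLogNorm A NE NH u (A.frame x u) =
      ((r : ℝ) - Module.finrank ℂ W - 1) *
        Real.log (NH.normSq x ((Module.finBasis ℂ W).map u.equivH)) +
      -((Module.finrank ℂ W : ℝ) * ((r : ℝ) - Module.finrank ℂ W - 1) / r) *
        Real.log (NE.normSq x u.basisE) := by
  have h : (A.frame x u).det (fun i => A.frame x u i) = 1 := (A.frame x u).det_self
  rw [inducedLogNorm, h, norm_one, Real.log_one, mul_zero, zero_add]

variable [FiniteDimensional ℂ F] [FiniteDimensional ℂ FL] [FiniteDimensional ℂ FH]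

theorem contMDiffAt_inducedLogNorm (hF : Module.finrank ℂ F = r)
    (hFH : Module.finrank ℂ FH = Module.finrank ℂ W) {u : ∀ x, AdaptedFrame j B W x} {U : Set X}
    (hu : IsHolAdaptedFrame u U) {b : ∀ x, Module.Basis (Fin n) ℂ (V x)}
    {U' : Set X} (hb : IsHolFrame hol b U') {x : X}
    (hx : x ∈ U) (hx' : x ∈ U') :
    ContMDiffAt 𝓘(ℝ, ℂ) 𝓘(ℝ) ∞ (fun y => inducedLogNorm A NE NH (u y) (b y)) x := by
  have h1 := contMDiffAt_log_normSq (A.holFun_det u U b U' hu hb x hx hx')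
    (det_basis_ne_zero _ _)
  simp only [Real.log_pow, Nat.cast_ofNat] at h1
  have h2 := NH.contMDiffAt_log (hu.isHolFrame_basisH hF hFH (Module.finBasis ℂ W)) hx
  have h3 := NE.contMDiffAt_log hu.isHolFrame_basisE hx
  exact h1.add ((contMDiffAt_const.mul h2).add (contMDiffAt_const.mul h3))

theorem AttachedFraming.hasHolTransitions (hB : B.IsSymm) (hdet : B.det ≠ 0) (hW : IsIsotropic B W)
    (hF : Module.finrank ℂ F = r) (hFL : Module.finrank ℂ FL = 1)
    (hFH : Module.finrank ℂ FH = Module.finrank ℂ W)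
    (A : AttachedFraming j B W V hol n) :
    HasHolTransitions hol n := by
  intro b b' U U' hb hb' x hx hx'
  obtain ⟨u, V', hxV, hu⟩ := exists_holomorphic_adaptedFrame hB hdet hW hF hFL hFH j x
  have h1 := A.holFun_det u V' b U hu hb x hxV hx
  have h2 := A.holFun_det u V' b' U' hu hb' x hxV hx'
  refine ((h1.inv₀ (det_basis_ne_zero _ _)).mul h2).congr_of_eventuallyEq
    (Filter.Eventually.of_forall fun y => ?_)
  have h3 : (A.frame y (u y)).det (fun i => b y i) * (b y).det (fun i => b' y i) =
      (A.frame y (u y)).det (fun i => b' y i) :=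
    (A.frame y (u y)).det_mul_det (b y) (b' y)
  change _ = ((A.frame y (u y)).det (fun i => b y i))⁻¹ *
    (A.frame y (u y)).det (fun i => b' y i)
  rw [← h3, inv_mul_cancel_left₀ (det_basis_ne_zero _ _)]

theorem AttachedFraming.hasLocalFrames (hB : B.IsSymm) (hdet : B.det ≠ 0) (hW : IsIsotropic B W)
    (hF : Module.finrank ℂ F = r) (hFL : Module.finrank ℂ FL = 1)
    (hFH : Module.finrank ℂ FH = Module.finrank ℂ W)
    (A : AttachedFraming j B W V hol n) :
    HasLocalFrames hol n := by
  intro x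
  obtain ⟨u, V', hxV, hu⟩ := exists_holomorphic_adaptedFrame hB hdet hW hF hFL hFH j x
  exact ⟨_, V', hxV, A.isHolFrame u V' hu⟩

/-- The metric on the determinant induced by metrics on the determinants of
`E` and `H`. -/
theorem exists_inducedMetric (hr : r ≠ 0) (hB : B.IsSymm) (hdet : B.det ≠ 0) (hW : IsIsotropic B W)
    (hF : Module.finrank ℂ F = r) (hFL : Module.finrank ℂ FL = 1)
    (hFH : Module.finrank ℂ FH = Module.finrank ℂ W) :
    ∃ N : DetMetric V hol n,
      ∀ x (u : AdaptedFrame j B W x) b,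
        Real.log (N.normSq x b) = inducedLogNorm A NE NH u b := by
  choose u₀ V' hV hu₀ using exists_holomorphic_adaptedFrame hB hdet hW hF hFL hFH j
  refine ⟨⟨fun x b => Real.exp (inducedLogNorm A NE NH (u₀ x x) b), fun _ _ => Real.exp_pos _,
    fun x b b' => ?_, fun b U hb x hx => ?_⟩, fun x u b => ?_⟩
  · rw [inducedLogNorm_change A NE NH (u₀ x x) b b', Real.exp_add,
      Real.exp_log (pow_pos (norm_pos_iff.2 (det_basis_ne_zero b b')) 2)]
  · refine ContMDiffAt.contMDiffWithinAt ?_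
    have h1 := contMDiffAt_inducedLogNorm A NE NH hF hFH (hu₀ x) hb (hV x) hx
    have h2 : (fun y => Real.exp (inducedLogNorm A NE NH (u₀ y y) (b y))) =
        Real.exp ∘ fun y => inducedLogNorm A NE NH (u₀ x y) (b y) :=
      funext fun y => congrArg Real.exp
        (inducedLogNorm_congr A NE NH hr hB hdet hW (u₀ y y) (u₀ x y) (b y))
    rw [h2]
    exact Real.contDiff_exp.contDiffAt.contMDiffAt.comp x h1
  · change Real.log (Real.exp _) = _
    rw [Real.log_exp]
    exact inducedLogNorm_congr A NE NH hr hB hdet hW _ u b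

theorem AttachedFraming.degreeOf_eq_combination [T2Space X] [CompactSpace X] (hr : r ≠ 0) (hB : B.IsSymm)
    (hdet : B.det ≠ 0) (hW : IsIsotropic B W) (hF : Module.finrank ℂ F = r)
    (hFL : Module.finrank ℂ FL = 1) (hFH : Module.finrank ℂ FH = Module.finrank ℂ W)
    (A : AttachedFraming j B W V hol n) :
    degreeOf V hol n =
      ((r : ℝ) - Module.finrank ℂ W - 1) *
        degreeOf H (IsHolSection FH H) (Module.finrank ℂ W) +
      -((Module.finrank ℂ W : ℝ) * ((r : ℝ) - Module.finrank ℂ W - 1) / r) *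
        degreeOf E (IsHolSection F E) r := by
  have hE := hasLocalFrames_vectorBundle (F := F) (E := E) hF
  have hE' := hasHolTransitions_vectorBundle (F := F) (E := E) hF
  have hH := hasLocalFrames_vectorBundle (F := FH) (E := H) hFH
  have hH' := hasHolTransitions_vectorBundle (F := FH) (E := H) hFH
  have hA := A.hasLocalFrames hB hdet hW hF hFL hFH
  have hA' := A.hasHolTransitions hB hdet hW hF hFL hFH
  obtain ⟨NE⟩ := nonempty_detMetric hE hE'
  obtain ⟨NH⟩ := nonempty_detMetric hH hH'
  obtain ⟨N, hN⟩ := exists_inducedMetric A NE NH hr hB hdet hW hF hFL hFH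
  rw [degreeOf_eq N hA hA', degreeOf_eq NE hE hE', degreeOf_eq NH hH hH',
    ← surfaceIntegral_const_mul, ← surfaceIntegral_const_mul, ← surfaceIntegral_add
      (fun x => continuousOn_const.mul (NH.isContForm_chernForm hH hH' x))
      (fun x => continuousOn_const.mul (NE.isContForm_chernForm hE hE' x))]
  refine surfaceIntegral_congr fun x z hz => ?_
  obtain ⟨u, V', hV, hu⟩ := exists_holomorphic_adaptedFrame hB hdet hW hF hFL hFH j
    ((chartAt ℂ x).symm z)
  have huH := hu.isHolFrame_basisH hF hFH (Module.finBasis ℂ W)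
  rw [N.chernForm_eq hA' (A.isHolFrame u V' hu) x hz hV,
    NE.chernForm_eq hE' hu.isHolFrame_basisE x hz hV, NH.chernForm_eq hH' huH x hz hV]
  have h1 := (contDiffAt_comp_chart_symm x hz (NH.contMDiffAt_log huH hV)).of_le two_le_smooth
  have h2 := (contDiffAt_comp_chart_symm x hz
    (NE.contMDiffAt_log hu.isHolFrame_basisE hV)).of_le two_le_smooth
  have h3 : (fun y => Real.log (N.normSq y (A.frame y (u y)))) ∘
        (chartAt ℂ x).symm =
      ((r : ℝ) - Module.finrank ℂ W - 1) •
        ((fun y => Real.log (NH.normSq y ((Module.finBasis ℂ W).map (u y).equivH))) ∘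
          (chartAt ℂ x).symm) +
      (-((Module.finrank ℂ W : ℝ) * ((r : ℝ) - Module.finrank ℂ W - 1) / r)) •
        ((fun y => Real.log (NE.normSq y (u y).basisE)) ∘ (chartAt ℂ x).symm) := by
    funext w
    exact (hN _ (u _) _).trans (inducedLogNorm_self A NE NH (u _))
  have hsmul : ∀ (a : ℝ) {f : ℂ → ℝ}, ContDiffAt ℝ 2 f z → ContDiffAt ℝ 2 (a • f) z :=
    fun a _ hf => contDiffAt_const.smul hf
  rw [h3, ContDiffAt.laplacian_add (hsmul _ h1) (hsmul _ h2),
    InnerProductSpace.laplacian_smul _ h1, InnerProductSpace.laplacian_smul _ h2, smul_eq_mul,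
    smul_eq_mul]
  ring

theorem _root_.Module.Basis.det_map_symm {M Q : Type*} [AddCommGroup M] [Module ℂ M]
    [AddCommGroup Q] [Module ℂ Q] (p : Module.Basis (Fin n) ℂ Q) (e e' : M ≃ₗ[ℂ] Q)
    (T : Q →ₗ[ℂ] Q) (h : ∀ f, e f = T (e' f)) :
    (p.map e.symm).det (fun i => p.map e'.symm i) = LinearMap.det T := by
  have h1 : e.symm.symm ∘ (fun i => p.map e'.symm i) = T ∘ p := by
    funext i
    change e (e'.symm (p i)) = T (p i)
    rw [h, e'.apply_symm_apply]
  rw [Module.Basis.det_map, h1, Module.Basis.det_comp, p.det_self, mul_one]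

/-- The system of frames obtained from a basis of the Lie algebra and identifications of the fibres
with it which transform by the adjoint representation. -/
def AttachedFraming.ofEquiv (p : Module.Basis (Fin n) ℂ (parabolicLie B W))
    (ev : ∀ x, AdaptedFrame j B W x → (V x ≃ₗ[ℂ] parabolicLie B W))
    (hev : ∀ x (u : AdaptedFrame j B W x) (g : parabolic B W) (f : V x),
      ev x u f = adjointAction g (ev x (u.act g) f))
    (hol_frame : ∀ (u : ∀ x, AdaptedFrame j B W x) (U : Set X), IsHolAdaptedFrame u U →
      IsHolFrame hol (fun x => p.map (ev x (u x)).symm) U)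
    (hol_det : ∀ (u : ∀ x, AdaptedFrame j B W x) (U : Set X)
      (b : ∀ x, Module.Basis (Fin n) ℂ (V x)) (U' : Set X), IsHolAdaptedFrame u U →
      IsHolFrame hol b U' → ∀ x ∈ U, x ∈ U' →
        HolFun (fun y => (p.map (ev y (u y)).symm).det (fun i => b y i)) x) :
    AttachedFraming j B W V hol n where
  frame x u := p.map (ev x u).symm
  det_act x u g := p.det_map_symm _ _ _ (hev x u g)
  isHolFrame := hol_frame
  holFun_det := hol_det

/-- The frames of the adjoint bundle attached to adapted frames. -/
def adjointFraming (hF : Module.finrank ℂ F = r) (p : Module.Basis (Fin n) ℂ (parabolicLie B W)) :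
    AttachedFraming j B W (fun x => adjointFibre j B W x)
      (IsHolAdjointSection (j := j) (B := B) (W := W)) n :=
  AttachedFraming.ofEquiv p (fun _ u => u.adjointEval) (fun _ u g f => u.adjointEval_act g f)
    (fun _ _ hu => hu.isHolFrame_adjointBasis hF p)
    (fun _ _ _ _ hu hb _ hx hx' => holFun_det_adjointBasis p hu hb hx hx')

end InducedMetric

end OrthBundle

end

theorem mainTheorem12
    {X : Type*} [TopologicalSpace X] [T2Space X] [CompactSpace X] [ConnectedSpace X]
    [ChartedSpace ℂ X] [IsManifold 𝓘(ℂ) ω X]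
    -- a nondegenerate symmetric bilinear form on `ℂʳ` and an isotropic subspace of dimension `s`
    {r s : ℕ} (hr : 3 ≤ r) (hs : 1 ≤ s)
    (B : Matrix (Fin r) (Fin r) ℂ) (hBsymm : B.IsSymm) (hBdet : B.det ≠ 0)
    (W : Submodule ℂ (Fin r → ℂ)) (hW : OrthBundle.IsIsotropic B W)
    (hWs : Module.finrank ℂ W = s)
    -- the holomorphic vector bundles `E`, `L`, `H`, of ranks `r`, `1`, `s`
    {F : Type*} [NormedAddCommGroup F] [NormedSpace ℂ F] [FiniteDimensional ℂ F]
    (hF : Module.finrank ℂ F = r)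
    {FL : Type*} [NormedAddCommGroup FL] [NormedSpace ℂ FL] [FiniteDimensional ℂ FL]
    (hFL : Module.finrank ℂ FL = 1)
    {FH : Type*} [NormedAddCommGroup FH] [NormedSpace ℂ FH] [FiniteDimensional ℂ FH]
    (hFH : Module.finrank ℂ FH = s)
    (E : X → Type*) [TopologicalSpace (TotalSpace F E)] [∀ x, AddCommGroup (E x)]
    [∀ x, Module ℂ (E x)] [∀ x, TopologicalSpace (E x)] [FiberBundle F E] [VectorBundle ℂ F E]
    [ContMDiffVectorBundle ω F E 𝓘(ℂ)]
    (L : X → Type*) [TopologicalSpace (TotalSpace FL L)] [∀ x, AddCommGroup (L x)]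
    [∀ x, Module ℂ (L x)] [∀ x, TopologicalSpace (L x)] [FiberBundle FL L] [VectorBundle ℂ FL L]
    [ContMDiffVectorBundle ω FL L 𝓘(ℂ)]
    (H : X → Type*) [TopologicalSpace (TotalSpace FH H)] [∀ x, AddCommGroup (H x)]
    [∀ x, Module ℂ (H x)] [∀ x, TopologicalSpace (H x)] [FiberBundle FH H] [VectorBundle ℂ FH H]
    [ContMDiffVectorBundle ω FH H 𝓘(ℂ)]
    -- the orthogonal structure of `E` and the inclusion of `H` as an isotropic subbundle
    (φ : OrthBundle.OrthogonalForm F FL E L) (j : OrthBundle.IsotropicSubbundle FH H φ) :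
    -- `P^Q` is a holomorphic reduction and `P^Q(𝔮)` a holomorphic vector bundle of rank `dim 𝔮`
    (∀ x₀ : X, ∃ (u : ∀ x, OrthBundle.AdaptedFrame j B W x) (U : Set X),
      x₀ ∈ U ∧ OrthBundle.IsHolAdaptedFrame u U) ∧
    OrthBundle.HasLocalFrames (OrthBundle.IsHolAdjointSection (j := j) (B := B) (W := W))
      (Module.finrank ℂ (OrthBundle.parabolicLie B W)) ∧
    -- the degree of `P^Q(𝔮)`
    OrthBundle.degreeOf (fun x => OrthBundle.adjointFibre j B W x)
        (OrthBundle.IsHolAdjointSection (j := j) (B := B) (W := W))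
        (Module.finrank ℂ (OrthBundle.parabolicLie B W)) =
      (OrthBundle.degree FH H / s - OrthBundle.degree F E / r) * s * ((r : ℝ) - s - 1) ∧
    -- the dimension of `𝔮`
    (Module.finrank ℂ (OrthBundle.parabolicLie B W) : ℝ) =
      ((r : ℝ) ^ 2 - r) / 2 - (2 * (r : ℝ) * s - 3 * (s : ℝ) ^ 2 - s) / 2 + 1 := by
  subst hWs
  have hr0 : r ≠ 0 := by omega
  have hs0 : (Module.finrank ℂ W : ℝ) ≠ 0 := by
    have : Module.finrank ℂ W ≠ 0 := by omega
    exact_mod_cast this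
  let A := OrthBundle.adjointFraming (j := j) hF (Module.finBasis ℂ (OrthBundle.parabolicLie B W))
  refine ⟨OrthBundle.exists_holomorphic_adaptedFrame hBsymm hBdet hW hF hFL hFH j,
    A.hasLocalFrames hBsymm hBdet hW hF hFL hFH, ?_,
    OrthBundle.finrank_parabolicLie_eq hr0 hBsymm hBdet hW⟩
  rw [A.degreeOf_eq_combination hr0 hBsymm hBdet hW hF hFL hFH, OrthBundle.degree,
    OrthBundle.degree, hF, hFH]
  field_simp
  ring
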